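/- **Pure system.** Pure types are the closed expressions $A,B ::= \mathbf 1 \mid A\times B\mid B\to A\mid A+B\mid \alpha\mid \mathrm{rec}\,\alpha.A$ (with $\alpha$ allowed on both sides of arrows). Terms are $M,N ::= x\mid \lambda x.M\mid MN\mid \mathrm{fix}\,x.M\mid\langle\rangle\mid\langle M,N\rangle\mid\pi_iM\mid \mathrm{in}_iM\mid \mathrm{case}\ M\ \{\mathrm{in}_1x\mapsto N_1\mid \mathrm{in}_2x\mapsto N_2\}\mid \mathrm{fold}\,M\mid\mathrm{unfold}\,M$, without type annotations, with the usual simple typing rules; in particular $\mathrm{fix}\,x.M:A$ if $x:A\vdash M:A$, and $\mathrm{fold}$, $\mathrm{unfold}$ go between $A[\mathrm{rec}\,\alpha.A/\alpha]$ and $\mathrm{rec}\,\alpha.A$. **Denotations.** Pure types denote pointed dcpos (in fact Scott domains): $\llbracket \mathbf 1\rrbracket =\{\bot\le\top\}$; $\llbracket A\times B\rrbracket $ is the cartesian product; $\llbracket B\to A\rrbracket $ is the pointwise ordered set of Scott-continuous maps; $\llbracket A+B\rrbracket $ is the disjoint union with a new least element; $\llbracket \mathrm{rec}\,\alpha.A\rrbracket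 $ is the bilimit of the finite unrollings of the type (starting from the one-point dcpo, along the canonical embedding-projection pairs), with the canonical inverse isomorphisms $\mathrm{fold}$, $\mathrm{unfold}$. A pure judgement $x_1:A_1,\dots,x_n:A_n\vdash M:A$ denotes the usual Scott-continuous map $\llbracket M\rrbracket :\llbracket A_1\rrbracket \times\dots\times\llbracket A_n\rrbracket \to\llbracket A\rrbracket $, with $\llbracket \langle\rangle\rrbracket =\top$ and $\mathrm{fix}$ denoting the least fixpoint $\bigvee_n f^n(\bot)$. **Formulae.** Iteration terms are $t::=k\mid 0\mid t+1$ over iteration variables $k$. Formulae of pure type are: $\mathsf{True},\mathsf{False},\varphi\wedge\psi,\varphi\vee\psi$ of any type; $\langle\rangle$ of type $\mathbf 1$; $[\pi_i]\varphi$ of type $A_1\times A_2$ and $[\mathrm{in}_i]\varphi$ of type $A_1+A_2$ for $\varphi$ of type $A_i$; $[\mathrm{fold}]\varphi$ of type $\mathrm{rec}\,\alpha.A$ for $\varphi$ of type $A[\mathrm{rec}\,\alpha.A/\alpha]$; fixpoint variables $X$ and bounded iterations $(\mu^tX)\varphi$, $(\nu^tX)\varphi$ with $X,\varphi$ of the same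 type; $(\exists k)\varphi$, $(\forall k)\varphi$; and $\psi\multimap \varphi$ of type $B\to A$ for $\psi,\varphi$ of types $B,A$ without free fixpoint variable. Positivity ($\mathrm{Pos}$) and negativity ($\mathrm{Neg}$) of $k$ in a formula are defined mutually. A variable not free in $\varphi$ is both. Both are preserved by $\wedge,\vee$ and modalities. $k\,\mathrm{Pos}\,(\psi\multimap \varphi)$ if $k\,\mathrm{Neg}\,\psi$ and $k\,\mathrm{Pos}\,\varphi$, and dually. $k\,\mathrm{Pos}\,(\exists\ell)\varphi$ and $k\,\mathrm{Pos}\,(\mu^tX)\varphi$ if $k\,\mathrm{Pos}\,\varphi$; $k\,\mathrm{Pos}\,(\nu^tX)\varphi$ if moreover $k$ is not in $t$. $k\,\mathrm{Neg}\,(\forall\ell)\varphi$ and $k\,\mathrm{Neg}\,(\nu^tX)\varphi$ if $k\,\mathrm{Neg}\,\varphi$; $k\,\mathrm{Neg}\,(\mu^tX)\varphi$ if moreover $k$ is not in $t$. The languages $\mathcal L^{+},\mathcal L^{-},\mathcal L^{\pm}$ (positive, negative, neutral) are each closed under all the formers but quantifiers and $\multimap $; $(\exists k)\varphi\in\mathcal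 L^+$ if $\varphi\in\mathcal L^+$ and $k\,\mathrm{Pos}\,\varphi$; $(\forall k)\varphi\in\mathcal L^-$ if $\varphi\in\mathcal L^-$ and $k\,\mathrm{Neg}\,\varphi$; and $\psi\multimap \varphi\in\mathcal L^{\sigma}$ if $\psi\in\mathcal L^{-\sigma}$ and $\varphi\in\mathcal L^\sigma$, where $-$ exchanges $+$ and $-$ and fixes $\pm$. Only formulae in one of these languages are considered. $\mathcal L^\wedge$ consists of the formulae built from $\mathsf{True},\mathsf{False},\langle\rangle,\wedge,$ modalities and $\multimap $ only. **Meaning of formulae.** Under a valuation of iteration variables in $\mathbb N$ and of fixpoint variables by sets, a formula of type $A$ denotes a subset of $\llbracket A\rrbracket $: connectives and quantifiers (over $\mathbb N$) are Boolean, $\llbracket \langle\rangle\rrbracket =\{\top\}$, $[\pi_i]\varphi$ and $[\mathrm{fold}]\varphi$ are the inverse images of $\llbracket \varphi\rrbracket $ under $\pi_i$ and $\mathrm{unfold}$, $[\mathrm{in}_i]\varphi$ is the direct image under the $i$-th injection, $(\mu^tX)\varphi$ and $(\nu^tX)\varphi$ are the $\llbracket t\rrbracket $-th iterates of $S\mapsto\llbracket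 \varphi\rrbracket (S/X)$ from $\emptyset$ and from $\llbracket A\rrbracket $, and $\llbracket \psi\multimap \varphi\rrbracket =\{f\mid f(\llbracket \psi\rrbracket )\subseteq\llbracket \varphi\rrbracket \}$. **Deduction.** A sequent $\psi\vdash\varphi$ consists of two formulae of the same type in a common language among $\mathcal L^+,\mathcal L^-,\mathcal L^\pm$. Derivable sequents, and a consistency predicate $\mathsf C$ on closed formulae, are generated by the following rules (with all conclusions sequents; $\triangle$ is any modality). * Identity; cut; $\wedge,\mathsf{True},\vee,\mathsf{False}$ left and right rules with one formula on each side; $\psi\wedge(\varphi\vee\theta)\vdash(\psi\wedge\varphi)\vee(\psi\wedge\theta)$. * Modalities: $\psi\vdash\varphi$ implies $[\triangle]\psi\vdash[\triangle]\varphi$; $[\triangle]\varphi_1\wedge[\triangle]\varphi_2\vdash[\triangle](\varphi_1\wedge\varphi_2)$; $[\triangle](\varphi_1\vee\varphi_2)\vdash[\triangle]\varphi_1\vee[\triangle]\varphi_2$; $[\triangle]\mathsf{False}\vdash\mathsf{False}$; $\mathsf{True}\vdash[\triangle]\mathsf{True}$ if $\triangle$ is not an injection; $(\forall k)[\triangle]\varphi\vdash[\triangle](\forall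 k)\varphi$; $[\triangle](\exists k)\varphi\vdash(\exists k)[\triangle]\varphi$; $[\mathrm{in}_1]\varphi\wedge[\mathrm{in}_2]\psi\vdash\mathsf{False}$. * Quantifiers: $\psi\vdash\varphi[t/k]$ implies $\psi\vdash(\exists k)\varphi$; $\theta\wedge\varphi\vdash\psi$ implies $\theta\wedge(\exists k)\varphi\vdash\psi$ ($k$ not free in $\theta,\psi$); $\varphi[t/k]\vdash\psi$ implies $(\forall k)\varphi\vdash\psi$; $\psi\vdash\varphi\vee\theta$ implies $\psi\vdash(\forall k)\varphi\vee\theta$ ($k$ not free in $\psi,\theta$); $(\exists\ell)(\exists k)\varphi\vdash(\exists k)\varphi[k/\ell]$; $(\forall k)\varphi[k/\ell]\vdash(\forall\ell)(\forall k)\varphi$; for $\theta\in\{\mu,\nu\}$ and $k$ not in $t$, $(\theta^tX)(\exists k)\varphi\vdash(\exists k)(\theta^tX)\varphi$ and $(\forall k)(\theta^tX)\varphi\vdash(\theta^tX)(\forall k)\varphi$. * Iteration: $(\mu^0X)\varphi\vdash\mathsf{False}$; $\mathsf{True}\vdash(\nu^0X)\varphi$; $\varphi[(\mu^tX)\varphi/X]\vdash(\mu^{t+1}X)\varphi$;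 $(\nu^{t+1}X)\varphi\vdash\varphi[(\nu^tX)\varphi/X]$; $(\mu^tX)\varphi\vdash\psi$ implies $(\mu^{t+1}X)\varphi\vdash\varphi[\psi/X]$; $\psi\vdash(\nu^tX)\varphi$ implies $\varphi[\psi/X]\vdash(\nu^{t+1}X)\varphi$; $\psi\vdash\varphi$ implies $(\theta^tX)\psi\vdash(\theta^tX)\varphi$. * Implication: $\psi'\vdash\psi$ and $\varphi\vdash\varphi'$ imply $\psi\multimap \varphi\vdash\psi'\multimap \varphi'$; $((\forall k)\psi)\multimap \varphi\vdash(\exists k)(\psi\multimap \varphi)$ ($k$ not free in $\varphi$); $\psi\multimap (\exists k)\varphi\vdash(\exists k)(\psi\multimap \varphi)$ ($\psi\in\mathcal L^\pm$, $k$ not free in $\psi$); $(\forall k)(\psi\multimap \varphi)\vdash((\exists k)\psi)\multimap \varphi$ ($k$ not free in $\varphi$); $(\forall k)(\psi\multimap \varphi)\vdash\psi\multimap (\forall k)\varphi$ ($k$ not free in $\psi$); $(\psi\multimap \varphi_1)\wedge(\psi\multimap \varphi_2)\vdash\psi\multimap (\varphi_1\wedge\varphi_2)$; $\mathsf{True}\vdash\psi\multimap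 \mathsf{True}$; $(\psi_1\multimap \varphi)\wedge(\psi_2\multimap \varphi)\vdash(\psi_1\vee\psi_2)\multimap \varphi$; $\mathsf{True}\vdash\mathsf{False}\multimap \varphi$; and for $\delta\in\mathcal L^\wedge$, $\delta\multimap (\varphi_1\vee\varphi_2)\vdash(\delta\multimap \varphi_1)\vee(\delta\multimap \varphi_2)$, and $\delta\multimap \mathsf{False}\vdash\mathsf{False}$ if $\mathsf C(\delta)$. * Consistency: $\mathsf C(\mathsf{True})$; $\mathsf C(\langle\rangle)$; $\mathsf C(\varphi)$ implies $\mathsf C([\mathrm{fold}]\varphi)$ and $\mathsf C([\mathrm{in}_i]\varphi)$; $\mathsf C(\varphi),\mathsf C(\psi)$ imply $\mathsf C([\pi_1]\varphi\wedge[\pi_2]\psi)$; $\mathsf C(\psi)$ and $\psi\vdash\varphi\in\mathcal L^\wedge$ imply $\mathsf C(\varphi)$; and, for a finite set $I$, if $\mathsf C(\psi_i),\mathsf C(\varphi_i)$ for all $i\in I$, and for all $J\subseteq I$ either $\bigwedge_J\psi_j\vdash\mathsf{False}$ or $\mathsf C(\bigwedge_J\varphi_j)$, then $\mathsf C(\bigwedge_I(\psi_i\multimap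 \varphi_i))$. **Refinement types.** $T,U::=A\mid\{A\mid\varphi\}\mid T\times U\mid U\to T$, with $A$ a pure type and $\varphi$ a formula of type $A$ without free fixpoint variable; $|T|$ is the underlying pure type. For each valuation of iteration variables, $\llbracket A\rrbracket $ is the whole domain, $\llbracket \{A\mid\varphi\}\rrbracket =\llbracket \varphi\rrbracket $, $\llbracket T\times U\rrbracket $ is the cartesian product of sets, and $\llbracket U\to T\rrbracket =\{f\mid f(\llbracket U\rrbracket )\subseteq\llbracket T\rrbracket \}$. Contexts are $\Gamma=x_1:U_1,\dots,x_n:U_n$. Subtyping is the least reflexive and transitive relation, covariant in $\times$ and in the codomain of $\to$ and contravariant in its domain, such that $T\le|T|$; $A\le\{A\mid\mathsf{True}\}$; $\{A\mid\psi\}\le\{A\mid\varphi\}$ if $\psi\vdash\varphi$ is derivable; $\{A\times B\mid[\pi_1]\varphi\wedge[\pi_2]\psi\}$ and $\{A\mid\varphi\}\times\{B\mid\psi\}$ are subtypes of each other, as are $\{B\to A\mid\psi\multimap \varphi\}$ and $\{B\mid\psi\}\to\{A\mid\varphi\}$; and a pure type $A\times B$ (resp. $B\to A$) is a subtype of the product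 (resp. arrow) of the pure types $A,B$. Derivable judgements $\Gamma\vdash M:T$ are generated by the following rules. * The usual rules for variables, abstraction, application, pairs and projections, with arbitrary refinement types; for the other term formers, their rules in the pure system, with the types displayed in the rule pure but with $\Gamma$ arbitrary. * $\langle\rangle:\{\mathbf 1\mid\langle\rangle\}$. If $M_i:\{A_i\mid\varphi\}$ and $M_{3-i}:A_{3-i}$ then $\langle M_1,M_2\rangle:\{A_1\times A_2\mid[\pi_i]\varphi\}$. If $M:\{A_1\times A_2\mid[\pi_i]\varphi\}$ then $\pi_iM:\{A_i\mid\varphi\}$. If $M$ has type $\{A[\mathrm{rec}\,\alpha.A/\alpha]\mid\varphi\}$ then $\mathrm{fold}\,M:\{\mathrm{rec}\,\alpha.A\mid[\mathrm{fold}]\varphi\}$, and conversely for $\mathrm{unfold}$. If $M:\{A_i\mid\varphi\}$ then $\mathrm{in}_iM:\{A_1+A_2\mid[\mathrm{in}_i]\varphi\}$. * If $\Gamma\vdash M:\{A_1+A_2\mid[\mathrm{in}_i]\varphi\}$, $\Gamma,x:\{A_i\mid\varphi\}\vdash N_i:T$, and $|\Gamma|,x:A_{3-i}\vdash N_{3-i}:|T|$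 in the pure system, then $\Gamma\vdash\mathrm{case}\ M\ \{\mathrm{in}_1x\mapsto N_1\mid\mathrm{in}_2x\mapsto N_2\}:T$. * If $\Gamma\vdash\mathrm{fix}\,x.M:\{A\mid\psi\}$ and $\Gamma,x:\{A\mid\psi\}\vdash M:\{A\mid\varphi\}$ then $\Gamma\vdash\mathrm{fix}\,x.M:\{A\mid\varphi\}$. * If $M:\{A\mid\varphi\}$ and $M:\{A\mid\psi\}$ then $M:\{A\mid\varphi\wedge\psi\}$. If $\Gamma,x:\{B\mid\psi_j\},\Delta\vdash M:T$ for $j=1,2$ then $\Gamma,x:\{B\mid\psi_1\vee\psi_2\},\Delta\vdash M:T$. If $|\Gamma|,x:B,|\Delta|\vdash M:|T|$ in the pure system then $\Gamma,x:\{B\mid\mathsf{False}\},\Delta\vdash M:T$. * If $\Gamma\vdash M:T$, $T\le T'$ and $\Gamma'\le\Gamma$ pointwise, then $\Gamma'\vdash M:T'$. **Theorem (Soundness of Typing).** Every derivable refinement typing judgement $x_1:U_1,\dots,x_n:U_n\vdash M:T$ is sound. That is, the pure judgement $x_1:|U_1|,\dots,x_n:|U_n|\vdash M:|T|$ is derivable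 and, for every valuation of the free iteration variables in $\mathbb N$ and all $u_1\in\llbracket U_1\rrbracket ,\dots,u_n\in\llbracket U_n\rrbracket $, one has $\llbracket M\rrbracket (u_1,\dots,u_n)\in\llbracket T\rrbracket $. Here $\llbracket M\rrbracket $ may be computed from any derivation of the pure judgement. -/

import Mathlib

namespace FPC

noncomputable section

/-! ### Cpos and Scott-continuous functions -/

/-- A cpo: a partial order with a least element and suprema of directed sets. -/
structure Cpo where
  carrier : Type
  [str : CompletePartialOrder carrier]

instance : CoeSort Cpo Type := ⟨Cpo.carrier⟩

instance (X : Cpo) : CompletePartialOrder X := X.str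

/-- A partial order with a least element in which non-empty directed sets have suprema is a cpo. -/
def Cpo.ofLUB (α : Type) [PartialOrder α] [OrderBot α]
    (h : ∀ d : Set α, d.Nonempty → DirectedOn (· ≤ ·) d → ∃ a, IsLUB d a) : Cpo where
  carrier := α
  str :=
    { sSup := fun d => @dite _ (∃ a, IsLUB d a) (Classical.dec _) (fun h => h.choose) (fun _ => ⊥)
      lubOfDirected := by
        intro d hd
        have hex : ∃ a, IsLUB d a := by
          rcases d.eq_empty_or_nonempty with rfl | hne
          · exact ⟨⊥, by simp⟩
          · exact h d hne hd
        change IsLUB d (@dite _ (∃ a, IsLUB d a) (Classical.dec _) _ _)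
        rw [dif_pos hex]
        exact hex.choose_spec }

/-- Scott-continuous functions. -/
@[ext]
structure Hom (X Y : Cpo) where
  toFun : X → Y
  cont : ScottContinuous toFun

instance (X Y : Cpo) : CoeFun (Hom X Y) (fun _ => X → Y) := ⟨Hom.toFun⟩

theorem Hom.mono {X Y : Cpo} (f : Hom X Y) : Monotone f := f.cont.monotone

/-- The pointwise order. -/
instance (X Y : Cpo) : PartialOrder (Hom X Y) :=
  PartialOrder.lift Hom.toFun (fun _ _ h => Hom.ext h)

instance (X Y : Cpo) : OrderBot (Hom X Y) where
  bot := ⟨fun _ => ⊥, ScottContinuous.const _⟩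
  bot_le _ := fun _ => bot_le

theorem scottContinuous_of_isLUB {X Y : Cpo} {ι : Sort*} (F : ι → X → Y)
    (hF : ∀ i, ScottContinuous (F i)) (g : X → Y)
    (hg : ∀ x, IsLUB (Set.range fun i => F i x) (g x)) : ScottContinuous g := by
  have hmono : Monotone g := by
    intro x y hxy
    refine (hg x).2 ?_
    rintro _ ⟨i, rfl⟩
    exact ((hF i).monotone hxy).trans ((hg y).1 ⟨i, rfl⟩)
  intro d hne hd a ha
  refine ⟨?_, ?_⟩
  · rintro _ ⟨x, hx, rfl⟩
    exact hmono (ha.1 hx)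
  · intro b hb
    refine (hg a).2 ?_
    rintro _ ⟨i, rfl⟩
    refine ((hF i) hne hd ha).2 ?_
    rintro _ ⟨x, hx, rfl⟩
    exact ((hg x).1 ⟨i, rfl⟩).trans (hb ⟨x, hx, rfl⟩)

/-- A function of two arguments that is Scott-continuous in each of them is Scott-continuous. -/
theorem scottContinuous_prod {X Y Z : Cpo} (f : X → Y → Z)
    (h₁ : ∀ y, ScottContinuous (fun x => f x y)) (h₂ : ∀ x, ScottContinuous (f x)) :
    ScottContinuous (fun z : X × Y => f z.1 z.2) := by
  have hmono : Monotone (fun z : X × Y => f z.1 z.2) := fun a b hab =>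
    ((h₁ a.2).monotone hab.1).trans ((h₂ b.1).monotone hab.2)
  intro d hne hd a ha
  rw [isLUB_prod] at ha
  refine ⟨?_, ?_⟩
  · rintro _ ⟨z, hz, rfl⟩
    exact hmono (Prod.le_def.2 ⟨ha.1.1 ⟨z, hz, rfl⟩, ha.2.1 ⟨z, hz, rfl⟩⟩)
  · intro b hb
    have hd₁ : DirectedOn (· ≤ ·) (Prod.fst '' d) := hd.fst
    have hd₂ : DirectedOn (· ≤ ·) (Prod.snd '' d) := hd.snd
    refine (h₁ a.2 (hne.image _) hd₁ ha.1).2 ?_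
    rintro _ ⟨_, ⟨z, hz, rfl⟩, rfl⟩
    refine (h₂ z.1 (hne.image _) hd₂ ha.2).2 ?_
    rintro _ ⟨_, ⟨w, hw, rfl⟩, rfl⟩
    obtain ⟨v, hv, hzv, hwv⟩ := hd z hz w hw
    exact (hmono (show (z.1, w.2) ≤ v from Prod.le_def.2 ⟨hzv.1, hwv.2⟩)).trans (hb ⟨v, hv, rfl⟩)

/-! ### Constructions on cpos -/

namespace Cpo

/-- The one-point cpo. -/
def one : Cpo := ⟨PUnit⟩

/-- The cpo `{⊥, ⊤}`. -/
def two : Cpo := ⟨Bool⟩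

/-- The Cartesian product with the componentwise order. -/
def prod (X Y : Cpo) : Cpo :=
  ofLUB (X × Y) (by
    intro d _ hd
    exact ⟨(sSup (Prod.fst '' d), sSup (Prod.snd '' d)),
      isLUB_prod.2 ⟨hd.fst.isLUB_sSup, hd.snd.isLUB_sSup⟩⟩)

/-- Directed suprema of Scott-continuous functions are computed pointwise. -/
theorem hom_lub {X Y : Cpo} (d : Set (Hom X Y)) (hd : DirectedOn (· ≤ ·) d) :
    ∃ a : Hom X Y, IsLUB d a ∧ ∀ x, IsLUB ((fun f : Hom X Y => f x) '' d) (a x) := by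
  have hdir : ∀ x : X, DirectedOn (· ≤ ·) ((fun f : Hom X Y => f x) '' d) := by
    rintro x _ ⟨f, hf, rfl⟩ _ ⟨g, hg, rfl⟩
    obtain ⟨k, hk, hfk, hgk⟩ := hd f hf g hg
    exact ⟨k x, ⟨k, hk, rfl⟩, hfk x, hgk x⟩
  have hlub := fun x => (hdir x).isLUB_sSup
  refine ⟨⟨fun x => sSup ((fun f : Hom X Y => f x) '' d), ?_⟩, ⟨?_, ?_⟩, hlub⟩
  · refine scottContinuous_of_isLUB (fun (f : d) => f.1.toFun) (fun f => f.1.cont) _ ?_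
    intro x
    have e : Set.range (fun f : d => f.1.toFun x) = (fun f : Hom X Y => f x) '' d := by
      ext
      simp
    rw [e]
    exact hlub x
  · intro f hf x
    exact (hlub x).1 ⟨f, hf, rfl⟩
  · intro g hg x
    refine (hlub x).2 ?_
    rintro _ ⟨f, hf, rfl⟩
    exact hg hf x

/-- The Scott-continuous functions with the pointwise order. -/
def exp (X Y : Cpo) : Cpo :=
  ofLUB (Hom X Y) (fun d _ hd => (hom_lub d hd).imp fun _ h => h.1)

/-- Directed sets that meet the image of an upward-closed order embedding. -/
theorem lub_of_embedding {X : Cpo} {Z : Type} [PartialOrder Z] (j : X → Z)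
    (hj : ∀ x y, j x ≤ j y ↔ x ≤ y) (hup : ∀ x z, j x ≤ z → ∃ y, z = j y)
    (d : Set Z) (hd : DirectedOn (· ≤ ·) d) (hx : ∃ x, j x ∈ d) :
    DirectedOn (· ≤ ·) {x | j x ∈ d} ∧ (∀ z ∈ d, ∃ y, j y ∈ d ∧ z ≤ j y) ∧
      IsLUB d (j (sSup {x | j x ∈ d})) := by
  obtain ⟨x₀, hx₀⟩ := hx
  have hs : DirectedOn (· ≤ ·) {x | j x ∈ d} := by
    intro x hx y hy
    obtain ⟨w, hw, h₁, h₂⟩ := hd _ hx _ hy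
    obtain ⟨v, rfl⟩ := hup _ _ h₁
    exact ⟨v, hw, (hj _ _).1 h₁, (hj _ _).1 h₂⟩
  have hcof : ∀ z ∈ d, ∃ y, j y ∈ d ∧ z ≤ j y := by
    intro z hz
    obtain ⟨w, hw, h₁, h₂⟩ := hd _ hz _ hx₀
    obtain ⟨v, rfl⟩ := hup _ _ h₂
    exact ⟨v, hw, h₁⟩
  refine ⟨hs, hcof, ?_, ?_⟩
  · intro z hz
    obtain ⟨y, hy, hzy⟩ := hcof z hz
    exact hzy.trans ((hj _ _).2 (hs.le_sSup hy))
  · intro b hb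
    obtain ⟨c, rfl⟩ := hup _ _ (hb hx₀)
    exact (hj _ _).2 (hs.sSup_le fun v hv => (hj _ _).1 (hb hv))

/-- The disjoint union of two cpos with a new least element. -/
abbrev WSum (X Y : Cpo) : Type := WithBot (X ⊕ Y)

/-- The two coprojections. -/
def WSum.inl {X Y : Cpo} (x : X) : WSum X Y := ((Sum.inl x : X ⊕ Y) : WithBot (X ⊕ Y))
def WSum.inr {X Y : Cpo} (y : Y) : WSum X Y := ((Sum.inr y : X ⊕ Y) : WithBot (X ⊕ Y))

theorem WSum.cases {X Y : Cpo} (z : WSum X Y) :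
    z = ⊥ ∨ (∃ x, z = WSum.inl x) ∨ ∃ y, z = WSum.inr y := by
  induction z using WithBot.recBotCoe with
  | bot => exact Or.inl rfl
  | coe z =>
    rcases z with x | y
    · exact Or.inr (Or.inl ⟨x, rfl⟩)
    · exact Or.inr (Or.inr ⟨y, rfl⟩)

theorem WSum.inl_le {X Y : Cpo} (x x' : X) :
    (WSum.inl x : WSum X Y) ≤ WSum.inl x' ↔ x ≤ x' := by simp [WSum.inl]

theorem WSum.inr_le {X Y : Cpo} (y y' : Y) :
    (WSum.inr y : WSum X Y) ≤ WSum.inr y' ↔ y ≤ y' := by simp [WSum.inr]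

theorem WSum.inl_up {X Y : Cpo} (x : X) (z : WSum X Y) (h : WSum.inl x ≤ z) :
    ∃ y, z = WSum.inl y := by
  rcases WSum.cases z with rfl | h' | ⟨y, rfl⟩
  · simp [WSum.inl] at h
  · exact h'
  · simp [WSum.inl, WSum.inr] at h

theorem WSum.inr_up {X Y : Cpo} (y : Y) (z : WSum X Y) (h : WSum.inr y ≤ z) :
    ∃ y, z = WSum.inr y := by
  rcases WSum.cases z with rfl | ⟨x, rfl⟩ | h'
  · simp [WSum.inr] at h
  · simp [WSum.inl, WSum.inr] at h
  · exact h'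

theorem WSum.trichotomy {X Y : Cpo} (d : Set (WSum X Y)) :
    (∃ x, WSum.inl x ∈ d) ∨ (∃ y, WSum.inr y ∈ d) ∨ ∀ z ∈ d, z = ⊥ := by
  by_contra! h
  obtain ⟨h₁, h₂, z, hz, hne⟩ := h
  rcases WSum.cases z with rfl | ⟨x, rfl⟩ | ⟨y, rfl⟩
  · exact hne rfl
  · exact h₁ x hz
  · exact h₂ y hz

/-- The weak coproduct: the disjoint union with a new least element. -/
def sum (X Y : Cpo) : Cpo :=
  ofLUB (WSum X Y) (by
    intro d _ hd
    rcases WSum.trichotomy d with h | h | h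
    · exact ⟨_, (lub_of_embedding WSum.inl WSum.inl_le WSum.inl_up d hd h).2.2⟩
    · exact ⟨_, (lub_of_embedding WSum.inr WSum.inr_le WSum.inr_up d hd h).2.2⟩
    · exact ⟨⊥, fun z hz => (h z hz).le, fun _ _ => bot_le⟩)

end Cpo

namespace Hom

variable {X Y Z W : Cpo}

def id (X : Cpo) : Hom X X := ⟨fun x => x, ScottContinuous.id⟩

def comp (g : Hom Y Z) (f : Hom X Y) : Hom X Z := ⟨fun x => g (f x), f.cont.comp g.cont⟩

def const (X : Cpo) (y : Y) : Hom X Y := ⟨fun _ => y, ScottContinuous.const _⟩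

def fst : Hom (Cpo.prod X Y) X := ⟨fun z => z.1, ScottContinuous.fst (α := X) (β := Y)⟩

def snd : Hom (Cpo.prod X Y) Y := ⟨fun z => z.2, ScottContinuous.snd (α := X) (β := Y)⟩

def pair (f : Hom Z X) (g : Hom Z Y) : Hom Z (Cpo.prod X Y) :=
  ⟨fun z => (f z, g z), ScottContinuous.prodMk f.cont g.cont⟩

/-- The map from a separately continuous function of two arguments. -/
def ofProd (f : X → Y → Z) (h₁ : ∀ y, ScottContinuous (fun x => f x y))
    (h₂ : ∀ x, ScottContinuous (f x)) : Hom (Cpo.prod X Y) Z :=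
  ⟨fun z => f z.1 z.2, scottContinuous_prod f h₁ h₂⟩

theorem pair_cont_left (y : Y) : ScottContinuous (fun x : X => ((x, y) : Cpo.prod X Y)) :=
  (pair (id X) (const X y)).cont

theorem pair_cont_right (x : X) : ScottContinuous (fun y : Y => ((x, y) : Cpo.prod X Y)) :=
  (pair (const Y x) (id Y)).cont

theorem isLUB_apply {s : Set (Hom X Y)} {g : Hom X Y} (hd : DirectedOn (· ≤ ·) s)
    (h : IsLUB s g) (x : X) : IsLUB ((fun f : Hom X Y => f x) '' s) (g x) := by
  obtain ⟨a, ha, hx⟩ := Cpo.hom_lub s hd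
  rw [h.unique ha]
  exact hx x

/-- Evaluation. -/
def ev : Hom (Cpo.prod (Cpo.exp X Y) X) Y :=
  ofProd (X := Cpo.exp X Y) (fun (f : Hom X Y) x => f x)
    (fun x _ _ hd _ ha => isLUB_apply hd ha x) (fun f => f.cont)

def curry (f : Hom (Cpo.prod X Y) Z) : Hom X (Cpo.exp Y Z) where
  toFun x := (⟨fun y => f (x, y), (pair_cont_right x).comp f.cont⟩ : Hom Y Z)
  cont := by
    intro d hne hd a ha
    have h := fun y => ((pair_cont_left y).comp f.cont) hne hd ha
    refine ⟨?_, ?_⟩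
    · rintro _ ⟨x, hx, rfl⟩ y
      exact (h y).1 ⟨x, hx, rfl⟩
    · intro b hb y
      refine (h y).2 ?_
      rintro _ ⟨x, hx, rfl⟩
      exact hb ⟨x, hx, rfl⟩ y

/-- The least fixpoint combinator `f ↦ ⨆ n, fⁿ(⊥)`. -/
def fix (X : Cpo) : Hom (Cpo.exp X X) X where
  toFun (f : Hom X X) := ⨆ n : ℕ, f.toFun^[n] ⊥
  cont := by
    refine scottContinuous_of_isLUB (X := Cpo.exp X X)
      (fun (n : ℕ) (f : Hom X X) => f.toFun^[n] ⊥) ?_ _ ?_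
    · intro n
      induction n with
      | zero => exact ScottContinuous.const _
      | succ n ih =>
        have := (ev.comp (pair (Hom.id (Cpo.exp X X)) ⟨_, ih⟩)).cont
        simp only [Function.iterate_succ_apply']
        exact this
    · intro f
      have hm : Monotone fun n : ℕ => f.toFun^[n] ⊥ :=
        Monotone.monotone_iterate_of_le_map (Hom.mono f) bot_le
      exact hm.directed_le.directedOn_range.isLUB_sSup

def inl : Hom X (Cpo.sum X Y) where
  toFun x := Cpo.WSum.inl x
  cont := by
    intro d hne hd a ha
    refine ⟨?_, ?_⟩
    · rintro _ ⟨x, hx, rfl⟩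
      exact (Cpo.WSum.inl_le _ _).2 (ha.1 hx)
    · intro b hb
      obtain ⟨x, hx⟩ := hne
      obtain ⟨c, rfl⟩ := Cpo.WSum.inl_up x b (hb ⟨x, hx, rfl⟩)
      exact (Cpo.WSum.inl_le _ _).2 (ha.2 fun y hy => (Cpo.WSum.inl_le _ _).1 (hb ⟨y, hy, rfl⟩))

def inr : Hom Y (Cpo.sum X Y) where
  toFun x := Cpo.WSum.inr x
  cont := by
    intro d hne hd a ha
    refine ⟨?_, ?_⟩
    · rintro _ ⟨x, hx, rfl⟩
      exact (Cpo.WSum.inr_le _ _).2 (ha.1 hx)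
    · intro b hb
      obtain ⟨x, hx⟩ := hne
      obtain ⟨c, rfl⟩ := Cpo.WSum.inr_up x b (hb ⟨x, hx, rfl⟩)
      exact (Cpo.WSum.inr_le _ _).2 (ha.2 fun y hy => (Cpo.WSum.inr_le _ _).1 (hb ⟨y, hy, rfl⟩))

/-- The function underlying `[f, g] : X + Y → Z`, which maps `⊥` to `⊥`. -/
def copairFun (f : X → Z) (g : Y → Z) : Cpo.WSum X Y → Z
  | none => ⊥
  | some (.inl x) => f x
  | some (.inr y) => g y

theorem copairFun_mono (f : Hom X Z) (g : Hom Y Z) : Monotone (copairFun f g) := by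
  intro a b hab
  rcases Cpo.WSum.cases a with rfl | ⟨x, rfl⟩ | ⟨y, rfl⟩
  · exact bot_le
  · obtain ⟨x', rfl⟩ := Cpo.WSum.inl_up _ _ hab
    exact f.mono ((Cpo.WSum.inl_le _ _).1 hab)
  · obtain ⟨y', rfl⟩ := Cpo.WSum.inr_up _ _ hab
    exact g.mono ((Cpo.WSum.inr_le _ _).1 hab)

theorem copairFun_cont (f : Hom X Z) (g : Hom Y Z) :
    ScottContinuous (copairFun f g) := by
  have hm := copairFun_mono f g
  intro d hne hd a ha
  refine ⟨?_, ?_⟩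
  · rintro _ ⟨z, hz, rfl⟩
    exact hm (ha.1 hz)
  · intro b hb
    rcases Cpo.WSum.trichotomy d with h | h | h
    · obtain ⟨hs, -, hl⟩ := Cpo.lub_of_embedding _ Cpo.WSum.inl_le Cpo.WSum.inl_up d hd h
      rw [ha.unique hl]
      refine (f.cont (d := {x | Cpo.WSum.inl x ∈ d}) h hs hs.isLUB_sSup).2 ?_
      rintro _ ⟨x, hx, rfl⟩
      exact hb ⟨_, hx, rfl⟩
    · obtain ⟨hs, -, hl⟩ := Cpo.lub_of_embedding _ Cpo.WSum.inr_le Cpo.WSum.inr_up d hd h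
      rw [ha.unique hl]
      refine (g.cont (d := {x | Cpo.WSum.inr x ∈ d}) h hs hs.isLUB_sSup).2 ?_
      rintro _ ⟨x, hx, rfl⟩
      exact hb ⟨_, hx, rfl⟩
    · have : a = ⊥ := le_bot_iff.1 (ha.2 fun z hz => (h z hz).le)
      rw [this]
      exact bot_le

def copair (f : Hom X Z) (g : Hom Y Z) : Hom (Cpo.sum X Y) Z :=
  ⟨copairFun f g, copairFun_cont f g⟩

/-- Case analysis in a context `W`. -/
def case (m : Hom W (Cpo.sum X Y)) (f : Hom (Cpo.prod W X) Z) (g : Hom (Cpo.prod W Y) Z) :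
    Hom W Z where
  toFun w := copair (curry f w) (curry g w) (m w)
  cont := by
    have h : ScottContinuous (fun z : Cpo.prod W (Cpo.sum X Y) =>
        copair (curry f z.1) (curry g z.1) z.2) := by
      refine scottContinuous_prod (Y := Cpo.sum X Y)
        (fun w z => copair (curry f w) (curry g w) z) ?_ (fun w => (copair _ _).cont)
      intro z
      rcases Cpo.WSum.cases z with rfl | ⟨x, rfl⟩ | ⟨y, rfl⟩
      · exact ScottContinuous.const _
      · exact (pair_cont_left x).comp f.cont
      · exact (pair_cont_left y).comp g.cont
    exact (pair (id W) m).cont.comp h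

end Hom

/-! ### Embedding-projection pairs and bilimits -/

/-- Embedding-projection pairs. -/
structure EP (X Y : Cpo) where
  e : Hom X Y
  p : Hom Y X
  p_e : ∀ x, p (e x) = x
  e_p : ∀ y, e (p y) ≤ y

namespace EP

variable {X Y Z X' Y' : Cpo}

theorem e_bot (c : EP X Y) : c.e ⊥ = ⊥ :=
  le_bot_iff.1 ((c.e.mono bot_le).trans (c.e_p ⊥))

theorem p_bot (c : EP X Y) : c.p ⊥ = ⊥ :=
  le_bot_iff.1 ((c.p.mono bot_le).trans (c.p_e ⊥).le)

def id (X : Cpo) : EP X X := ⟨Hom.id X, Hom.id X, fun _ => rfl, fun _ => le_rfl⟩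

def comp (d : EP Y Z) (c : EP X Y) : EP X Z where
  e := d.e.comp c.e
  p := c.p.comp d.p
  p_e x := (congrArg c.p (d.p_e (c.e x))).trans (c.p_e x)
  e_p z := (d.e.mono (c.e_p (d.p z))).trans (d.e_p z)

/-- The one-point cpo embeds in every cpo. -/
def init (X : Cpo) : EP Cpo.one X :=
  ⟨Hom.const _ ⊥, Hom.const _ PUnit.unit, fun _ => rfl, fun _ => bot_le⟩

def prod (c : EP X Y) (c' : EP X' Y') : EP (Cpo.prod X X') (Cpo.prod Y Y') where
  e := Hom.pair (c.e.comp Hom.fst) (c'.e.comp Hom.snd)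
  p := Hom.pair (c.p.comp Hom.fst) (c'.p.comp Hom.snd)
  p_e x := Prod.ext (c.p_e x.1) (c'.p_e x.2)
  e_p y := ⟨c.e_p y.1, c'.e_p y.2⟩

/-- `f ↦ b ∘ f ∘ a`. -/
def expMap (a : Hom X' X) (b : Hom Y Y') : Hom (Cpo.exp X Y) (Cpo.exp X' Y') :=
  Hom.curry (b.comp (Hom.ev.comp (Hom.pair Hom.fst (a.comp Hom.snd))))

def exp (c : EP X Y) (c' : EP X' Y') : EP (Cpo.exp X X') (Cpo.exp Y Y') where
  e := expMap c.p c'.e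
  p := expMap c.e c'.p
  p_e f := Hom.ext (funext fun x =>
    (c'.p_e _).trans (congrArg (Hom.toFun f) (c.p_e x)))
  e_p f := fun y => (c'.e_p _).trans (Hom.mono f (c.e_p y))

/-- `f + g = [inl ∘ f, inr ∘ g]`. -/
def sumMap (f : Hom X Y) (g : Hom X' Y') : Hom (Cpo.sum X X') (Cpo.sum Y Y') :=
  Hom.copair (Hom.inl.comp f) (Hom.inr.comp g)

def sum (c : EP X Y) (c' : EP X' Y') : EP (Cpo.sum X X') (Cpo.sum Y Y') where
  e := sumMap c.e c'.e
  p := sumMap c.p c'.p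
  p_e x := by
    rcases Cpo.WSum.cases x with rfl | ⟨x, rfl⟩ | ⟨x, rfl⟩
    · rfl
    · exact congrArg Cpo.WSum.inl (c.p_e x)
    · exact congrArg Cpo.WSum.inr (c'.p_e x)
  e_p y := by
    rcases Cpo.WSum.cases y with rfl | ⟨x, rfl⟩ | ⟨x, rfl⟩
    · exact le_rfl
    · exact (Cpo.WSum.inl_le _ _).2 (c.e_p x)
    · exact (Cpo.WSum.inr_le _ _).2 (c'.e_p x)

end EP

/-- An `ω`-chain of embedding-projection pairs. -/
structure Chain where
  obj : ℕ → Cpo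
  ep : ∀ n, EP (obj n) (obj (n + 1))

namespace Chain

def shift (C : Chain) : Chain := ⟨fun n => C.obj (n + 1), fun n => C.ep (n + 1)⟩

/-- The coherent sequences, ordered pointwise. -/
abbrev Seq (C : Chain) : Type := {x : ∀ n, C.obj n // ∀ n, (C.ep n).p (x (n + 1)) = x n}

instance (C : Chain) : OrderBot C.Seq where
  bot := ⟨fun _ => ⊥, fun n => (C.ep n).p_bot⟩
  bot_le _ := fun _ => bot_le

theorem seq_lub (C : Chain) (d : Set C.Seq) (hne : d.Nonempty) (hd : DirectedOn (· ≤ ·) d) :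
    ∃ a : C.Seq, IsLUB d a ∧ ∀ n, IsLUB ((fun x : C.Seq => x.1 n) '' d) (a.1 n) := by
  have hdir : ∀ n, DirectedOn (· ≤ ·) ((fun x : C.Seq => x.1 n) '' d) := by
    rintro n _ ⟨f, hf, rfl⟩ _ ⟨g, hg, rfl⟩
    obtain ⟨k, hk, hfk, hgk⟩ := hd f hf g hg
    exact ⟨k.1 n, ⟨k, hk, rfl⟩, hfk n, hgk n⟩
  have hlub := fun n => (hdir n).isLUB_sSup
  refine ⟨⟨fun n => sSup ((fun x : C.Seq => x.1 n) '' d), fun n => ?_⟩, ⟨?_, ?_⟩, hlub⟩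
  · have h := (C.ep n).p.cont (hne.image _) (hdir (n + 1)) (hlub (n + 1))
    refine h.unique ?_
    have e : (C.ep n).p.toFun '' ((fun x : C.Seq => x.1 (n + 1)) '' d) =
        (fun x : C.Seq => x.1 n) '' d := by
      rw [Set.image_image]
      exact Set.image_congr fun x _ => x.2 n
    rw [e]
    exact hlub n
  · intro x hx n
    exact (hlub n).1 ⟨x, hx, rfl⟩
  · intro y hy n
    refine (hlub n).2 ?_
    rintro _ ⟨x, hx, rfl⟩
    exact hy hx n

/-- The limit of the projections of the chain, which is also the colimit of its embeddings. -/
def lim (C : Chain) : Cpo :=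
  Cpo.ofLUB C.Seq (fun d hne hd => (C.seq_lub d hne hd).imp fun _ h => h.1)

variable (C : Chain)

theorem isLUB_apply {s : Set C.Seq} {a : C.Seq} (hne : s.Nonempty)
    (hd : DirectedOn (· ≤ ·) s) (h : IsLUB s a) (n : ℕ) :
    IsLUB ((fun x : C.Seq => x.1 n) '' s) (a.1 n) := by
  obtain ⟨b, hb, hn⟩ := C.seq_lub s hne hd
  rw [h.unique hb]
  exact hn n

def proj (n : ℕ) : Hom C.lim (C.obj n) where
  toFun x := Subtype.val x n
  cont := fun _ hne hd _ ha => C.isLUB_apply hne hd ha n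

theorem proj_coh (n : ℕ) (x : C.lim) : (C.ep n).p (C.proj (n + 1) x) = C.proj n x :=
  Subtype.property x n

/-- Maps into the limit. -/
def lift {X : Cpo} (f : ∀ n, Hom X (C.obj n)) (hf : ∀ n x, (C.ep n).p (f (n + 1) x) = f n x) :
    Hom X C.lim where
  toFun x := (⟨fun n => f n x, fun n => hf n x⟩ : C.Seq)
  cont := by
    intro d hne hd a ha
    refine ⟨?_, ?_⟩
    · rintro _ ⟨x, hx, rfl⟩ n
      exact (f n).mono (ha.1 hx)
    · intro b hb n
      refine ((f n).cont hne hd ha).2 ?_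
      rintro _ ⟨x, hx, rfl⟩
      exact hb ⟨x, hx, rfl⟩ n

/-- The embeddings `C 0 → C m`. -/
def emb0 : ∀ m, Hom (C.obj 0) (C.obj m)
  | 0 => Hom.id _
  | m + 1 => (C.ep m).e.comp (emb0 m)

/-- The `n`-th component of the limiting cone, with its embedding. -/
def cone : ∀ (n : ℕ) (C : Chain), EP (C.obj n) C.lim
  | 0, C =>
    { e := C.lift C.emb0 (fun n x => (C.ep n).p_e _)
      p := C.proj 0
      p_e := fun _ => rfl
      e_p := fun y m => by
        induction m with
        | zero => exact le_rfl
        | succ m ih =>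
          refine ((C.ep m).e.mono ih).trans ?_
          exact (congrArg (C.ep m).e (C.proj_coh m y)).ge.trans ((C.ep m).e_p _) }
  | n + 1, C =>
    EP.comp
      { e := C.lift (fun m => Nat.casesOn m ((C.ep 0).p.comp (C.shift.proj 0))
            (fun m => C.shift.proj m))
          (fun m x => by
            cases m with
            | zero => rfl
            | succ m => exact C.shift.proj_coh m x)
        p := C.shift.lift (fun m => C.proj (m + 1)) (fun m x => C.proj_coh (m + 1) x)
        p_e := fun _ => rfl
        e_p := fun y m => by
          cases m with
          | zero => exact (C.proj_coh 0 y).le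
          | succ m => exact le_rfl }
      (cone n C.shift)

theorem cone_p (n : ℕ) (C : Chain) (x : C.lim) : (cone n C).p x = C.proj n x := by
  induction n generalizing C with
  | zero => rfl
  | succ n ih => exact ih C.shift _

theorem cone_comm_e (n : ℕ) (C : Chain) (x : C.obj n) :
    (cone (n + 1) C).e ((C.ep n).e x) = (cone n C).e x := by
  induction n generalizing C with
  | zero =>
    refine Subtype.ext (funext fun m => ?_)
    cases m with
    | zero => exact (C.ep 0).p_e x
    | succ m =>
      change C.shift.emb0 m ((C.ep 0).e x) = C.emb0 (m + 1) x
      induction m with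
      | zero => rfl
      | succ m ih => exact congrArg (C.ep (m + 1)).e ih
  | succ n ih =>
    have h := ih C.shift x
    exact congrArg (Hom.toFun (C.lift (fun m => Nat.casesOn m ((C.ep 0).p.comp (C.shift.proj 0))
            (fun m => C.shift.proj m)) _)) h

/-- Commuting families of embedding-projection pairs out of a chain. -/
structure Cocone (C : Chain) (X : Cpo) where
  ep : ∀ n, EP (C.obj n) X
  comm_e : ∀ n x, (ep (n + 1)).e ((C.ep n).e x) = (ep n).e x
  comm_p : ∀ n y, (C.ep n).p ((ep (n + 1)).p y) = (ep n).p y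

/-- The cocone with vertex the limit. -/
def limCocone (C : Chain) : C.Cocone C.lim where
  ep n := cone n C
  comm_e n x := cone_comm_e n C x
  comm_p n y := by
    rw [cone_p, cone_p]
    exact C.proj_coh n y

variable {C} {X Y : Cpo}

theorem Cocone.mono (c : C.Cocone X) (c' : C.Cocone Y) (x : X) :
    Monotone fun n => (c'.ep n).e ((c.ep n).p x) := by
  refine monotone_nat_of_le_succ fun n => ?_
  rw [← c.comm_p n x, ← c'.comm_e n]
  exact (c'.ep (n + 1)).e.mono ((C.ep n).e_p _)

/-- The canonical map `x ↦ ⨆ n, e'ₙ(pₙ(x))` between the vertices of two cocones. -/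
def Cocone.map (c : C.Cocone X) (c' : C.Cocone Y) : Hom X Y where
  toFun x := ⨆ n, (c'.ep n).e ((c.ep n).p x)
  cont := scottContinuous_of_isLUB (fun n => ((c'.ep n).e.comp (c.ep n).p).toFun)
    (fun _ => Hom.cont _) _
    (fun x => (Cocone.mono c c' x).directed_le.directedOn_range.isLUB_sSup)

end Chain

/-! ### Pure types -/

/-- Type expressions with `n` free type variables (de Bruijn indices); `mu A` is the recursive type
which binds variable `0` of `A`. -/
inductive Ty : ℕ → Type
  | var {n : ℕ} (i : Fin n) : Ty n
  | unit {n : ℕ} : Ty n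
  | prod {n : ℕ} (A B : Ty n) : Ty n
  | arrow {n : ℕ} (A B : Ty n) : Ty n
  | sum {n : ℕ} (A B : Ty n) : Ty n
  | mu {n : ℕ} (A : Ty (n + 1)) : Ty n

namespace Ty

def ren : {n m : ℕ} → (Fin n → Fin m) → Ty n → Ty m
  | _, _, ρ, var i => var (ρ i)
  | _, _, _, unit => unit
  | _, _, ρ, prod A B => prod (A.ren ρ) (B.ren ρ)
  | _, _, ρ, arrow A B => arrow (A.ren ρ) (B.ren ρ)
  | _, _, ρ, sum A B => sum (A.ren ρ) (B.ren ρ)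
  | _, _, ρ, mu A => mu (A.ren (Fin.cases 0 fun i => (ρ i).succ))

def subst : {n m : ℕ} → (Fin n → Ty m) → Ty n → Ty m
  | _, _, σ, var i => σ i
  | _, _, _, unit => unit
  | _, _, σ, prod A B => prod (A.subst σ) (B.subst σ)
  | _, _, σ, arrow A B => arrow (A.subst σ) (B.subst σ)
  | _, _, σ, sum A B => sum (A.subst σ) (B.subst σ)
  | _, _, σ, mu A => mu (A.subst (Fin.cases (var 0) fun i => (σ i).ren Fin.succ))

/-- The unrolling `A[mu A / 0]` of `mu A`. -/
def unroll {n : ℕ} (A : Ty (n + 1)) : Ty n := A.subst (Fin.cases (mu A) var)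

end Ty

/-- Pure types are closed type expressions. -/
abbrev PTy : Type := Ty 0

/-! ### Interpretation of pure types

Recursive types are interpreted by the bilimit of their finite unrollings. Free type variables, which
do not occur in pure types, are interpreted by the one-point cpo. -/

/-- One layer of the interpretation: recursive types are interpreted by unrolling them once and
using `prev`. -/
def step (prev : ∀ {n : ℕ}, Ty n → Cpo) : {n : ℕ} → Ty n → Cpo
  | _, .var _ => Cpo.one
  | _, .unit => Cpo.two
  | _, .prod A B => Cpo.prod (step prev A) (step prev B)
  | _, .arrow A B => Cpo.exp (step prev A) (step prev B)
  | _, .sum A B => Cpo.sum (step prev A) (step prev B)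
  | _, .mu A => prev A.unroll

/-- The `k`-th approximant of a type, in which recursive types are unrolled fewer than `k` times
before being cut to the one-point cpo. -/
def approx : ℕ → ∀ {n : ℕ}, Ty n → Cpo
  | 0, _, _ => Cpo.one
  | k + 1, _, A => step (approx k) A

def stepEP {prev prev' : ∀ {n : ℕ}, Ty n → Cpo}
    (h : ∀ {n : ℕ} (A : Ty n), EP (prev A) (prev' A)) :
    {n : ℕ} → (A : Ty n) → EP (step prev A) (step prev' A)
  | _, .var _ => EP.id Cpo.one
  | _, .unit => EP.id Cpo.two
  | _, .prod A B => EP.prod (stepEP h A) (stepEP h B)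
  | _, .arrow A B => EP.exp (stepEP h A) (stepEP h B)
  | _, .sum A B => EP.sum (stepEP h A) (stepEP h B)
  | _, .mu A => h A.unroll

/-- The embedding-projection pairs between consecutive approximants. -/
def approxEP : (k : ℕ) → ∀ {n : ℕ} (A : Ty n), EP (approx k A) (approx (k + 1) A)
  | 0, _, _ => EP.init _
  | k + 1, _, A => stepEP (approxEP k) A

def approxChain {n : ℕ} (A : Ty n) : Chain := ⟨fun k => approx k A, fun k => approxEP k A⟩

/-- The interpretation of types. -/
def Dom : {n : ℕ} → Ty n → Cpo
  | _, .var _ => Cpo.one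
  | _, .unit => Cpo.two
  | _, .prod A B => Cpo.prod (Dom A) (Dom B)
  | _, .arrow A B => Cpo.exp (Dom A) (Dom B)
  | _, .sum A B => Cpo.sum (Dom A) (Dom B)
  | _, .mu A => (approxChain (.mu A)).lim

/-- The approximants embed in the interpretation. -/
def approxDom (k : ℕ) : {n : ℕ} → (A : Ty n) → EP (approx (k + 1) A) (Dom A)
  | _, .var _ => EP.id Cpo.one
  | _, .unit => EP.id Cpo.two
  | _, .prod A B => EP.prod (approxDom k A) (approxDom k B)
  | _, .arrow A B => EP.exp (approxDom k A) (approxDom k B)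
  | _, .sum A B => EP.sum (approxDom k A) (approxDom k B)
  | _, .mu A => (approxChain (.mu A)).limCocone.ep (k + 1)

theorem approxDom_comm (k : ℕ) : {n : ℕ} → (A : Ty n) →
    (∀ x, (approxDom (k + 1) A).e ((approxEP (k + 1) A).e x) = (approxDom k A).e x) ∧
    (∀ y, (approxEP (k + 1) A).p ((approxDom (k + 1) A).p y) = (approxDom k A).p y)
  | _, .var _ => ⟨fun _ => rfl, fun _ => rfl⟩
  | _, .unit => ⟨fun _ => rfl, fun _ => rfl⟩
  | _, .prod A B =>
    have hA := approxDom_comm k A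
    have hB := approxDom_comm k B
    ⟨fun x => Prod.ext (hA.1 x.1) (hB.1 x.2), fun x => Prod.ext (hA.2 x.1) (hB.2 x.2)⟩
  | _, .arrow A B =>
    have hA := approxDom_comm k A
    have hB := approxDom_comm k B
    ⟨fun f => Hom.ext (funext fun x => (hB.1 _).trans
        (congrArg (fun z => (approxDom k B).e (Hom.toFun f z)) (hA.2 x))),
      fun f => Hom.ext (funext fun x => (hB.2 _).trans
        (congrArg (fun z => (approxDom k B).p (Hom.toFun f z)) (hA.1 x)))⟩
  | _, .sum A B =>
    have hA := approxDom_comm k A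
    have hB := approxDom_comm k B
    ⟨fun x => by
      rcases Cpo.WSum.cases x with rfl | ⟨x, rfl⟩ | ⟨x, rfl⟩
      · rfl
      · exact congrArg Cpo.WSum.inl (hA.1 x)
      · exact congrArg Cpo.WSum.inr (hB.1 x),
    fun x => by
      rcases Cpo.WSum.cases x with rfl | ⟨x, rfl⟩ | ⟨x, rfl⟩
      · rfl
      · exact congrArg Cpo.WSum.inl (hA.2 x)
      · exact congrArg Cpo.WSum.inr (hB.2 x)⟩
  | _, .mu A =>
    ⟨(approxChain (.mu A)).limCocone.comm_e (k + 1), (approxChain (.mu A)).limCocone.comm_p (k + 1)⟩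

/-- The cocone from the approximants of a type to its interpretation. -/
def domCocone {n : ℕ} (A : Ty n) : (approxChain A).Cocone (Dom A) where
  ep
    | 0 => EP.init _
    | k + 1 => approxDom k A
  comm_e
    | 0, _ => EP.e_bot (approxDom 0 A)
    | k + 1, x => (approxDom_comm k A).1 x
  comm_p
    | 0, _ => rfl
    | k + 1, y => (approxDom_comm k A).2 y

/-- The cocone from the approximants of the unrolling of `mu A` to the interpretation of `mu A`:
the `k`-th approximant of the former is the `(k+1)`-st approximant of the latter. -/
def unrollCocone {n : ℕ} (A : Ty (n + 1)) : (approxChain A.unroll).Cocone (Dom (.mu A)) where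
  ep k := approxDom k (.mu A)
  comm_e k x := (approxDom_comm k (.mu A)).1 x
  comm_p k y := (approxDom_comm k (.mu A)).2 y

/-- The canonical isomorphism between a recursive type and its unrolling, and its inverse. -/
def unfoldHom {n : ℕ} (A : Ty (n + 1)) : Hom (Dom (.mu A)) (Dom A.unroll) :=
  (unrollCocone A).map (domCocone A.unroll)

def foldHom {n : ℕ} (A : Ty (n + 1)) : Hom (Dom A.unroll) (Dom (.mu A)) :=
  (domCocone A.unroll).map (unrollCocone A)

namespace Chain.Cocone

variable {C : Chain} {X Y : Cpo}

/-- The cocone is colimiting. -/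
def IsColim (c : C.Cocone X) : Prop := ∀ x, IsLUB (Set.range fun n => (c.ep n).e ((c.ep n).p x)) x

theorem p_e_eq (c : C.Cocone X) (c' : C.Cocone Y) {m k : ℕ} (h : m ≤ k) (z : C.obj k) :
    (c'.ep m).p ((c'.ep k).e z) = (c.ep m).p ((c.ep k).e z) := by
  induction h using Nat.decreasingInduction with
  | self => rw [(c.ep k).p_e, (c'.ep k).p_e]
  | of_succ m _ ih => rw [← c.comm_p, ← c'.comm_p, ih]

theorem p_map (c : C.Cocone X) (c' : C.Cocone Y) (m : ℕ) (x : X) :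
    (c'.ep m).p (c.map c' x) = (c.ep m).p x := by
  have hd := (mono c c' x).directed_le.directedOn_range
  refine le_antisymm ?_ ?_
  · refine ((c'.ep m).p.cont (Set.range_nonempty _) hd hd.isLUB_sSup).2 ?_
    rintro _ ⟨_, ⟨n, rfl⟩, rfl⟩
    refine ((c'.ep m).p.mono (mono c c' x (le_max_right m n))).trans ?_
    change (c'.ep m).p ((c'.ep (max m n)).e _) ≤ _
    rw [p_e_eq c c' (le_max_left m n)]
    exact (c.ep m).p.mono ((c.ep _).e_p x)
  · rw [← (c'.ep m).p_e ((c.ep m).p x)]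
    exact (c'.ep m).p.mono (hd.isLUB_sSup.1 ⟨m, rfl⟩)

theorem map_map (c : C.Cocone X) (c' : C.Cocone Y) (hc : c.IsColim) (x : X) :
    c'.map c (c.map c' x) = x := by
  have hd := (mono c' c (c.map c' x)).directed_le.directedOn_range
  refine hd.isLUB_sSup.unique ?_
  have := hc x
  simp only [← p_map c c'] at this
  exact this

end Chain.Cocone

theorem Chain.limCocone_isColim (C : Chain) : C.limCocone.IsColim := by
  intro x
  refine ⟨?_, ?_⟩
  · rintro _ ⟨n, rfl⟩
    exact (C.limCocone.ep n).e_p x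
  · intro b hb n
    have := (C.limCocone.ep n).p.mono (hb ⟨n, rfl⟩)
    rw [(C.limCocone.ep n).p_e] at this
    have h : C.proj n x ≤ C.proj n b := by simpa [limCocone, cone_p] using this
    exact h

theorem unrollCocone_isColim {n : ℕ} (A : Ty (n + 1)) : (unrollCocone A).IsColim := by
  intro x
  have h := (approxChain (.mu A)).limCocone_isColim x
  refine ⟨?_, ?_⟩
  · rintro _ ⟨k, rfl⟩
    exact h.1 ⟨k + 1, rfl⟩
  · intro b hb
    refine h.2 ?_
    rintro _ ⟨k, rfl⟩
    exact (Chain.Cocone.mono _ _ x (Nat.le_succ k)).trans (hb ⟨k, rfl⟩)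

theorem domCocone_isColim : {n : ℕ} → (A : Ty n) → (domCocone A).IsColim
  | _, .var _ => fun x => ⟨by rintro _ ⟨k, rfl⟩; exact le_rfl, fun b hb => hb ⟨1, rfl⟩⟩
  | _, .unit => fun x => ⟨by
      rintro _ ⟨k, rfl⟩
      exact ((domCocone .unit).ep k).e_p x, fun b hb => hb ⟨1, rfl⟩⟩
  | _, .prod A B => fun x => ⟨by
      rintro _ ⟨k, rfl⟩
      exact ((domCocone (.prod A B)).ep k).e_p x, fun b hb => by
      refine ⟨(domCocone_isColim A x.1).2 ?_, (domCocone_isColim B x.2).2 ?_⟩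
      · rintro _ ⟨k, rfl⟩
        cases k with
        | zero => exact bot_le
        | succ k => exact (hb ⟨k + 1, rfl⟩).1
      · rintro _ ⟨k, rfl⟩
        cases k with
        | zero => exact bot_le
        | succ k => exact (hb ⟨k + 1, rfl⟩).2⟩
  | _, .arrow A B => fun f => ⟨by
      rintro _ ⟨k, rfl⟩
      exact ((domCocone (.arrow A B)).ep k).e_p f, fun b hb x => by
      have hd := (Chain.Cocone.mono (domCocone A) (domCocone A) x).directed_le.directedOn_range
      refine (Hom.cont f (Set.range_nonempty _) hd (domCocone_isColim A x)).2 ?_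
      rintro _ ⟨_, ⟨j, rfl⟩, rfl⟩
      refine (domCocone_isColim B _).2 ?_
      rintro _ ⟨k, rfl⟩
      refine le_trans ?_ (hb ⟨max j k + 1, rfl⟩ x)
      have h₁ := Chain.Cocone.mono (domCocone A) (domCocone A) x
        ((le_max_left j k).trans (Nat.le_succ _))
      have h₂ := Chain.Cocone.mono (domCocone B) (domCocone B)
        (Hom.toFun f (((domCocone A).ep j).e (((domCocone A).ep j).p x)))
        ((le_max_right j k).trans (Nat.le_succ _))
      refine h₂.trans ?_
      exact ((domCocone B).ep _).e.mono (((domCocone B).ep _).p.mono (Hom.mono f h₁))⟩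
  | _, .sum A B => fun x => ⟨by
      rintro _ ⟨k, rfl⟩
      exact ((domCocone (.sum A B)).ep k).e_p x, fun b hb => by
      rcases Cpo.WSum.cases x with rfl | ⟨x, rfl⟩ | ⟨x, rfl⟩
      · exact bot_le
      · obtain ⟨c, rfl⟩ := Cpo.WSum.inl_up _ _ (hb ⟨1, rfl⟩)
        refine (Cpo.WSum.inl_le _ _).2 ((domCocone_isColim A x).2 ?_)
        rintro _ ⟨k, rfl⟩
        cases k with
        | zero => exact bot_le
        | succ k => exact (Cpo.WSum.inl_le _ _).1 (hb ⟨k + 1, rfl⟩)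
      · obtain ⟨c, rfl⟩ := Cpo.WSum.inr_up _ _ (hb ⟨1, rfl⟩)
        refine (Cpo.WSum.inr_le _ _).2 ((domCocone_isColim B x).2 ?_)
        rintro _ ⟨k, rfl⟩
        cases k with
        | zero => exact bot_le
        | succ k => exact (Cpo.WSum.inr_le _ _).1 (hb ⟨k + 1, rfl⟩)⟩
  | _, .mu A => fun x => by
      have h := (approxChain (.mu A)).limCocone_isColim x
      refine ⟨?_, ?_⟩
      · rintro _ ⟨k, rfl⟩
        exact ((domCocone (.mu A)).ep k).e_p x
      · intro b hb
        refine h.2 ?_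
        rintro _ ⟨k, rfl⟩
        exact (Chain.Cocone.mono _ _ x (Nat.le_succ k)).trans (hb ⟨k + 1, rfl⟩)

theorem fold_unfold {n : ℕ} (A : Ty (n + 1)) (x : Dom (.mu A)) : foldHom A (unfoldHom A x) = x :=
  Chain.Cocone.map_map _ _ (unrollCocone_isColim A) x

theorem unfold_fold {n : ℕ} (A : Ty (n + 1)) (x : Dom A.unroll) : unfoldHom A (foldHom A x) = x :=
  Chain.Cocone.map_map _ _ (domCocone_isColim A.unroll) x

/-! ### Terms of the pure system -/

/-- Terms modulo `α`-equivalence (de Bruijn indices). `case M N₁ N₂` binds one variable in each of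
`N₁` and `N₂`. -/
inductive Tm : Type
  | star : Tm
  | pair (M N : Tm) : Tm
  | proj₁ (M : Tm) : Tm
  | proj₂ (M : Tm) : Tm
  | var (i : ℕ) : Tm
  | lam (M : Tm) : Tm
  | app (M N : Tm) : Tm
  | fix (M : Tm) : Tm
  | fold (M : Tm) : Tm
  | unfold (M : Tm) : Tm
  | inj₁ (M : Tm) : Tm
  | inj₂ (M : Tm) : Tm
  | case (M N₁ N₂ : Tm) : Tm

/-- `Lookup Γ i a`: the `i`-th entry of `Γ` is `a`. -/
inductive Lookup {α : Type} : List α → ℕ → α → Type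
  | zero {Γ : List α} {a : α} : Lookup (a :: Γ) 0 a
  | succ {Γ : List α} {a b : α} {i : ℕ} : Lookup Γ i a → Lookup (b :: Γ) (i + 1) a

/-- Derivations of pure typing judgements `Γ ⊢ M : A`. The head of `Γ` is the type of variable `0`,
which is the most recently bound one. -/
inductive PTyping : List PTy → Tm → PTy → Type
  | var {Γ : List PTy} {i : ℕ} {A : PTy} : Lookup Γ i A → PTyping Γ (.var i) A
  | lam {Γ : List PTy} {M : Tm} {A B : PTy} :
      PTyping (B :: Γ) M A → PTyping Γ (.lam M) (.arrow B A)
  | app {Γ : List PTy} {M N : Tm} {A B : PTy} :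
      PTyping Γ M (.arrow B A) → PTyping Γ N B → PTyping Γ (.app M N) A
  | pair {Γ : List PTy} {M N : Tm} {A B : PTy} :
      PTyping Γ M A → PTyping Γ N B → PTyping Γ (.pair M N) (.prod A B)
  | proj₁ {Γ : List PTy} {M : Tm} {A B : PTy} :
      PTyping Γ M (.prod A B) → PTyping Γ (.proj₁ M) A
  | proj₂ {Γ : List PTy} {M : Tm} {A B : PTy} :
      PTyping Γ M (.prod A B) → PTyping Γ (.proj₂ M) B
  | star {Γ : List PTy} : PTyping Γ .star .unit
  | fix {Γ : List PTy} {M : Tm} {A : PTy} : PTyping (A :: Γ) M A → PTyping Γ (.fix M) A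
  | fold {Γ : List PTy} {M : Tm} {A : Ty 1} :
      PTyping Γ M A.unroll → PTyping Γ (.fold M) (.mu A)
  | unfold {Γ : List PTy} {M : Tm} {A : Ty 1} :
      PTyping Γ M (.mu A) → PTyping Γ (.unfold M) A.unroll
  | inj₁ {Γ : List PTy} {M : Tm} {A B : PTy} :
      PTyping Γ M A → PTyping Γ (.inj₁ M) (.sum A B)
  | inj₂ {Γ : List PTy} {M : Tm} {A B : PTy} :
      PTyping Γ M B → PTyping Γ (.inj₂ M) (.sum A B)
  | case {Γ : List PTy} {M N₁ N₂ : Tm} {A B C : PTy} :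
      PTyping Γ M (.sum A B) → PTyping (A :: Γ) N₁ C → PTyping (B :: Γ) N₂ C →
      PTyping Γ (.case M N₁ N₂) C

/-- The interpretation of a pure context is the product of the interpretations of its types. -/
def CtxDom : List PTy → Cpo
  | [] => Cpo.one
  | A :: Γ => Cpo.prod (CtxDom Γ) (Dom A)

def Lookup.sem : {Γ : List PTy} → {i : ℕ} → {A : PTy} → Lookup Γ i A → Hom (CtxDom Γ) (Dom A)
  | _, _, _, .zero => Hom.snd
  | _, _, _, .succ x => x.sem.comp Hom.fst

/-- The interpretation of typed terms as Scott-continuous functions. -/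
def PTyping.sem : {Γ : List PTy} → {M : Tm} → {A : PTy} → PTyping Γ M A → Hom (CtxDom Γ) (Dom A)
  | _, _, _, .var x => x.sem
  | _, _, _, .lam d => Hom.curry d.sem
  | _, _, _, .app d d' => Hom.ev.comp (Hom.pair d.sem d'.sem)
  | _, _, _, .pair d d' => Hom.pair d.sem d'.sem
  | _, _, _, .proj₁ d => Hom.fst.comp d.sem
  | _, _, _, .proj₂ d => Hom.snd.comp d.sem
  | _, _, _, .star => Hom.const _ (⊤ : Bool)
  | _, _, _, .fix (A := A) d => (Hom.fix (Dom A)).comp (Hom.curry d.sem)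
  | _, _, _, .fold (A := A) d => (foldHom A).comp d.sem
  | _, _, _, .unfold (A := A) d => (unfoldHom A).comp d.sem
  | _, _, _, .inj₁ d => Hom.inl.comp d.sem
  | _, _, _, .inj₂ d => Hom.inr.comp d.sem
  | _, _, _, .case d d₁ d₂ => Hom.case d.sem d₁.sem d₂.sem

/-! ### Formulae -/

/-- Iteration terms over the iteration variables `0, 1, …` (de Bruijn indices). -/
inductive ITm : Type
  | var (k : ℕ) : ITm
  | zero : ITm
  | succ (t : ITm) : ITm

namespace ITm

def subst (σ : ℕ → ITm) : ITm → ITm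
  | var k => σ k
  | zero => zero
  | succ t => succ (t.subst σ)

/-- Occurrence of an iteration variable. -/
def Free (k : ℕ) : ITm → Prop
  | var j => j = k
  | zero => False
  | succ t => t.Free k

def sem (ρ : ℕ → ℕ) : ITm → ℕ
  | var k => ρ k
  | zero => 0
  | succ t => t.sem ρ + 1

/-- Substitutions under a quantifier. -/
def up (σ : ℕ → ITm) : ℕ → ITm
  | 0 => var 0
  | k + 1 => (σ k).subst fun j => var (j + 1)

/-- The substitution of `t` for variable `0`. -/
def inst (t : ITm) : ℕ → ITm
  | 0 => t
  | k + 1 => var k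

end ITm

/-- Modalities, from formulae of the first type to formulae of the second. -/
inductive Modality : PTy → PTy → Type
  | proj₁ {A B : PTy} : Modality A (.prod A B)
  | proj₂ {A B : PTy} : Modality B (.prod A B)
  | inj₁ {A B : PTy} : Modality A (.sum A B)
  | inj₂ {A B : PTy} : Modality B (.sum A B)
  | fold {A : Ty 1} : Modality A.unroll (.mu A)

/-- The two kinds of bounded iteration. -/
inductive IterKind : Type
  | mu : IterKind
  | nu : IterKind

/-- Typed fixpoint variables of a fixpoint context. -/
inductive FVar : List PTy → PTy → Type
  | zero {Φ : List PTy} {A : PTy} : FVar (A :: Φ) A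
  | succ {Φ : List PTy} {A B : PTy} : FVar Φ A → FVar (B :: Φ) A

/-- Definition by cases on the fixpoint variables of an extended context. -/
def FVar.extend {P : PTy → Type} {Φ : List PTy} {A : PTy} (z : P A) (s : ∀ B, FVar Φ B → P B) :
    ∀ B, FVar (A :: Φ) B → P B
  | _, .zero => z
  | _, .succ X => s _ X

/-- Raw formulae of a pure type in a fixpoint context; the polarity constraints are imposed by
`InL` below. `ex` and `all` bind iteration variable `0`; `iter b t φ` is the iteration
`(μᵗ X) φ` or `(νᵗ X) φ`, with `X` the first variable of the extended context. The components of a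
realizability implication have no free fixpoint variable. -/
inductive Form : List PTy → PTy → Type
  | top {Φ : List PTy} {A : PTy} : Form Φ A
  | bot {Φ : List PTy} {A : PTy} : Form Φ A
  | and {Φ : List PTy} {A : PTy} (φ ψ : Form Φ A) : Form Φ A
  | or {Φ : List PTy} {A : PTy} (φ ψ : Form Φ A) : Form Φ A
  | star {Φ : List PTy} : Form Φ .unit
  | mod {Φ : List PTy} {A B : PTy} (m : Modality A B) (φ : Form Φ A) : Form Φ B
  | var {Φ : List PTy} {A : PTy} (X : FVar Φ A) : Form Φ A
  | iter {Φ : List PTy} {A : PTy} (b : IterKind) (t : ITm) (φ : Form (A :: Φ) A) : Form Φ A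
  | ex {Φ : List PTy} {A : PTy} (φ : Form Φ A) : Form Φ A
  | all {Φ : List PTy} {A : PTy} (φ : Form Φ A) : Form Φ A
  | imp {Φ : List PTy} {A B : PTy} (ψ : Form [] B) (φ : Form [] A) : Form Φ (.arrow B A)

namespace Form

/-- Substitution of iteration terms for iteration variables. -/
def substI : {Φ : List PTy} → {A : PTy} → (ℕ → ITm) → Form Φ A → Form Φ A
  | _, _, _, top => top
  | _, _, _, bot => bot
  | _, _, σ, and φ ψ => and (φ.substI σ) (ψ.substI σ)
  | _, _, σ, or φ ψ => or (φ.substI σ) (ψ.substI σ)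
  | _, _, _, star => star
  | _, _, σ, mod m φ => mod m (φ.substI σ)
  | _, _, _, var X => var X
  | _, _, σ, iter b t φ => iter b (t.subst σ) (φ.substI σ)
  | _, _, σ, ex φ => ex (φ.substI (ITm.up σ))
  | _, _, σ, all φ => all (φ.substI (ITm.up σ))
  | _, _, σ, imp ψ φ => imp (ψ.substI σ) (φ.substI σ)

/-- Weakening by a fresh iteration variable `0`. -/
def lift {Φ : List PTy} {A : PTy} (φ : Form Φ A) : Form Φ A :=
  φ.substI fun k => ITm.var (k + 1)

/-- `φ[t/k]`, where `k` is iteration variable `0`. -/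
def inst {Φ : List PTy} {A : PTy} (φ : Form Φ A) (t : ITm) : Form Φ A := φ.substI t.inst

/-- Renaming of fixpoint variables. -/
def renF : {Φ Ψ : List PTy} → {A : PTy} → (∀ B, FVar Φ B → FVar Ψ B) → Form Φ A → Form Ψ A
  | _, _, _, _, top => top
  | _, _, _, _, bot => bot
  | _, _, _, r, and φ ψ => and (φ.renF r) (ψ.renF r)
  | _, _, _, r, or φ ψ => or (φ.renF r) (ψ.renF r)
  | _, _, _, _, star => star
  | _, _, _, r, mod m φ => mod m (φ.renF r)
  | _, _, _, r, var X => var (r _ X)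
  | _, _, _, r, iter b t φ => iter b t (φ.renF (FVar.extend .zero fun _ X => .succ (r _ X)))
  | _, _, _, r, ex φ => ex (φ.renF r)
  | _, _, _, r, all φ => all (φ.renF r)
  | _, _, _, _, imp ψ φ => imp ψ φ

/-- Capture-avoiding substitution of formulae for fixpoint variables. -/
def substF : {Φ Ψ : List PTy} → {A : PTy} → (∀ B, FVar Φ B → Form Ψ B) → Form Φ A → Form Ψ A
  | _, _, _, _, top => top
  | _, _, _, _, bot => bot
  | _, _, _, s, and φ ψ => and (φ.substF s) (ψ.substF s)
  | _, _, _, s, or φ ψ => or (φ.substF s) (ψ.substF s)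
  | _, _, _, _, star => star
  | _, _, _, s, mod m φ => mod m (φ.substF s)
  | _, _, _, s, var X => s _ X
  | _, _, _, s, iter b t φ =>
      iter b t (φ.substF (FVar.extend (var .zero) fun _ X => (s _ X).renF fun _ => .succ))
  | _, _, _, s, ex φ => ex (φ.substF fun _ X => (s _ X).lift)
  | _, _, _, s, all φ => all (φ.substF fun _ X => (s _ X).lift)
  | _, _, _, _, imp ψ φ => imp ψ φ

/-- `φ[ψ/X]`, where `X` is the first fixpoint variable. -/
def instF {Φ : List PTy} {A B : PTy} (φ : Form (B :: Φ) A) (ψ : Form Φ B) : Form Φ A :=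
  φ.substF (FVar.extend ψ fun _ X => var X)

/-- Free occurrence of an iteration variable. -/
def Free : {Φ : List PTy} → {A : PTy} → ℕ → Form Φ A → Prop
  | _, _, _, top => False
  | _, _, _, bot => False
  | _, _, k, and φ ψ => φ.Free k ∨ ψ.Free k
  | _, _, k, or φ ψ => φ.Free k ∨ ψ.Free k
  | _, _, _, star => False
  | _, _, k, mod _ φ => φ.Free k
  | _, _, _, var _ => False
  | _, _, k, iter _ t φ => t.Free k ∨ φ.Free k
  | _, _, k, ex φ => φ.Free (k + 1)
  | _, _, k, all φ => φ.Free (k + 1)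
  | _, _, k, imp ψ φ => ψ.Free k ∨ φ.Free k

/-- Finite conjunctions. -/
def conj {Φ : List PTy} {A : PTy} : List (Form Φ A) → Form Φ A
  | [] => top
  | φ :: l => and φ (conj l)

end Form

mutual

/-- The iteration variable `k` is positive in `φ`. -/
inductive Pos : {Φ : List PTy} → {A : PTy} → ℕ → Form Φ A → Prop
  | notFree {Φ : List PTy} {A : PTy} {k : ℕ} {φ : Form Φ A} : ¬ φ.Free k → Pos k φ
  | and {Φ : List PTy} {A : PTy} {k : ℕ} {φ ψ : Form Φ A} :
      Pos k φ → Pos k ψ → Pos k (φ.and ψ)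
  | or {Φ : List PTy} {A : PTy} {k : ℕ} {φ ψ : Form Φ A} :
      Pos k φ → Pos k ψ → Pos k (φ.or ψ)
  | mod {Φ : List PTy} {A B : PTy} {k : ℕ} {m : Modality A B} {φ : Form Φ A} :
      Pos k φ → Pos k (φ.mod m)
  | imp {Φ : List PTy} {A B : PTy} {k : ℕ} {ψ : Form [] B} {φ : Form [] A} :
      Neg k ψ → Pos k φ → Pos k (Form.imp (Φ := Φ) ψ φ)
  | ex {Φ : List PTy} {A : PTy} {k : ℕ} {φ : Form Φ A} : Pos (k + 1) φ → Pos k φ.ex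
  | mu {Φ : List PTy} {A : PTy} {k : ℕ} {t : ITm} {φ : Form (A :: Φ) A} :
      Pos k φ → Pos k (Form.iter .mu t φ)
  | nu {Φ : List PTy} {A : PTy} {k : ℕ} {t : ITm} {φ : Form (A :: Φ) A} :
      Pos k φ → ¬ t.Free k → Pos k (Form.iter .nu t φ)

/-- The iteration variable `k` is negative in `φ`. -/
inductive Neg : {Φ : List PTy} → {A : PTy} → ℕ → Form Φ A → Prop
  | notFree {Φ : List PTy} {A : PTy} {k : ℕ} {φ : Form Φ A} : ¬ φ.Free k → Neg k φ
  | and {Φ : List PTy} {A : PTy} {k : ℕ} {φ ψ : Form Φ A} :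
      Neg k φ → Neg k ψ → Neg k (φ.and ψ)
  | or {Φ : List PTy} {A : PTy} {k : ℕ} {φ ψ : Form Φ A} :
      Neg k φ → Neg k ψ → Neg k (φ.or ψ)
  | mod {Φ : List PTy} {A B : PTy} {k : ℕ} {m : Modality A B} {φ : Form Φ A} :
      Neg k φ → Neg k (φ.mod m)
  | imp {Φ : List PTy} {A B : PTy} {k : ℕ} {ψ : Form [] B} {φ : Form [] A} :
      Pos k ψ → Neg k φ → Neg k (Form.imp (Φ := Φ) ψ φ)
  | all {Φ : List PTy} {A : PTy} {k : ℕ} {φ : Form Φ A} : Neg (k + 1) φ → Neg k φ.all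
  | nu {Φ : List PTy} {A : PTy} {k : ℕ} {t : ITm} {φ : Form (A :: Φ) A} :
      Neg k φ → Neg k (Form.iter .nu t φ)
  | mu {Φ : List PTy} {A : PTy} {k : ℕ} {t : ITm} {φ : Form (A :: Φ) A} :
      Neg k φ → ¬ t.Free k → Neg k (Form.iter .mu t φ)

end

/-- Polarities: neutral, positive, negative. -/
inductive Sign : Type
  | neutral : Sign
  | pos : Sign
  | neg : Sign

def Sign.opp : Sign → Sign
  | neutral => neutral
  | pos => neg
  | neg => pos

/-- `InL s φ`: the formula `φ` belongs to the language of polarity `s`. -/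
inductive InL : {Φ : List PTy} → {A : PTy} → Sign → Form Φ A → Prop
  | top {Φ : List PTy} {A : PTy} {s : Sign} : InL s (Form.top (Φ := Φ) (A := A))
  | bot {Φ : List PTy} {A : PTy} {s : Sign} : InL s (Form.bot (Φ := Φ) (A := A))
  | and {Φ : List PTy} {A : PTy} {s : Sign} {φ ψ : Form Φ A} :
      InL s φ → InL s ψ → InL s (φ.and ψ)
  | or {Φ : List PTy} {A : PTy} {s : Sign} {φ ψ : Form Φ A} :
      InL s φ → InL s ψ → InL s (φ.or ψ)
  | star {Φ : List PTy} {s : Sign} : InL s (Form.star (Φ := Φ))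
  | mod {Φ : List PTy} {A B : PTy} {s : Sign} {m : Modality A B} {φ : Form Φ A} :
      InL s φ → InL s (φ.mod m)
  | var {Φ : List PTy} {A : PTy} {s : Sign} {X : FVar Φ A} : InL s (Form.var X)
  | iter {Φ : List PTy} {A : PTy} {s : Sign} {b : IterKind} {t : ITm} {φ : Form (A :: Φ) A} :
      InL s φ → InL s (Form.iter b t φ)
  | ex {Φ : List PTy} {A : PTy} {φ : Form Φ A} : InL .pos φ → Pos 0 φ → InL .pos φ.ex
  | all {Φ : List PTy} {A : PTy} {φ : Form Φ A} : InL .neg φ → Neg 0 φ → InL .neg φ.all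
  | imp {Φ : List PTy} {A B : PTy} {s : Sign} {ψ : Form [] B} {φ : Form [] A} :
      InL s.opp ψ → InL s φ → InL s (Form.imp (Φ := Φ) ψ φ)

/-- The fragment with neither iteration, nor fixpoint and iteration variables, nor quantifiers, nor
binary disjunction (but with `⊥`). -/
inductive InMeet : {A : PTy} → Form [] A → Prop
  | top {A : PTy} : InMeet (Form.top (A := A))
  | bot {A : PTy} : InMeet (Form.bot (A := A))
  | and {A : PTy} {φ ψ : Form [] A} : InMeet φ → InMeet ψ → InMeet (φ.and ψ)
  | star : InMeet Form.star
  | mod {A B : PTy} {m : Modality A B} {φ : Form [] A} : InMeet φ → InMeet (φ.mod m)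
  | imp {A B : PTy} {ψ : Form [] B} {φ : Form [] A} : InMeet ψ → InMeet φ → InMeet (Form.imp ψ φ)

/-! ### Deduction -/

/-- `ψ ⊢ φ` is a sequent when `ψ` and `φ` belong to the language of a same polarity. -/
def IsSequent {Φ : List PTy} {A : PTy} (ψ φ : Form Φ A) : Prop := ∃ s, InL s ψ ∧ InL s φ

def Modality.IsInj : {A B : PTy} → Modality A B → Prop
  | _, _, .inj₁ => True
  | _, _, .inj₂ => True
  | _, _, _ => False

mutual

/-- Derivable sequents `ψ ⊢ φ`. -/
inductive Ded : {Φ : List PTy} → {A : PTy} → Form Φ A → Form Φ A → Prop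
  -- propositional rules
  | refl {Φ : List PTy} {A : PTy} {φ : Form Φ A} : IsSequent φ φ → Ded φ φ
  | cut {Φ : List PTy} {A : PTy} {ψ θ φ : Form Φ A} :
      IsSequent ψ φ → Ded ψ θ → Ded θ φ → Ded ψ φ
  | distr {Φ : List PTy} {A : PTy} {ψ φ θ : Form Φ A} :
      IsSequent (ψ.and (φ.or θ)) ((ψ.and φ).or (ψ.and θ)) →
      Ded (ψ.and (φ.or θ)) ((ψ.and φ).or (ψ.and θ))
  | andR {Φ : List PTy} {A : PTy} {ψ φ₁ φ₂ : Form Φ A} :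
      IsSequent ψ (φ₁.and φ₂) → Ded ψ φ₁ → Ded ψ φ₂ → Ded ψ (φ₁.and φ₂)
  | andL₁ {Φ : List PTy} {A : PTy} {ψ₁ ψ₂ φ : Form Φ A} :
      IsSequent (ψ₁.and ψ₂) φ → Ded ψ₁ φ → Ded (ψ₁.and ψ₂) φ
  | andL₂ {Φ : List PTy} {A : PTy} {ψ₁ ψ₂ φ : Form Φ A} :
      IsSequent (ψ₁.and ψ₂) φ → Ded ψ₂ φ → Ded (ψ₁.and ψ₂) φ
  | topR {Φ : List PTy} {A : PTy} {ψ : Form Φ A} : IsSequent ψ .top → Ded ψ .top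
  | orR₁ {Φ : List PTy} {A : PTy} {ψ φ₁ φ₂ : Form Φ A} :
      IsSequent ψ (φ₁.or φ₂) → Ded ψ φ₁ → Ded ψ (φ₁.or φ₂)
  | orR₂ {Φ : List PTy} {A : PTy} {ψ φ₁ φ₂ : Form Φ A} :
      IsSequent ψ (φ₁.or φ₂) → Ded ψ φ₂ → Ded ψ (φ₁.or φ₂)
  | orL {Φ : List PTy} {A : PTy} {ψ₁ ψ₂ φ : Form Φ A} :
      IsSequent (ψ₁.or ψ₂) φ → Ded ψ₁ φ → Ded ψ₂ φ → Ded (ψ₁.or ψ₂) φ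
  | botL {Φ : List PTy} {A : PTy} {φ : Form Φ A} : IsSequent .bot φ → Ded .bot φ
  -- modal rules
  | inj {Φ : List PTy} {A B : PTy} {φ : Form Φ A} {ψ : Form Φ B} :
      IsSequent ((φ.mod .inj₁).and (ψ.mod .inj₂)) .bot →
      Ded ((φ.mod .inj₁).and (ψ.mod .inj₂)) .bot
  | modMono {Φ : List PTy} {A B : PTy} {m : Modality A B} {ψ φ : Form Φ A} :
      IsSequent (ψ.mod m) (φ.mod m) → Ded ψ φ → Ded (ψ.mod m) (φ.mod m)
  | modAnd {Φ : List PTy} {A B : PTy} {m : Modality A B} {φ₁ φ₂ : Form Φ A} :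
      IsSequent ((φ₁.mod m).and (φ₂.mod m)) ((φ₁.and φ₂).mod m) →
      Ded ((φ₁.mod m).and (φ₂.mod m)) ((φ₁.and φ₂).mod m)
  | modTop {Φ : List PTy} {A B : PTy} {m : Modality A B} :
      IsSequent (Φ := Φ) .top (Form.top.mod m) → ¬ m.IsInj → Ded (Φ := Φ) .top (Form.top.mod m)
  | modAll {Φ : List PTy} {A B : PTy} {m : Modality A B} {φ : Form Φ A} :
      IsSequent (φ.mod m).all (φ.all.mod m) → Ded (φ.mod m).all (φ.all.mod m)
  | modOr {Φ : List PTy} {A B : PTy} {m : Modality A B} {φ₁ φ₂ : Form Φ A} :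
      IsSequent ((φ₁.or φ₂).mod m) ((φ₁.mod m).or (φ₂.mod m)) →
      Ded ((φ₁.or φ₂).mod m) ((φ₁.mod m).or (φ₂.mod m))
  | modBot {Φ : List PTy} {A B : PTy} {m : Modality A B} :
      IsSequent (Φ := Φ) (Form.bot.mod m) .bot → Ded (Φ := Φ) (Form.bot.mod m) .bot
  | modEx {Φ : List PTy} {A B : PTy} {m : Modality A B} {φ : Form Φ A} :
      IsSequent (φ.ex.mod m) (φ.mod m).ex → Ded (φ.ex.mod m) (φ.mod m).ex
  -- quantifier rules
  | exR {Φ : List PTy} {A : PTy} {ψ φ : Form Φ A} {t : ITm} :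
      IsSequent ψ φ.ex → Ded ψ (φ.inst t) → Ded ψ φ.ex
  | exL {Φ : List PTy} {A : PTy} {θ φ ψ : Form Φ A} :
      IsSequent (θ.and φ.ex) ψ → Ded (θ.lift.and φ) ψ.lift → Ded (θ.and φ.ex) ψ
  | exM {Φ : List PTy} {A : PTy} {φ : Form Φ A} :
      IsSequent φ.ex.ex (φ.inst (.var 0)).ex → Ded φ.ex.ex (φ.inst (.var 0)).ex
  | allL {Φ : List PTy} {A : PTy} {φ ψ : Form Φ A} {t : ITm} :
      IsSequent φ.all ψ → Ded (φ.inst t) ψ → Ded φ.all ψ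
  | allR {Φ : List PTy} {A : PTy} {ψ φ θ : Form Φ A} :
      IsSequent ψ (φ.all.or θ) → Ded ψ.lift (φ.or θ.lift) → Ded ψ (φ.all.or θ)
  | allM {Φ : List PTy} {A : PTy} {φ : Form Φ A} :
      IsSequent (φ.inst (.var 0)).all φ.all.all → Ded (φ.inst (.var 0)).all φ.all.all
  | iterEx {Φ : List PTy} {A : PTy} {b : IterKind} {t : ITm} {φ : Form (A :: Φ) A} :
      IsSequent (Form.iter b t φ.ex) (Form.iter b (t.subst fun k => .var (k + 1)) φ).ex →
      Ded (Form.iter b t φ.ex) (Form.iter b (t.subst fun k => .var (k + 1)) φ).ex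
  | allIter {Φ : List PTy} {A : PTy} {b : IterKind} {t : ITm} {φ : Form (A :: Φ) A} :
      IsSequent (Form.iter b (t.subst fun k => .var (k + 1)) φ).all (Form.iter b t φ.all) →
      Ded (Form.iter b (t.subst fun k => .var (k + 1)) φ).all (Form.iter b t φ.all)
  -- bounded iteration
  | muZero {Φ : List PTy} {A : PTy} {φ : Form (A :: Φ) A} :
      IsSequent (Form.iter .mu .zero φ) .bot → Ded (Form.iter .mu .zero φ) .bot
  | muSuccL {Φ : List PTy} {A : PTy} {t : ITm} {φ : Form (A :: Φ) A} {ψ : Form Φ A} :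
      IsSequent (Form.iter .mu t.succ φ) (φ.instF ψ) → Ded (Form.iter .mu t φ) ψ →
      Ded (Form.iter .mu t.succ φ) (φ.instF ψ)
  | muSuccR {Φ : List PTy} {A : PTy} {t : ITm} {φ : Form (A :: Φ) A} :
      IsSequent (φ.instF (Form.iter .mu t φ)) (Form.iter .mu t.succ φ) →
      Ded (φ.instF (Form.iter .mu t φ)) (Form.iter .mu t.succ φ)
  | nuZero {Φ : List PTy} {A : PTy} {φ : Form (A :: Φ) A} :
      IsSequent .top (Form.iter .nu .zero φ) → Ded .top (Form.iter .nu .zero φ)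
  | nuSuccR {Φ : List PTy} {A : PTy} {t : ITm} {φ : Form (A :: Φ) A} {ψ : Form Φ A} :
      IsSequent (φ.instF ψ) (Form.iter .nu t.succ φ) → Ded ψ (Form.iter .nu t φ) →
      Ded (φ.instF ψ) (Form.iter .nu t.succ φ)
  | nuSuccL {Φ : List PTy} {A : PTy} {t : ITm} {φ : Form (A :: Φ) A} :
      IsSequent (Form.iter .nu t.succ φ) (φ.instF (Form.iter .nu t φ)) →
      Ded (Form.iter .nu t.succ φ) (φ.instF (Form.iter .nu t φ))
  | iterMono {Φ : List PTy} {A : PTy} {b : IterKind} {t : ITm} {ψ φ : Form (A :: Φ) A} :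
      IsSequent (Form.iter b t ψ) (Form.iter b t φ) → Ded ψ φ →
      Ded (Form.iter b t ψ) (Form.iter b t φ)
  -- realizability implication
  | impMono {Φ : List PTy} {A B : PTy} {ψ ψ' : Form [] B} {φ φ' : Form [] A} :
      IsSequent (Form.imp (Φ := Φ) ψ φ) (Form.imp ψ' φ') → Ded ψ' ψ → Ded φ φ' →
      Ded (Form.imp (Φ := Φ) ψ φ) (Form.imp ψ' φ')
  | wf {Φ : List PTy} {A B : PTy} {ψ : Form [] B} {φ : Form [] A} :
      IsSequent (Form.imp (Φ := Φ) ψ.all φ) (Form.imp ψ φ.lift).ex →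
      Ded (Form.imp (Φ := Φ) ψ.all φ) (Form.imp ψ φ.lift).ex
  | cc {Φ : List PTy} {A B : PTy} {ψ : Form [] B} {φ : Form [] A} :
      IsSequent (Form.imp (Φ := Φ) ψ φ.ex) (Form.imp ψ.lift φ).ex → InL .neutral ψ →
      Ded (Form.imp (Φ := Φ) ψ φ.ex) (Form.imp ψ.lift φ).ex
  | exImp {Φ : List PTy} {A B : PTy} {ψ : Form [] B} {φ : Form [] A} :
      IsSequent (Form.imp (Φ := Φ) ψ φ.lift).all (Form.imp ψ.ex φ) →
      Ded (Form.imp (Φ := Φ) ψ φ.lift).all (Form.imp ψ.ex φ)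
  | impAll {Φ : List PTy} {A B : PTy} {ψ : Form [] B} {φ : Form [] A} :
      IsSequent (Form.imp (Φ := Φ) ψ.lift φ).all (Form.imp ψ φ.all) →
      Ded (Form.imp (Φ := Φ) ψ.lift φ).all (Form.imp ψ φ.all)
  | impAnd {Φ : List PTy} {A B : PTy} {ψ : Form [] B} {φ₁ φ₂ : Form [] A} :
      IsSequent ((Form.imp (Φ := Φ) ψ φ₁).and (Form.imp ψ φ₂)) (Form.imp ψ (φ₁.and φ₂)) →
      Ded ((Form.imp (Φ := Φ) ψ φ₁).and (Form.imp ψ φ₂)) (Form.imp ψ (φ₁.and φ₂))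
  | impTop {Φ : List PTy} {A B : PTy} {ψ : Form [] B} :
      IsSequent .top (Form.imp (Φ := Φ) (A := A) ψ .top) →
      Ded .top (Form.imp (Φ := Φ) (A := A) ψ .top)
  | orImp {Φ : List PTy} {A B : PTy} {ψ₁ ψ₂ : Form [] B} {φ : Form [] A} :
      IsSequent ((Form.imp (Φ := Φ) ψ₁ φ).and (Form.imp ψ₂ φ)) (Form.imp (ψ₁.or ψ₂) φ) →
      Ded ((Form.imp (Φ := Φ) ψ₁ φ).and (Form.imp ψ₂ φ)) (Form.imp (ψ₁.or ψ₂) φ)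
  | botImp {Φ : List PTy} {A B : PTy} {φ : Form [] A} :
      IsSequent .top (Form.imp (Φ := Φ) (B := B) .bot φ) →
      Ded .top (Form.imp (Φ := Φ) (B := B) .bot φ)
  | impOr {Φ : List PTy} {A B : PTy} {δ : Form [] B} {φ₁ φ₂ : Form [] A} :
      IsSequent (Form.imp (Φ := Φ) δ (φ₁.or φ₂)) ((Form.imp δ φ₁).or (Form.imp δ φ₂)) →
      InMeet δ → Ded (Form.imp (Φ := Φ) δ (φ₁.or φ₂)) ((Form.imp δ φ₁).or (Form.imp δ φ₂))
  | impBot {Φ : List PTy} {A B : PTy} {δ : Form [] B} :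
      IsSequent (Form.imp (Φ := Φ) (A := A) δ .bot) .bot → Con δ → InMeet δ →
      Ded (Form.imp (Φ := Φ) (A := A) δ .bot) .bot

/-- The consistency predicate. In the last rule, the finite family `(ψᵢ, φᵢ)` is a list and
its subfamilies are sublists; `inc` selects the subfamilies `J` for which `⋀_J ψⱼ ⊢ ⊥` is used. -/
inductive Con : {A : PTy} → Form [] A → Prop
  | star : Con Form.star
  | fold {A : Ty 1} {φ : Form [] A.unroll} : Con φ → Con (φ.mod .fold)
  | pair {A B : PTy} {φ : Form [] A} {ψ : Form [] B} :
      Con φ → Con ψ → Con ((φ.mod .proj₁).and (ψ.mod .proj₂))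
  | inj₁ {A B : PTy} {φ : Form [] A} : Con φ → Con (φ.mod (.inj₁ (B := B)))
  | inj₂ {A B : PTy} {φ : Form [] B} : Con φ → Con (φ.mod (.inj₂ (A := A)))
  | top {A : PTy} : Con (Form.top (A := A))
  | ded {A : PTy} {ψ φ : Form [] A} : Con ψ → Ded ψ φ → InMeet φ → Con φ
  | imp {A B : PTy} (l : List (Form [] B × Form [] A))
      (inc : List (Form [] B × Form [] A) → Prop) :
      (∀ i ∈ l, Con i.1) → (∀ i ∈ l, Con i.2) →
      (∀ J, J.Sublist l → inc J → Ded (Form.conj (J.map Prod.fst)) .bot) →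
      (∀ J, J.Sublist l → ¬ inc J → Con (Form.conj (J.map Prod.snd))) →
      Con (Form.conj (l.map fun i => Form.imp i.1 i.2))

end

/-! ### Semantics of formulae -/

def Modality.sem : {A B : PTy} → Modality A B → Set (Dom A) → Set (Dom B)
  | _, _, .proj₁ (A := A) (B := B), S => {x | Hom.fst (X := Dom A) (Y := Dom B) x ∈ S}
  | _, _, .proj₂ (A := A) (B := B), S => {x | Hom.snd (X := Dom A) (Y := Dom B) x ∈ S}
  | _, _, .inj₁ (A := A) (B := B), S => Hom.inl (X := Dom A) (Y := Dom B) '' S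
  | _, _, .inj₂ (A := A) (B := B), S => Hom.inr (X := Dom A) (Y := Dom B) '' S
  | _, _, .fold (A := A), S => {x | unfoldHom A x ∈ S}

/-- The semantic realizability implication. -/
def semImp {A B : PTy} (S : Set (Dom B)) (T : Set (Dom A)) : Set (Dom (.arrow B A)) :=
  {f | ∀ x ∈ S, Hom.toFun f x ∈ T}

/-- Valuations of the variables of a fixpoint context. -/
abbrev FVal (Φ : List PTy) : Type := ∀ A, FVar Φ A → Set (Dom A)

def FVal.nil : FVal [] := fun _ X => nomatch X

def FVal.cons {Φ : List PTy} {A : PTy} (S : Set (Dom A)) (v : FVal Φ) : FVal (A :: Φ) :=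
  FVar.extend S v

/-- Valuations of iteration variables are extended under a quantifier. -/
def ivalCons (n : ℕ) (ρ : ℕ → ℕ) : ℕ → ℕ
  | 0 => n
  | k + 1 => ρ k

/-- The interpretation of formulae. -/
def Form.sem : {Φ : List PTy} → {A : PTy} → (ℕ → ℕ) → FVal Φ → Form Φ A → Set (Dom A)
  | _, _, _, _, .top => Set.univ
  | _, _, _, _, .bot => ∅
  | _, _, ρ, v, .and φ ψ => φ.sem ρ v ∩ ψ.sem ρ v
  | _, _, ρ, v, .or φ ψ => φ.sem ρ v ∪ ψ.sem ρ v
  | _, _, _, _, .star => {(⊤ : Bool)}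
  | _, _, ρ, v, .mod m φ => m.sem (φ.sem ρ v)
  | _, _, _, v, .var X => v _ X
  | _, _, ρ, v, .iter .mu t φ => (fun S => φ.sem ρ (v.cons S))^[t.sem ρ] ∅
  | _, _, ρ, v, .iter .nu t φ => (fun S => φ.sem ρ (v.cons S))^[t.sem ρ] Set.univ
  | _, _, ρ, v, .ex φ => ⋃ n : ℕ, φ.sem (ivalCons n ρ) v
  | _, _, ρ, v, .all φ => ⋂ n : ℕ, φ.sem (ivalCons n ρ) v
  | _, _, ρ, _, .imp ψ φ => semImp (ψ.sem ρ FVal.nil) (φ.sem ρ FVal.nil)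

/-! ### Refinement types -/

/-- `IsFormula φ`: the raw formula `φ` is positive, negative or neutral. -/
def IsFormula {A : PTy} (φ : Form [] A) : Prop := ∃ s, InL s φ

/-- Refinement types with underlying pure type `A`. -/
inductive RT : PTy → Type
  | pure (A : PTy) : RT A
  | reft {A : PTy} (φ : Form [] A) (hφ : IsFormula φ) : RT A
  | prod {A B : PTy} (T : RT A) (U : RT B) : RT (.prod A B)
  | arrow {A B : PTy} (U : RT B) (T : RT A) : RT (.arrow B A)

/-- Contexts of refinement types. -/
abbrev RCtx : Type := List (Σ A, RT A)

/-- The underlying pure context. -/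
def RCtx.under (Γ : RCtx) : List PTy := Γ.map Sigma.fst

/-- Subtyping. -/
inductive Sub : {A : PTy} → RT A → RT A → Prop
  | refl {A : PTy} {T : RT A} : Sub T T
  | trans {A : PTy} {T U V : RT A} : Sub T U → Sub U V → Sub T V
  | under {A : PTy} {T : RT A} : Sub T (.pure A)
  | top {A : PTy} (h : IsFormula (A := A) .top) : Sub (.pure A) (.reft .top h)
  | ded {A : PTy} {ψ φ : Form [] A} (hψ : IsFormula ψ) (hφ : IsFormula φ) :
      Ded ψ φ → Sub (.reft ψ hψ) (.reft φ hφ)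
  | prod {A B : PTy} {T T' : RT A} {U U' : RT B} :
      Sub T T' → Sub U U' → Sub (.prod T U) (.prod T' U')
  | arrow {A B : PTy} {T T' : RT A} {U U' : RT B} :
      Sub U' U → Sub T T' → Sub (.arrow U T) (.arrow U' T')
  | pureProd {A B : PTy} : Sub (.pure (.prod A B)) (.prod (.pure A) (.pure B))
  | pureArrow {A B : PTy} : Sub (.pure (.arrow B A)) (.arrow (.pure B) (.pure A))
  | reftProd {A B : PTy} {φ : Form [] A} {ψ : Form [] B} (hφ : IsFormula φ) (hψ : IsFormula ψ)
      (h : IsFormula ((φ.mod .proj₁).and (ψ.mod .proj₂))) :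
      Sub (.reft _ h) (.prod (.reft φ hφ) (.reft ψ hψ))
  | prodReft {A B : PTy} {φ : Form [] A} {ψ : Form [] B} (hφ : IsFormula φ) (hψ : IsFormula ψ)
      (h : IsFormula ((φ.mod .proj₁).and (ψ.mod .proj₂))) :
      Sub (.prod (.reft φ hφ) (.reft ψ hψ)) (.reft _ h)
  | reftArrow {A B : PTy} {ψ : Form [] B} {φ : Form [] A} (hψ : IsFormula ψ) (hφ : IsFormula φ)
      (h : IsFormula (Form.imp ψ φ)) :
      Sub (.reft _ h) (.arrow (.reft ψ hψ) (.reft φ hφ))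
  | arrowReft {A B : PTy} {ψ : Form [] B} {φ : Form [] A} (hψ : IsFormula ψ) (hφ : IsFormula φ)
      (h : IsFormula (Form.imp ψ φ)) :
      Sub (.arrow (.reft ψ hψ) (.reft φ hφ)) (.reft _ h)

/-- Pointwise subtyping of contexts. -/
inductive CtxSub : RCtx → RCtx → Prop
  | nil : CtxSub [] []
  | cons {Γ Γ' : RCtx} {A : PTy} {T T' : RT A} :
      Sub T T' → CtxSub Γ Γ' → CtxSub (⟨A, T⟩ :: Γ) (⟨A, T'⟩ :: Γ')

/-- Derivable refinement typing judgements `Γ ⊢ M : T`. -/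
inductive Typing : RCtx → Tm → {A : PTy} → RT A → Prop
  -- basic rules
  | var {Γ : RCtx} {i : ℕ} {A : PTy} {T : RT A} : Lookup Γ i ⟨A, T⟩ → Typing Γ (.var i) T
  | lam {Γ : RCtx} {M : Tm} {A B : PTy} {U : RT B} {T : RT A} :
      Typing (⟨B, U⟩ :: Γ) M T → Typing Γ (.lam M) (.arrow U T)
  | app {Γ : RCtx} {M N : Tm} {A B : PTy} {U : RT B} {T : RT A} :
      Typing Γ M (.arrow U T) → Typing Γ N U → Typing Γ (.app M N) T
  | pair {Γ : RCtx} {M N : Tm} {A B : PTy} {T : RT A} {U : RT B} :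
      Typing Γ M T → Typing Γ N U → Typing Γ (.pair M N) (.prod T U)
  | proj₁ {Γ : RCtx} {M : Tm} {A B : PTy} {T : RT A} {U : RT B} :
      Typing Γ M (.prod T U) → Typing Γ (.proj₁ M) T
  | proj₂ {Γ : RCtx} {M : Tm} {A B : PTy} {T : RT A} {U : RT B} :
      Typing Γ M (.prod T U) → Typing Γ (.proj₂ M) U
  -- rules for pure types
  | star {Γ : RCtx} : Typing Γ .star (.pure .unit)
  | fix {Γ : RCtx} {M : Tm} {A : PTy} :
      Typing (⟨A, .pure A⟩ :: Γ) M (.pure A) → Typing Γ (.fix M) (.pure A)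
  | fold {Γ : RCtx} {M : Tm} {A : Ty 1} :
      Typing Γ M (.pure A.unroll) → Typing Γ (.fold M) (.pure (.mu A))
  | unfold {Γ : RCtx} {M : Tm} {A : Ty 1} :
      Typing Γ M (.pure (.mu A)) → Typing Γ (.unfold M) (.pure A.unroll)
  | inj₁ {Γ : RCtx} {M : Tm} {A B : PTy} :
      Typing Γ M (.pure A) → Typing Γ (.inj₁ M) (.pure (.sum A B))
  | inj₂ {Γ : RCtx} {M : Tm} {A B : PTy} :
      Typing Γ M (.pure B) → Typing Γ (.inj₂ M) (.pure (.sum A B))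
  | case {Γ : RCtx} {M N₁ N₂ : Tm} {A B C : PTy} :
      Typing Γ M (.pure (.sum A B)) → Typing (⟨A, .pure A⟩ :: Γ) N₁ (.pure C) →
      Typing (⟨B, .pure B⟩ :: Γ) N₂ (.pure C) → Typing Γ (.case M N₁ N₂) (.pure C)
  -- rules for refinements
  | starReft {Γ : RCtx} (h : IsFormula .star) : Typing Γ .star (.reft .star h)
  | pairReft₁ {Γ : RCtx} {M N : Tm} {A B : PTy} {φ : Form [] A} (h : IsFormula φ)
      (h' : IsFormula (φ.mod (.proj₁ (B := B)))) :
      Typing Γ M (.reft φ h) → Typing Γ N (.pure B) → Typing Γ (.pair M N) (.reft _ h')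
  | pairReft₂ {Γ : RCtx} {M N : Tm} {A B : PTy} {φ : Form [] B} (h : IsFormula φ)
      (h' : IsFormula (φ.mod (.proj₂ (A := A)))) :
      Typing Γ M (.pure A) → Typing Γ N (.reft φ h) → Typing Γ (.pair M N) (.reft _ h')
  | projReft₁ {Γ : RCtx} {M : Tm} {A B : PTy} {φ : Form [] A} (h : IsFormula φ)
      (h' : IsFormula (φ.mod (.proj₁ (B := B)))) :
      Typing Γ M (.reft _ h') → Typing Γ (.proj₁ M) (.reft φ h)
  | projReft₂ {Γ : RCtx} {M : Tm} {A B : PTy} {φ : Form [] B} (h : IsFormula φ)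
      (h' : IsFormula (φ.mod (.proj₂ (A := A)))) :
      Typing Γ M (.reft _ h') → Typing Γ (.proj₂ M) (.reft φ h)
  | foldReft {Γ : RCtx} {M : Tm} {A : Ty 1} {φ : Form [] A.unroll} (h : IsFormula φ)
      (h' : IsFormula (φ.mod .fold)) :
      Typing Γ M (.reft φ h) → Typing Γ (.fold M) (.reft _ h')
  | unfoldReft {Γ : RCtx} {M : Tm} {A : Ty 1} {φ : Form [] A.unroll} (h : IsFormula φ)
      (h' : IsFormula (φ.mod .fold)) :
      Typing Γ M (.reft _ h') → Typing Γ (.unfold M) (.reft φ h)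
  | injReft₁ {Γ : RCtx} {M : Tm} {A B : PTy} {φ : Form [] A} (h : IsFormula φ)
      (h' : IsFormula (φ.mod (.inj₁ (B := B)))) :
      Typing Γ M (.reft φ h) → Typing Γ (.inj₁ M) (.reft _ h')
  | injReft₂ {Γ : RCtx} {M : Tm} {A B : PTy} {φ : Form [] B} (h : IsFormula φ)
      (h' : IsFormula (φ.mod (.inj₂ (A := A)))) :
      Typing Γ M (.reft φ h) → Typing Γ (.inj₂ M) (.reft _ h')
  | caseReft₁ {Γ : RCtx} {M N₁ N₂ : Tm} {A B C : PTy} {T : RT C} {φ : Form [] A}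
      (h : IsFormula φ) (h' : IsFormula (φ.mod (.inj₁ (B := B)))) :
      Typing Γ M (.reft _ h') → Typing (⟨A, .reft φ h⟩ :: Γ) N₁ T →
      Nonempty (PTyping (B :: Γ.under) N₂ C) → Typing Γ (.case M N₁ N₂) T
  | caseReft₂ {Γ : RCtx} {M N₁ N₂ : Tm} {A B C : PTy} {T : RT C} {φ : Form [] B}
      (h : IsFormula φ) (h' : IsFormula (φ.mod (.inj₂ (A := A)))) :
      Typing Γ M (.reft _ h') → Nonempty (PTyping (A :: Γ.under) N₁ C) →
      Typing (⟨B, .reft φ h⟩ :: Γ) N₂ T → Typing Γ (.case M N₁ N₂) T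
  | fixReft {Γ : RCtx} {M : Tm} {A : PTy} {ψ φ : Form [] A} (hψ : IsFormula ψ)
      (hφ : IsFormula φ) :
      Typing Γ (.fix M) (.reft ψ hψ) → Typing (⟨A, .reft ψ hψ⟩ :: Γ) M (.reft φ hφ) →
      Typing Γ (.fix M) (.reft φ hφ)
  -- logical rules
  | and {Γ : RCtx} {M : Tm} {A : PTy} {φ ψ : Form [] A} (hφ : IsFormula φ) (hψ : IsFormula ψ)
      (h : IsFormula (φ.and ψ)) :
      Typing Γ M (.reft φ hφ) → Typing Γ M (.reft ψ hψ) → Typing Γ M (.reft _ h)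
  | or {Γ Δ : RCtx} {M : Tm} {A B : PTy} {T : RT A} {ψ₁ ψ₂ : Form [] B} (h₁ : IsFormula ψ₁)
      (h₂ : IsFormula ψ₂) (h : IsFormula (ψ₁.or ψ₂)) :
      Typing (Δ ++ ⟨B, .reft ψ₁ h₁⟩ :: Γ) M T → Typing (Δ ++ ⟨B, .reft ψ₂ h₂⟩ :: Γ) M T →
      Typing (Δ ++ ⟨B, .reft _ h⟩ :: Γ) M T
  | bot {Γ Δ : RCtx} {M : Tm} {A B : PTy} {T : RT A} (h : IsFormula (A := B) .bot) :
      Nonempty (PTyping (RCtx.under (Δ ++ ⟨B, .reft .bot h⟩ :: Γ)) M A) →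
      Typing (Δ ++ ⟨B, .reft .bot h⟩ :: Γ) M T
  | sub {Γ Γ' : RCtx} {M : Tm} {A : PTy} {T T' : RT A} :
      CtxSub Γ' Γ → Typing Γ M T → Sub T T' → Typing Γ' M T'

/-- The interpretation of refinement types, under a valuation `ρ` of iteration variables. -/
def RT.sem (ρ : ℕ → ℕ) : {A : PTy} → RT A → Set (Dom A)
  | _, .pure _ => Set.univ
  | _, .reft φ _ => φ.sem ρ FVal.nil
  | _, .prod T U => Modality.sem .proj₁ (T.sem ρ) ∩ Modality.sem .proj₂ (U.sem ρ)
  | _, .arrow U T => semImp (U.sem ρ) (T.sem ρ)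

/-- The tuples `(u₁, …, uₙ)` with `uᵢ ∈ ⟦Uᵢ⟧` for all `i`. -/
def RCtx.sem (ρ : ℕ → ℕ) : (Γ : RCtx) → Set (CtxDom Γ.under)
  | [] => Set.univ
  | ⟨_, T⟩ :: Γ => {u | u.1 ∈ RCtx.sem ρ Γ ∧ u.2 ∈ T.sem ρ}

/-- Sound judgements: the underlying pure judgement is derivable, and the interpretation of the
term maps tuples of elements of the interpreted context types to elements of the interpreted type.
As terms carry no type annotations, the latter is required of every pure typing derivation. -/
def Sound (Γ : RCtx) (M : Tm) {A : PTy} (T : RT A) : Prop :=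
  Nonempty (PTyping Γ.under M A) ∧
    ∀ (d : PTyping Γ.under M A) (ρ : ℕ → ℕ), ∀ u ∈ RCtx.sem ρ Γ, d.sem u ∈ T.sem ρ

end

end FPC

/-!
Typing is sound because derivable sequents denote inclusions and because the interpretation of a
term does not depend on its pure typing derivation.

The sequents which are not inclusions for purely set-theoretic reasons are those commuting a
quantifier with an iteration or with an implication, and those with a formula of `𝓛^∧` on the left
of an implication. Every type denotes a bifinite domain: each element `x` is the supremum of its
truncations `trunc k x`, and each `trunc k` has finite range. Neutral formulae denote compact open
sets, positive ones unions, and negative ones intersections, of compact open sets. A decreasing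
intersection of compact saturated sets lies in an open set only if one of its members does, and an
increasing union of upper sets covers a compact open set only if one of its members does; this
yields the quantifier rules for implications. Positive formulae commute with increasing unions of
the values of their fixpoint variables, and negative ones with decreasing intersections; this yields
those for iterations. A formula of `𝓛^∧` denotes the empty set or the upper set of a point, by
bounded completeness, and a consistent one is inhabited, by gluing step functions.

Terms carry no type annotations, so two derivations for the same term may pass through different
intermediate types. They are compared by a logical relation between the interpretations of two
arbitrary types, defined on their finite approximants, which is equality when the two types
coincide.
-/

namespace FPC

noncomputable section

/-! ### Bifinite domains -/

/-- An (`ω`-)bifinite domain, presented by an increasing sequence of idempotent deflations of finite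
range whose supremum is the identity. -/
class Bifinite (X : Cpo) where
  trunc : ℕ → Hom X X
  trunc_le : ∀ k x, trunc k x ≤ x
  trunc_trunc : ∀ k x, trunc k (trunc k x) = trunc k x
  trunc_mono_level : ∀ x, Monotone fun k => trunc k x
  isLUB_trunc : ∀ x, IsLUB (Set.range fun k => trunc k x) x
  finite_range_trunc : ∀ k, (Set.range (trunc k)).Finite

open Bifinite (trunc trunc_le trunc_trunc trunc_mono_level isLUB_trunc finite_range_trunc)

section Bifinite

variable {X Y : Cpo} [Bifinite X] [Bifinite Y]

theorem trunc_mono (k : ℕ) : Monotone (trunc k : Hom X X) := (trunc k).mono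

theorem trunc_trunc_of_le {k l : ℕ} (h : k ≤ l) (x : X) : trunc k (trunc l x) = trunc k x :=
  le_antisymm (trunc_mono k (trunc_le l x))
    ((trunc_trunc k x).ge.trans (trunc_mono k (trunc_mono_level x h)))

theorem finite_image_trunc (k : ℕ) (S : Set X) : ((trunc k : Hom X X) '' S).Finite :=
  (finite_range_trunc k).subset (Set.image_subset_range _ _)

theorem directedOn_range_trunc (x : X) : DirectedOn (· ≤ ·) (Set.range fun k => trunc k x) :=
  (trunc_mono_level x).directed_le.directedOn_range

theorem isLUB_apply_trunc {Z : Cpo} (f : Hom X Z) (x : X) :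
    IsLUB (Set.range fun k => f (trunc k x)) (f x) := by
  have := f.cont (Set.range_nonempty _) (directedOn_range_trunc x) (isLUB_trunc x)
  rwa [← Set.range_comp] at this

-- The truncations of the members of a directed set have a maximal, hence a greatest element.
theorem exists_trunc_eq_of_isLUB {d : Set X} (hne : d.Nonempty) (hd : DirectedOn (· ≤ ·) d)
    {a : X} (ha : IsLUB d a) (k : ℕ) : ∃ x ∈ d, trunc k x = trunc k a := by
  obtain ⟨_, ⟨x, hx, rfl⟩, hmax⟩ := (finite_image_trunc k d).exists_maximal (hne.image _)
  refine ⟨x, hx, le_antisymm (trunc_mono k (ha.1 hx)) (((trunc k).cont hne hd ha).2 ?_)⟩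
  rintro _ ⟨y, hy, rfl⟩
  obtain ⟨w, hw, hxw, hyw⟩ := hd x hx y hy
  exact (trunc_mono k hyw).trans (hmax ⟨w, hw, rfl⟩ (trunc_mono k hxw))

theorem exists_trunc_eq_of_coherent {z : ℕ → X} (hz : ∀ {k l}, k ≤ l → trunc k (z l) = z k) :
    ∃ y, ∀ k, trunc k y = z k := by
  have hmono : Monotone z := fun k l h => (hz h).ge.trans (trunc_le k _)
  have hd := hmono.directed_le.directedOn_range
  refine ⟨sSup (Set.range z), fun k => le_antisymm ?_ ?_⟩
  · obtain ⟨_, ⟨l, rfl⟩, hl⟩ :=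
      exists_trunc_eq_of_isLUB (Set.range_nonempty z) hd hd.isLUB_sSup k
    rw [← hl, ← hz (le_max_left k l)]
    exact trunc_mono k (hmono (le_max_right k l))
  · exact (hz le_rfl).ge.trans (trunc_mono k (hd.isLUB_sSup.1 ⟨k, rfl⟩))

theorem exists_eventually_trunc_eq {ι : Type*} (F : Ultrafilter ι) (x : ι → X) :
    ∃ y, ∀ k, ∀ᶠ i in F, trunc k (x i) = trunc k y := by
  have hz : ∀ k, ∃ z, ∀ᶠ i in F, trunc k (x i) = z := by
    intro k
    have := (finite_range_trunc (X := X) k).to_subtype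
    obtain ⟨z, hz⟩ := (Ultrafilter.eventually_exists_iff (f := F)
      (P := fun (z : Set.range (trunc k : Hom X X)) i => trunc k (x i) = z)).1
      (Filter.Eventually.of_forall fun i => ⟨⟨_, x i, rfl⟩, rfl⟩)
    exact ⟨z, hz⟩
  choose z hz using hz
  obtain ⟨y, hy⟩ := exists_trunc_eq_of_coherent (z := z) fun {k l} hkl => by
    obtain ⟨i, hk, hl⟩ := ((hz k).and (hz l)).exists
    rw [← hl, trunc_trunc_of_le hkl, hk]
  exact ⟨y, fun k => (hz k).mono fun i hi => hi.trans (hy k).symm⟩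

/-- Compact open sets of a bifinite domain: the upper sets which are the inverse image of a set
along a truncation. -/
def CompactOpen (S : Set X) : Prop := IsUpperSet S ∧ ∃ k, ∀ x ∈ S, trunc k x ∈ S

/-- Scott-open sets of a bifinite domain, as unions of compact open sets. -/
def ScottOpen (S : Set X) : Prop := ∀ x ∈ S, ∃ Q, CompactOpen Q ∧ x ∈ Q ∧ Q ⊆ S

/-- Compact saturated sets of a bifinite domain, as intersections of compact open sets. -/
def CompactSat (S : Set X) : Prop := ∀ x ∉ S, ∃ Q, CompactOpen Q ∧ x ∉ Q ∧ S ⊆ Q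

variable {S T U : Set X}

theorem CompactOpen.scottOpen (h : CompactOpen S) : ScottOpen S :=
  fun _ hx => ⟨S, h, hx, subset_rfl⟩

theorem CompactOpen.compactSat (h : CompactOpen S) : CompactSat S :=
  fun _ hx => ⟨S, h, hx, subset_rfl⟩

theorem ScottOpen.isUpperSet (h : ScottOpen S) : IsUpperSet S := by
  intro x y hxy hx
  obtain ⟨Q, hQ, hxQ, hQS⟩ := h x hx
  exact hQS (hQ.1 hxy hxQ)

theorem CompactSat.isUpperSet (h : CompactSat S) : IsUpperSet S := by
  intro x y hxy hx
  by_contra hy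
  obtain ⟨Q, hQ, hyQ, hSQ⟩ := h y hy
  exact hyQ (hQ.1 hxy (hSQ hx))

theorem trunc_mem_of_le (hS : IsUpperSet S) {k l : ℕ} (h : k ≤ l) {x : X}
    (hx : trunc k x ∈ S) : trunc l x ∈ S := hS (trunc_mono_level x h) hx

theorem ScottOpen.exists_trunc_mem (h : ScottOpen S) {x : X} (hx : x ∈ S) :
    ∃ k, trunc k x ∈ S := by
  obtain ⟨Q, ⟨-, k, hk⟩, hxQ, hQS⟩ := h x hx
  exact ⟨k, hQS (hk x hxQ)⟩

theorem compactOpen_univ : CompactOpen (Set.univ : Set X) :=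
  ⟨isUpperSet_univ, 0, fun _ _ => trivial⟩

theorem compactOpen_empty : CompactOpen (∅ : Set X) :=
  ⟨isUpperSet_empty, 0, fun _ h => h.elim⟩

theorem compactOpen_trunc_le (k : ℕ) (S : Set X) : CompactOpen {x | ∃ y ∈ S, trunc k y ≤ x} :=
  ⟨fun _ _ hx ⟨y, hy, h⟩ => ⟨y, hy, h.trans hx⟩, k,
    fun _ ⟨y, hy, h⟩ => ⟨y, hy, (trunc_trunc k y).ge.trans (trunc_mono k h)⟩⟩

theorem compactOpen_preimage_trunc (k : ℕ) (hS : IsUpperSet S) :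
    CompactOpen ((trunc k : Hom X X) ⁻¹' S) :=
  ⟨fun _ _ hxy hx => hS (trunc_mono k hxy) hx, k, fun x hx => by
    rwa [Set.mem_preimage, trunc_trunc]⟩

theorem CompactOpen.inter (hS : CompactOpen S) (hT : CompactOpen T) : CompactOpen (S ∩ T) := by
  obtain ⟨hS, k, hk⟩ := hS
  obtain ⟨hT, l, hl⟩ := hT
  exact ⟨hS.inter hT, max k l, fun x hx => ⟨trunc_mem_of_le hS (le_max_left _ _) (hk x hx.1),
    trunc_mem_of_le hT (le_max_right _ _) (hl x hx.2)⟩⟩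

theorem CompactOpen.union (hS : CompactOpen S) (hT : CompactOpen T) : CompactOpen (S ∪ T) := by
  obtain ⟨hS, k, hk⟩ := hS
  obtain ⟨hT, l, hl⟩ := hT
  exact ⟨hS.union hT, max k l, fun x hx => hx.imp
    (fun hx => trunc_mem_of_le hS (le_max_left _ _) (hk x hx))
    (fun hx => trunc_mem_of_le hT (le_max_right _ _) (hl x hx))⟩

theorem ScottOpen.inter (hS : ScottOpen S) (hT : ScottOpen T) : ScottOpen (S ∩ T) := by
  rintro x ⟨hxS, hxT⟩
  obtain ⟨Q, hQ, hxQ, hQS⟩ := hS x hxS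
  obtain ⟨R, hR, hxR, hRT⟩ := hT x hxT
  exact ⟨Q ∩ R, hQ.inter hR, ⟨hxQ, hxR⟩, Set.inter_subset_inter hQS hRT⟩

theorem ScottOpen.iUnion {ι : Sort*} {S : ι → Set X} (h : ∀ i, ScottOpen (S i)) :
    ScottOpen (⋃ i, S i) := by
  intro x hx
  obtain ⟨i, hi⟩ := Set.mem_iUnion.1 hx
  obtain ⟨Q, hQ, hxQ, hQS⟩ := h i x hi
  exact ⟨Q, hQ, hxQ, hQS.trans (Set.subset_iUnion S i)⟩

theorem ScottOpen.union (hS : ScottOpen S) (hT : ScottOpen T) : ScottOpen (S ∪ T) := by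
  rw [Set.union_eq_iUnion]
  exact ScottOpen.iUnion (Bool.forall_bool.2 ⟨hT, hS⟩)

theorem CompactSat.union (hS : CompactSat S) (hT : CompactSat T) : CompactSat (S ∪ T) := by
  intro x hx
  obtain ⟨Q, hQ, hxQ, hQS⟩ := hS x fun h => hx (Or.inl h)
  obtain ⟨R, hR, hxR, hRT⟩ := hT x fun h => hx (Or.inr h)
  exact ⟨Q ∪ R, hQ.union hR, fun h => h.elim hxQ hxR, Set.union_subset_union hQS hRT⟩

theorem CompactSat.iInter {ι : Sort*} {S : ι → Set X} (h : ∀ i, CompactSat (S i)) :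
    CompactSat (⋂ i, S i) := by
  intro x hx
  obtain ⟨i, hi⟩ : ∃ i, x ∉ S i := by simpa using hx
  obtain ⟨Q, hQ, hxQ, hQS⟩ := h i x hi
  exact ⟨Q, hQ, hxQ, (Set.iInter_subset S i).trans hQS⟩

theorem CompactSat.inter (hS : CompactSat S) (hT : CompactSat T) : CompactSat (S ∩ T) := by
  rw [Set.inter_eq_iInter]
  exact CompactSat.iInter (Bool.forall_bool.2 ⟨hT, hS⟩)

theorem ScottOpen.iUnion_compactOpen (h : ScottOpen S) :
    ⋃ Q : {Q : Set X // CompactOpen Q ∧ Q ⊆ S}, Q.1 = S := by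
  refine subset_antisymm (Set.iUnion_subset fun Q => Q.2.2) fun x hx => ?_
  obtain ⟨Q, hQ, hxQ, hQS⟩ := h x hx
  exact Set.mem_iUnion.2 ⟨⟨Q, hQ, hQS⟩, hxQ⟩

theorem CompactSat.iInter_compactOpen (h : CompactSat S) :
    ⋂ Q : {Q : Set X // CompactOpen Q ∧ S ⊆ Q}, Q.1 = S := by
  refine subset_antisymm (fun x hx => ?_) (Set.subset_iInter fun Q => Q.2.2)
  by_contra hxS
  obtain ⟨Q, hQ, hxQ, hQS⟩ := h x hxS
  exact hxQ (Set.mem_iInter.1 hx ⟨Q, hQ, hQS⟩)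

theorem CompactSat.mem_of_forall_trunc (h : CompactSat S) {x : X}
    (hx : ∀ k, ∃ y ∈ S, trunc k y ≤ x) : x ∈ S := by
  by_contra hxS
  obtain ⟨Q, ⟨hQ, k, hk⟩, hxQ, hSQ⟩ := h x hxS
  obtain ⟨y, hy, hyx⟩ := hx k
  exact hxQ (hQ hyx (hk y (hSQ hy)))

-- Well-filteredness: points of the `S i` outside of `U` accumulate at a point of `⋂ i, S i`.
theorem ScottOpen.exists_subset_of_iInter_subset {ι : Type*} [Preorder ι] [IsDirectedOrder ι]
    [Nonempty ι] {S : ι → Set X} (hS : ∀ i, CompactSat (S i)) (hanti : Antitone S)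
    (hU : ScottOpen U) (h : ⋂ i, S i ⊆ U) : ∃ i, S i ⊆ U := by
  by_contra! hne
  choose x hxS hxU using fun i => Set.not_subset.1 (hne i)
  obtain ⟨y, hy⟩ := exists_eventually_trunc_eq (Ultrafilter.of Filter.atTop) x
  have hyU : y ∈ U := by
    refine h (Set.mem_iInter.2 fun i => (hS i).mem_of_forall_trunc fun k => ?_)
    obtain ⟨j, hjk, hij⟩ :=
      ((hy k).and (Ultrafilter.of_le _ (Filter.eventually_ge_atTop i))).exists
    exact ⟨x j, hanti hij (hxS j), hjk.trans_le (trunc_le k y)⟩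
  obtain ⟨k, hk⟩ := hU.exists_trunc_mem hyU
  obtain ⟨i, hi⟩ := (hy k).exists
  exact hxU i (hU.isUpperSet (trunc_le k _) (hi ▸ hk))

theorem CompactSat.exists_trunc_subset (hS : CompactSat S) (hU : ScottOpen U) (h : S ⊆ U) :
    ∃ k, {x | ∃ y ∈ S, trunc k y ≤ x} ⊆ U :=
  hU.exists_subset_of_iInter_subset (fun k => (compactOpen_trunc_le k S).compactSat)
    (fun _ _ hkl _ ⟨y, hy, hyx⟩ => ⟨y, hy, (trunc_mono_level y hkl).trans hyx⟩)
    fun _ hx => h (hS.mem_of_forall_trunc (Set.mem_iInter.1 hx))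

theorem CompactOpen.exists_subset_of_subset_iUnion {ι : Type*} [Preorder ι] [IsDirectedOrder ι]
    [Nonempty ι] (hS : CompactOpen S) {T : ι → Set X} (hT : ∀ i, IsUpperSet (T i))
    (hmono : Monotone T) (h : S ⊆ ⋃ i, T i) : ∃ i, S ⊆ T i := by
  obtain ⟨-, k, hk⟩ := hS
  have hcover : (trunc k : Hom X X) '' S ⊆ ⋃ i, T i :=
    (Set.image_subset_iff.2 hk).trans h
  obtain ⟨I, hI, hcover⟩ := Set.finite_subset_iUnion (finite_image_trunc k S) hcover
  obtain ⟨i, hi⟩ := hI.bddAbove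
  refine ⟨i, fun x hx => hT i (trunc_le k x) ?_⟩
  obtain ⟨j, hj, hxj⟩ := Set.mem_iUnion₂.1 (hcover ⟨x, hx, rfl⟩)
  exact hmono (hi hj) hxj

theorem ScottOpen.preimage {S : Set Y} (hS : ScottOpen S) (f : Hom X Y) : ScottOpen (f ⁻¹' S) := by
  intro x hx
  obtain ⟨m, hm⟩ := hS.exists_trunc_mem hx
  have hmono : Monotone fun k => f (trunc k x) := f.mono.comp (trunc_mono_level x)
  obtain ⟨_, ⟨k, rfl⟩, hk⟩ := exists_trunc_eq_of_isLUB (Set.range_nonempty _)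
    hmono.directed_le.directedOn_range (isLUB_apply_trunc f x) m
  refine ⟨_, compactOpen_trunc_le k {x}, ⟨x, rfl, trunc_le k x⟩, ?_⟩
  rintro y ⟨_, rfl, hy⟩
  exact hS.isUpperSet ((trunc_le m _).trans (f.mono hy)) (hk ▸ hm)

theorem CompactOpen.preimage {S : Set Y} (hS : CompactOpen S) (f : Hom X Y) {l : ℕ → ℕ}
    (hl : ∀ k x, trunc k (f x) ≤ f (trunc (l k) x)) : CompactOpen (f ⁻¹' S) :=
  let ⟨hS, k, hk⟩ := hS
  ⟨fun _ _ hxy hx => hS (f.mono hxy) hx, l k, fun x hx => hS (hl k x) (hk _ hx)⟩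

theorem CompactOpen.image (hS : CompactOpen S) {f : X → Y} {l : ℕ → ℕ}
    (hf : ∀ x x', f x ≤ f x' ↔ x ≤ x') (hup : ∀ x y, f x ≤ y → ∃ x', y = f x')
    (hl : ∀ k x, f (trunc k x) ≤ trunc (l k) (f x)) : CompactOpen (f '' S) := by
  obtain ⟨hS, k, hk⟩ := hS
  have hupper : IsUpperSet (f '' S) := by
    rintro _ y hxy ⟨x, hx, rfl⟩
    obtain ⟨y, rfl⟩ := hup _ _ hxy
    exact ⟨y, hS ((hf _ _).1 hxy) hx, rfl⟩
  refine ⟨hupper, l k, ?_⟩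
  rintro _ ⟨x, hx, rfl⟩
  exact hupper (hl k x) ⟨_, hk x hx, rfl⟩

end Bifinite

/-! ### Bounded completeness and step functions -/

/-- Every bounded set has a supremum. Bifinite domains with this property are Scott domains. -/
def BoundedComplete (X : Cpo) : Prop := ∀ s : Set X, BddAbove s → ∃ a, IsLUB s a

section BoundedComplete

variable {X Y : Cpo}

theorem boundedComplete_one : BoundedComplete Cpo.one := fun _ _ =>
  ⟨PUnit.unit, fun _ _ => le_rfl, fun _ _ => le_rfl⟩

theorem boundedComplete_two : BoundedComplete Cpo.two := fun s _ =>
  ⟨_, isLUB_sSup (α := Bool) s⟩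

theorem BoundedComplete.prod (hX : BoundedComplete X) (hY : BoundedComplete Y) :
    BoundedComplete (Cpo.prod X Y) := by
  intro s hs
  obtain ⟨a, ha⟩ := hX (Prod.fst '' (s : Set (X × Y))) (monotone_fst.map_bddAbove hs)
  obtain ⟨b, hb⟩ := hY (Prod.snd '' (s : Set (X × Y))) (monotone_snd.map_bddAbove hs)
  exact ⟨(a, b), isLUB_prod.2 ⟨ha, hb⟩⟩

theorem BoundedComplete.exp (hY : BoundedComplete Y) : BoundedComplete (Cpo.exp X Y) := by
  rintro s ⟨c, hc⟩
  have h : ∀ x, ∃ a, IsLUB (Set.range fun f : s => Hom.toFun f.1 x) a := fun x =>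
    hY _ ⟨Hom.toFun c x, Set.forall_mem_range.2 fun f => hc f.2 x⟩
  choose g hg using h
  refine ⟨(⟨g, scottContinuous_of_isLUB _ (fun f : s => Hom.cont f.1) g hg⟩ : Hom X Y), ?_, ?_⟩
  · exact fun f hf x => (hg x).1 ⟨⟨f, hf⟩, rfl⟩
  · exact fun b hb x => (hg x).2 (Set.forall_mem_range.2 fun f => hb f.2 x)

theorem BoundedComplete.exists_isLUB_of_embedding (hX : BoundedComplete X) {Z : Type}
    [PartialOrder Z] [OrderBot Z] {j : X → Z} (hj : ∀ x y, j x ≤ j y ↔ x ≤ y)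
    (hup : ∀ x z, j x ≤ z → ∃ y, z = j y) (hdown : ∀ x z, z ≤ j x → z = ⊥ ∨ ∃ y, z = j y)
    {s : Set Z} (hs : BddAbove s) {x₀ : X} (hx₀ : j x₀ ∈ s) : ∃ a, IsLUB s a := by
  obtain ⟨c, hc⟩ := hs
  obtain ⟨c, rfl⟩ := hup _ _ (hc hx₀)
  obtain ⟨a, ha⟩ := hX (j ⁻¹' s) ⟨c, fun x hx => (hj _ _).1 (hc hx)⟩
  refine ⟨j a, fun z hz => ?_, fun b hb => ?_⟩
  · obtain rfl | ⟨x, rfl⟩ := hdown _ _ (hc hz)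
    · exact bot_le
    · exact (hj _ _).2 (ha.1 hz)
  · obtain ⟨b, rfl⟩ := hup _ _ (hb hx₀)
    exact (hj _ _).2 (ha.2 fun x hx => (hj _ _).1 (hb hx))

theorem inl_injective : Function.Injective (Hom.inl (X := X) (Y := Y)) := fun _ _ h =>
  Sum.inl_injective (Option.some_injective _ h)

theorem inr_injective : Function.Injective (Hom.inr (X := X) (Y := Y)) := fun _ _ h =>
  Sum.inr_injective (Option.some_injective _ h)

theorem inl_ne_inr (x : X) (y : Y) : Hom.inl (X := X) (Y := Y) x ≠ Hom.inr (X := X) (Y := Y) y :=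
  fun h => Sum.inl_ne_inr (Option.some_injective _ h)

theorem BoundedComplete.sum (hX : BoundedComplete X) (hY : BoundedComplete Y) :
    BoundedComplete (Cpo.sum X Y) := by
  intro (s : Set (Cpo.WSum X Y)) (hs : BddAbove s)
  change ∃ a : Cpo.WSum X Y, IsLUB s a
  obtain ⟨x, hx⟩ | ⟨y, hy⟩ | h := Cpo.WSum.trichotomy s
  · refine hX.exists_isLUB_of_embedding Cpo.WSum.inl_le Cpo.WSum.inl_up (fun c z hz => ?_) hs hx
    obtain rfl | h | ⟨y, rfl⟩ := Cpo.WSum.cases z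
    · exact Or.inl rfl
    · exact Or.inr h
    · obtain ⟨d, hd⟩ := Cpo.WSum.inr_up _ _ hz
      exact absurd hd (inl_ne_inr c d)
  · refine hY.exists_isLUB_of_embedding Cpo.WSum.inr_le Cpo.WSum.inr_up (fun c z hz => ?_) hs hy
    obtain rfl | ⟨x, rfl⟩ | h := Cpo.WSum.cases z
    · exact Or.inl rfl
    · obtain ⟨d, hd⟩ := Cpo.WSum.inl_up _ _ hz
      exact absurd hd.symm (inl_ne_inr d c)
    · exact Or.inr h
  · exact ⟨⊥, fun z hz => (h z hz).le, fun _ _ => bot_le⟩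

theorem EP.gc (c : EP X Y) : GaloisConnection c.e c.p := fun x y =>
  ⟨fun h => (c.p_e x).ge.trans (c.p.mono h), fun h => (c.e.mono h).trans (c.e_p y)⟩

theorem Chain.Cocone.IsColim.boundedComplete {C : Chain} {c : C.Cocone X} (hc : c.IsColim)
    (hC : ∀ k, BoundedComplete (C.obj k)) : BoundedComplete X := by
  intro s hs
  have h : ∀ k, ∃ a, IsLUB ((c.ep k).e '' ((c.ep k).p '' s)) a := fun k =>
    let ⟨z, hz⟩ := hC k _ ((c.ep k).p.mono.map_bddAbove hs)
    ⟨_, (c.ep k).gc.isLUB_l_image hz⟩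
  choose a ha using h
  have hmono : Monotone a := by
    intro k l hkl
    refine (ha k).2 ?_
    rintro _ ⟨_, ⟨x, hx, rfl⟩, rfl⟩
    exact (c.mono c x hkl).trans ((ha l).1 ⟨_, ⟨x, hx, rfl⟩, rfl⟩)
  have hsup := hmono.directed_le.directedOn_range.isLUB_sSup
  refine ⟨_, fun x hx => (hc x).2 ?_, fun b hb => hsup.2 ?_⟩
  · rintro _ ⟨k, rfl⟩
    exact ((ha k).1 ⟨_, ⟨x, hx, rfl⟩, rfl⟩).trans (hsup.1 ⟨k, rfl⟩)
  · rintro _ ⟨k, rfl⟩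
    refine (ha k).2 ?_
    rintro _ ⟨_, ⟨x, hx, rfl⟩, rfl⟩
    exact ((c.ep k).e_p x).trans (hb hx)

/-- The least function which maps `a` above `b`. -/
def stepFun (a : X) (b : Y) (x : X) : Y := open Classical in if a ≤ x then b else ⊥

theorem stepFun_of_le {a x : X} (h : a ≤ x) (b : Y) : stepFun a b x = b := if_pos h

theorem stepFun_le {a x : X} {b c : Y} (h : a ≤ x → b ≤ c) : stepFun a b x ≤ c := by
  unfold stepFun
  split_ifs with hax
  · exact h hax
  · exact bot_le

variable [Bifinite X]

theorem scottContinuous_stepFun {a : X} (ha : CompactOpen (Set.Ici a)) (b : Y) :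
    ScottContinuous (stepFun a b) := by
  obtain ⟨-, k, hk⟩ := ha
  intro d hne hd c hc
  refine ⟨Set.forall_mem_image.2 fun x hx => stepFun_le fun h => ?_,
    fun y hy => stepFun_le fun h => ?_⟩
  · rw [stepFun_of_le (h.trans (hc.1 hx))]
  · obtain ⟨x, hx, hxc⟩ := exists_trunc_eq_of_isLUB hne hd hc k
    have hax : a ≤ x := calc
      a ≤ trunc k a := hk a le_rfl
      _ ≤ trunc k c := trunc_mono k h
      _ = trunc k x := hxc.symm
      _ ≤ x := trunc_le k x
    exact (stepFun_of_le hax b).ge.trans (hy ⟨x, hx, rfl⟩)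

theorem BoundedComplete.exists_least_hom (hY : BoundedComplete Y) {ι : Type*} {a : ι → X}
    {b : ι → Y} (ha : ∀ i, CompactOpen (Set.Ici (a i))) (h : ∀ x, ∃ c, ∀ i, a i ≤ x → b i ≤ c) :
    ∃ f : Hom X Y, (∀ i x, a i ≤ x → b i ≤ f x) ∧
      ∀ g : Hom X Y, (∀ i, b i ≤ g (a i)) → f ≤ g := by
  have hlub : ∀ x, ∃ c, IsLUB (Set.range fun i => stepFun (a i) (b i) x) c := fun x =>
    let ⟨c, hc⟩ := h x
    hY _ ⟨c, Set.forall_mem_range.2 fun i => stepFun_le (hc i)⟩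
  choose f hf using hlub
  refine ⟨⟨f, scottContinuous_of_isLUB _ (fun i => scottContinuous_stepFun (ha i) (b i)) f hf⟩,
    fun i x hi => (stepFun_of_le hi (b i)).ge.trans ((hf x).1 ⟨i, rfl⟩), fun g hg x => ?_⟩
  exact (hf x).2 (Set.forall_mem_range.2 fun i => stepFun_le fun hi => (hg i).trans (g.mono hi))

end BoundedComplete

/-! ### The interpretation of types -/

/-- A colimit of finite cpos is bifinite: the `k`-th truncation passes through the `k`-th one. -/
abbrev Chain.Cocone.IsColim.bifinite {C : Chain} {X : Cpo} {c : C.Cocone X} (hc : c.IsColim)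
    (hC : ∀ k, Finite (C.obj k)) : Bifinite X where
  trunc k := (c.ep k).e.comp (c.ep k).p
  trunc_le k := (c.ep k).e_p
  trunc_trunc k _ := congrArg (c.ep k).e ((c.ep k).p_e _)
  trunc_mono_level := c.mono c
  isLUB_trunc := hc
  finite_range_trunc k :=
    have := hC k
    (Set.finite_range (c.ep k).e).subset (Set.range_comp_subset_range (c.ep k).p (c.ep k).e)

theorem Chain.Cocone.e_p_map_le {C : Chain} {X Y : Cpo} (c : C.Cocone X) (c' : C.Cocone Y) (k : ℕ)
    (x : X) : (c'.ep k).e ((c'.ep k).p (c.map c' x)) ≤ c.map c' ((c.ep k).e ((c.ep k).p x)) := by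
  have h : (c'.ep k).p (c.map c' x) = (c'.ep k).p (c.map c' ((c.ep k).e ((c.ep k).p x))) := by
    rw [c.p_map, c.p_map, EP.p_e]
  exact h ▸ (c'.ep k).e_p _

theorem finite_step {prev : ∀ {n : ℕ}, Ty n → Cpo} (h : ∀ {n : ℕ} (A : Ty n), Finite (prev A)) :
    {n : ℕ} → (A : Ty n) → Finite (step prev A)
  | _, .var _ => inferInstanceAs (Finite PUnit)
  | _, .unit => inferInstanceAs (Finite Bool)
  | _, .prod A B =>
    have := finite_step h A
    have := finite_step h B
    inferInstanceAs (Finite (step prev A × step prev B))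
  | _, .arrow A B =>
    have := finite_step h A
    have := finite_step h B
    Finite.of_injective (β := step prev A → step prev B) (fun f => Hom.toFun f)
      (fun _ _ h => Hom.ext h)
  | _, .sum A B =>
    have := finite_step h A
    have := finite_step h B
    inferInstanceAs (Finite (Option (step prev A ⊕ step prev B)))
  | _, .mu A => h A.unroll

theorem finite_approx : (k : ℕ) → ∀ {n : ℕ} (A : Ty n), Finite (approx k A)
  | 0, _, _ => inferInstanceAs (Finite PUnit)
  | k + 1, _, A => finite_step (finite_approx k) A

theorem boundedComplete_step {prev : ∀ {n : ℕ}, Ty n → Cpo}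
    (h : ∀ {n : ℕ} (A : Ty n), BoundedComplete (prev A)) :
    {n : ℕ} → (A : Ty n) → BoundedComplete (step prev A)
  | _, .var _ => boundedComplete_one
  | _, .unit => boundedComplete_two
  | _, .prod A B => (boundedComplete_step h A).prod (boundedComplete_step h B)
  | _, .arrow _ B => (boundedComplete_step h B).exp
  | _, .sum A B => (boundedComplete_step h A).sum (boundedComplete_step h B)
  | _, .mu A => h A.unroll

theorem boundedComplete_approx : (k : ℕ) → ∀ {n : ℕ} (A : Ty n), BoundedComplete (approx k A)
  | 0, _, _ => boundedComplete_one
  | k + 1, _, A => boundedComplete_step (boundedComplete_approx k) A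

instance {n : ℕ} (A : Ty n) : Bifinite (Dom A) :=
  (domCocone_isColim A).bifinite fun k => finite_approx k A

theorem boundedComplete_dom {n : ℕ} (A : Ty n) : BoundedComplete (Dom A) :=
  (domCocone_isColim A).boundedComplete fun k => boundedComplete_approx k A

section Dom

variable {n : ℕ} {A B : Ty n}

theorem trunc_arrow_apply (k : ℕ) (f : Dom (.arrow A B)) (x : Dom A) :
    Hom.toFun (trunc k f) x = trunc k (Hom.toFun f (trunc k x)) := by
  cases k <;> rfl

theorem fst_trunc (k : ℕ) (x : Dom (.prod A B)) : (trunc k x).1 = trunc k x.1 := by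
  cases k <;> rfl

theorem snd_trunc (k : ℕ) (x : Dom (.prod A B)) : (trunc k x).2 = trunc k x.2 := by
  cases k <;> rfl

-- The level is a successor because `trunc 0` is constantly `⊥`, which is not an injection.
theorem trunc_inl (k : ℕ) (x : Dom A) :
    trunc (X := Dom (.sum A B)) (k + 1) (Hom.inl x) = Hom.inl (trunc (k + 1) x) := rfl

theorem trunc_inr (k : ℕ) (x : Dom B) :
    trunc (X := Dom (.sum A B)) (k + 1) (Hom.inr x) = Hom.inr (trunc (k + 1) x) := rfl

theorem trunc_unfold_le (k : ℕ) (A : Ty (n + 1)) (x : Dom (.mu A)) :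
    trunc k (unfoldHom A x) ≤ unfoldHom A (trunc (k + 1) x) :=
  (unrollCocone A).e_p_map_le (domCocone A.unroll) k x

end Dom

/-! ### Modalities and implication -/

section Modality

variable {A B : PTy} (m : Modality A B)

theorem Modality.sem_mono : Monotone m.sem := by
  intro S T h
  cases m with
  | inj₁ | inj₂ => exact Set.image_mono h
  | proj₁ | proj₂ | fold => exact Set.preimage_mono h

theorem Modality.sem_iUnion {ι : Sort*} (S : ι → Set (Dom A)) :
    m.sem (⋃ i, S i) = ⋃ i, m.sem (S i) := by
  cases m with
  | inj₁ | inj₂ => exact Set.image_iUnion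
  | proj₁ | proj₂ | fold => exact Set.preimage_iUnion

theorem Modality.sem_iInter {ι : Sort*} [Nonempty ι] (S : ι → Set (Dom A)) :
    m.sem (⋂ i, S i) = ⋂ i, m.sem (S i) := by
  cases m with
  | inj₁ => exact inl_injective.injOn.image_iInter_eq
  | inj₂ => exact inr_injective.injOn.image_iInter_eq
  | proj₁ | proj₂ | fold => exact Set.preimage_iInter

variable {S : Set (Dom A)}

theorem Modality.compactOpen (h : CompactOpen S) : CompactOpen (m.sem S) := by
  cases m with
  | @proj₁ _ C =>
    exact h.preimage (X := Dom (.prod A C)) Hom.fst fun k x => (fst_trunc k x).ge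
  | @proj₂ C =>
    exact h.preimage (X := Dom (.prod C A)) Hom.snd fun k x => (snd_trunc k x).ge
  | inj₁ =>
    exact h.image (Y := Dom (.sum _ _)) Cpo.WSum.inl_le Cpo.WSum.inl_up fun k x =>
      (Hom.inl.mono (trunc_mono_level x k.le_succ)).trans (trunc_inl k x).ge
  | inj₂ =>
    exact h.image (Y := Dom (.sum _ _)) Cpo.WSum.inr_le Cpo.WSum.inr_up fun k x =>
      (Hom.inr.mono (trunc_mono_level x k.le_succ)).trans (trunc_inr k x).ge
  | fold => exact h.preimage (unfoldHom _) fun k x => trunc_unfold_le k _ x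

theorem Modality.scottOpen (h : ScottOpen S) : ScottOpen (m.sem S) := by
  rw [← h.iUnion_compactOpen, m.sem_iUnion]
  exact ScottOpen.iUnion fun Q => (m.compactOpen Q.2.1).scottOpen

theorem Modality.compactSat (h : CompactSat S) : CompactSat (m.sem S) := by
  have : Nonempty {Q : Set (Dom A) // CompactOpen Q ∧ S ⊆ Q} :=
    ⟨⟨_, compactOpen_univ, Set.subset_univ _⟩⟩
  rw [← h.iInter_compactOpen, m.sem_iInter]
  exact CompactSat.iInter fun Q => (m.compactOpen Q.2.1).compactSat

end Modality

section semImp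

variable {A B : PTy} {S S' : Set (Dom B)} {T T' : Set (Dom A)}

theorem semImp_mono (hS : S' ⊆ S) (hT : T ⊆ T') : semImp S T ⊆ semImp S' T' :=
  fun _ hf x hx => hT (hf x (hS hx))

theorem CompactOpen.semImp (hS : CompactOpen S) (hT : CompactOpen T) :
    CompactOpen (semImp S T) := by
  obtain ⟨hS, k, hk⟩ := hS
  obtain ⟨hT, l, hl⟩ := hT
  refine ⟨fun f g hfg hf x hx => hT (hfg x) (hf x hx), max k l, fun f hf x hx => ?_⟩
  rw [trunc_arrow_apply]
  refine trunc_mem_of_le hT (le_max_right k l) (hl _ (hf _ ?_))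
  exact trunc_mem_of_le hS (le_max_left k l) (hk x hx)

theorem CompactSat.semImp (hS : ScottOpen S) (hT : CompactSat T) : CompactSat (semImp S T) := by
  intro f hf
  obtain ⟨x, hx, hfx⟩ : ∃ x ∈ S, Hom.toFun f x ∉ T := by simpa [FPC.semImp] using hf
  obtain ⟨R, hR, hxR, hRS⟩ := hS x hx
  obtain ⟨Q, hQ, hfQ, hTQ⟩ := hT _ hfx
  exact ⟨_, hR.semImp hQ, fun h => hfQ (h x hxR), semImp_mono hRS hTQ⟩

theorem CompactOpen.exists_mem_semImp {ι : Type*} [Preorder ι] [IsDirectedOrder ι] [Nonempty ι]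
    (hS : CompactOpen S) {T : ι → Set (Dom A)} (hT : ∀ i, IsUpperSet (T i)) (hmono : Monotone T)
    {f : Dom (.arrow B A)} (hf : f ∈ FPC.semImp S (⋃ i, T i)) : ∃ i, f ∈ FPC.semImp S (T i) :=
  hS.exists_subset_of_subset_iUnion (T := fun i => Hom.toFun f ⁻¹' T i)
    (fun i _ _ hxy hx => hT i (Hom.mono f hxy) hx) (fun _ _ hij _ hx => hmono hij hx)
    fun x hx => by simpa using hf x hx

theorem ScottOpen.semImp (hS : CompactSat S) (hT : ScottOpen T) : ScottOpen (semImp S T) := by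
  intro f hf
  obtain ⟨k, hk⟩ := hS.exists_trunc_subset (hT.preimage f) hf
  have hTrunc : ∀ l, CompactOpen ((trunc l : Hom (Dom A) (Dom A)) ⁻¹' T) := fun l =>
    compactOpen_preimage_trunc l hT.isUpperSet
  obtain ⟨l, hl⟩ := (compactOpen_trunc_le k S).exists_mem_semImp (fun l => (hTrunc l).1)
    (fun _ _ hij _ hx => trunc_mem_of_le hT.isUpperSet hij hx)
    (fun x hx => Set.mem_iUnion.2 (hT.exists_trunc_mem (hk hx)))
  exact ⟨_, (compactOpen_trunc_le k S).semImp (hTrunc l), hl,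
    semImp_mono (fun y hy => ⟨y, hy, trunc_le k y⟩) fun x hx => hT.isUpperSet (trunc_le l x) hx⟩

end semImp

/-! ### Substitution -/

section Substitution

variable {Φ Ψ : List PTy} {A B : PTy}

theorem ITm.sem_subst (σ : ℕ → ITm) (ρ : ℕ → ℕ) (t : ITm) :
    (t.subst σ).sem ρ = t.sem fun k => (σ k).sem ρ := by
  induction t with
  | var k => rfl
  | zero => rfl
  | succ t ih => exact congrArg (· + 1) ih

theorem ITm.sem_up (σ : ℕ → ITm) (ρ : ℕ → ℕ) (i : ℕ) :
    (fun k => (ITm.up σ k).sem (ivalCons i ρ)) = ivalCons i fun k => (σ k).sem ρ := by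
  funext k
  cases k with
  | zero => rfl
  | succ k => exact ITm.sem_subst _ _ _

theorem ITm.sem_inst (t : ITm) (ρ : ℕ → ℕ) :
    (fun k => (t.inst k).sem ρ) = ivalCons (t.sem ρ) ρ := by
  funext k
  cases k <;> rfl

/-- The set from which an iteration starts. -/
def IterKind.start {α : Type*} : IterKind → Set α
  | .mu => ∅
  | .nu => Set.univ

theorem Form.sem_iter (ρ : ℕ → ℕ) (v : FVal Φ) (b : IterKind) (t : ITm)
    (φ : Form (A :: Φ) A) :
    (Form.iter b t φ).sem ρ v = (fun S => φ.sem ρ (v.cons S))^[t.sem ρ] b.start := by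
  cases b <;> rfl

theorem Form.sem_substI (φ : Form Φ A) (σ : ℕ → ITm) (ρ : ℕ → ℕ)
    (v : FVal Φ) : (φ.substI σ).sem ρ v = φ.sem (fun k => (σ k).sem ρ) v := by
  induction φ generalizing σ ρ with
  | top | bot | star | var => rfl
  | and φ ψ ih₁ ih₂ | or φ ψ ih₁ ih₂ => simp only [substI, sem, ih₁, ih₂]
  | mod m φ ih => simp only [substI, sem, ih]
  | iter b t φ ih => simp only [substI, sem_iter, ih, ITm.sem_subst]
  | ex φ ih | all φ ih => simp only [substI, sem, ih, ITm.sem_up]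
  | imp ψ φ ih₁ ih₂ => simp only [substI, sem, ih₁, ih₂]

theorem Form.sem_lift (φ : Form Φ A) (i : ℕ) (ρ : ℕ → ℕ) (v : FVal Φ) :
    φ.lift.sem (ivalCons i ρ) v = φ.sem ρ v := φ.sem_substI _ _ _

theorem Form.sem_inst (φ : Form Φ A) (t : ITm) (ρ : ℕ → ℕ)
    (v : FVal Φ) : (φ.inst t).sem ρ v = φ.sem (ivalCons (t.sem ρ) ρ) v := by
  rw [inst, sem_substI, ITm.sem_inst]

theorem Form.sem_renF (φ : Form Φ A)
    (r : ∀ B, FVar Φ B → FVar Ψ B) (ρ : ℕ → ℕ) (v : FVal Ψ) :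
    (φ.renF r).sem ρ v = φ.sem ρ fun B X => v B (r B X) := by
  induction φ generalizing ρ Ψ with
  | top | bot | star | var | imp => rfl
  | and φ ψ ih₁ ih₂ | or φ ψ ih₁ ih₂ => simp only [renF, sem, ih₁, ih₂]
  | mod m φ ih => simp only [renF, sem, ih]
  | iter b t φ ih =>
    simp only [renF, sem_iter, ih]
    congr 2
    funext S
    congr 1
    funext B X
    cases X <;> rfl
  | ex φ ih | all φ ih => simp only [renF, sem, ih]

theorem Form.sem_substF (φ : Form Φ A)
    (s : ∀ B, FVar Φ B → Form Ψ B) (ρ : ℕ → ℕ) (v : FVal Ψ) :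
    (φ.substF s).sem ρ v = φ.sem ρ fun B X => (s B X).sem ρ v := by
  induction φ generalizing ρ Ψ with
  | top | bot | star | var | imp => rfl
  | and φ ψ ih₁ ih₂ | or φ ψ ih₁ ih₂ => simp only [substF, sem, ih₁, ih₂]
  | mod m φ ih => simp only [substF, sem, ih]
  | iter b t φ ih =>
    simp only [substF, sem_iter, ih]
    congr 2
    funext S
    congr 1
    funext B X
    cases X with
    | zero => rfl
    | succ X => exact sem_renF _ _ _ _
  | ex φ ih | all φ ih => simp only [substF, sem, ih, sem_lift]

theorem Form.sem_instF (φ : Form (B :: Φ) A) (ψ : Form Φ B)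
    (ρ : ℕ → ℕ) (v : FVal Φ) : (φ.instF ψ).sem ρ v = φ.sem ρ (v.cons (ψ.sem ρ v)) := by
  rw [instF, sem_substF]
  congr 1
  funext B X
  cases X <;> rfl

end Substitution

/-! ### Monotonicity of formulae -/

section Monotonicity

variable {Φ : List PTy} {A B : PTy} {k : ℕ} {ρ ρ' : ℕ → ℕ}

theorem FVal.cons_mono {S S' : Set (Dom A)} {v v' : FVal Φ} (hS : S ≤ S') (hv : v ≤ v') :
    v.cons S ≤ v'.cons S' := by
  intro B X
  cases X with
  | zero => exact hS
  | succ X => exact hv _ X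

theorem Form.sem_mono (φ : Form Φ A) (ρ : ℕ → ℕ) : Monotone fun v => φ.sem ρ v := by
  induction φ generalizing ρ with
  | top | bot | star | imp => exact fun _ _ _ => le_rfl
  | var X => exact fun _ _ h => h _ X
  | and φ ψ ih₁ ih₂ => exact fun _ _ h => Set.inter_subset_inter (ih₁ ρ h) (ih₂ ρ h)
  | or φ ψ ih₁ ih₂ => exact fun _ _ h => Set.union_subset_union (ih₁ ρ h) (ih₂ ρ h)
  | mod m φ ih => exact fun _ _ h => m.sem_mono (ih ρ h)
  | iter b t φ ih =>
    intro v v' h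
    simp only [sem_iter]
    exact Monotone.iterate_le_of_le (fun _ _ hS => ih ρ (FVal.cons_mono hS le_rfl))
      (fun _ => ih ρ (FVal.cons_mono le_rfl h)) _ _
  | ex φ ih => exact fun _ _ h => Set.iUnion_mono fun i => ih _ h
  | all φ ih => exact fun _ _ h => Set.iInter_mono fun i => ih _ h

theorem Form.sem_cons_mono (φ : Form (B :: Φ) A) (ρ : ℕ → ℕ) (v : FVal Φ) :
    Monotone fun S => φ.sem ρ (v.cons S) :=
  fun _ _ h => φ.sem_mono ρ (FVal.cons_mono h le_rfl)

theorem ITm.sem_congr (t : ITm) (h : ∀ k, t.Free k → ρ k = ρ' k) : t.sem ρ = t.sem ρ' := by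
  induction t with
  | var k => exact h k rfl
  | zero => rfl
  | succ t ih => exact congrArg (· + 1) (ih h)

theorem ITm.sem_mono (t : ITm) : Monotone fun ρ => t.sem ρ := by
  intro ρ ρ' h
  induction t with
  | var k => exact h k
  | zero => exact le_rfl
  | succ t ih => exact Nat.succ_le_succ ih

theorem Form.sem_congr (φ : Form Φ A) (h : ∀ k, φ.Free k → ρ k = ρ' k) (v : FVal Φ) :
    φ.sem ρ v = φ.sem ρ' v := by
  induction φ generalizing ρ ρ' with
  | top | bot | star | var => rfl
  | and φ ψ ih₁ ih₂ | or φ ψ ih₁ ih₂ | imp φ ψ ih₁ ih₂ =>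
    simp only [sem, ih₁ (fun k hk => h k (Or.inl hk)), ih₂ (fun k hk => h k (Or.inr hk))]
  | mod m φ ih => simp only [sem, ih h]
  | iter b t φ ih =>
    simp only [sem_iter, ih (fun k hk => h k (Or.inr hk)),
      t.sem_congr (fun k hk => h k (Or.inl hk))]
  | ex φ ih =>
    refine Set.iUnion_congr fun i => ih ?_ v
    rintro (_ | k) hk
    · rfl
    · exact h k hk
  | all φ ih =>
    refine Set.iInter_congr fun i => ih ?_ v
    rintro (_ | k) hk
    · rfl
    · exact h k hk

/-- The valuation `ρ'` is obtained from `ρ` by increasing the value of the variable `k`. -/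
def IncreaseAt (k : ℕ) (ρ ρ' : ℕ → ℕ) : Prop := ρ ≤ ρ' ∧ ∀ j, j ≠ k → ρ j = ρ' j

namespace IncreaseAt

theorem ivalCons (h : IncreaseAt k ρ ρ') (i : ℕ) :
    IncreaseAt (k + 1) (ivalCons i ρ) (ivalCons i ρ') := by
  refine ⟨?_, ?_⟩
  · rintro (_ | j)
    · exact le_rfl
    · exact h.1 j
  · rintro (_ | j) hj
    · rfl
    · exact h.2 j fun e => hj (congrArg (· + 1) e)

theorem sem_eq (h : IncreaseAt k ρ ρ') {φ : Form Φ A} (hφ : ¬ φ.Free k) (v : FVal Φ) :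
    φ.sem ρ v = φ.sem ρ' v :=
  φ.sem_congr (fun j hj => h.2 j fun e => hφ (e ▸ hj)) v

theorem sem_itm_eq (h : IncreaseAt k ρ ρ') {t : ITm} (ht : ¬ t.Free k) : t.sem ρ = t.sem ρ' :=
  t.sem_congr fun j hj => h.2 j fun e => ht (e ▸ hj)

end IncreaseAt

theorem increaseAt_ivalCons {i j : ℕ} (h : i ≤ j) (ρ : ℕ → ℕ) :
    IncreaseAt 0 (ivalCons i ρ) (ivalCons j ρ) := by
  refine ⟨?_, ?_⟩
  · rintro (_ | k)
    · exact h
    · exact le_rfl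
  · rintro (_ | k) hk
    · exact absurd rfl hk
    · rfl

theorem Form.sem_iter_subset {φ : Form (A :: Φ) A} {v : FVal Φ}
    (hφ : ∀ S, φ.sem ρ (v.cons S) ⊆ φ.sem ρ' (v.cons S)) {t : ITm} (ht : t.sem ρ = t.sem ρ')
    (b : IterKind) : (iter b t φ).sem ρ v ⊆ (iter b t φ).sem ρ' v := by
  rw [sem_iter, sem_iter, ht]
  exact (φ.sem_cons_mono ρ v).iterate_le_of_le hφ _ _

theorem Form.sem_mu_subset {φ : Form (A :: Φ) A} {v : FVal Φ}
    (hφ : ∀ S, φ.sem ρ (v.cons S) ⊆ φ.sem ρ' (v.cons S)) {t : ITm} (ht : t.sem ρ ≤ t.sem ρ') :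
    (iter .mu t φ).sem ρ v ⊆ (iter .mu t φ).sem ρ' v :=
  ((φ.sem_cons_mono ρ v).iterate_le_of_le hφ _ _).trans <|
    (φ.sem_cons_mono ρ' v).monotone_iterate_of_le_map (Set.empty_subset _) ht

theorem Form.sem_nu_subset {φ : Form (A :: Φ) A} {v : FVal Φ}
    (hφ : ∀ S, φ.sem ρ (v.cons S) ⊆ φ.sem ρ' (v.cons S)) {t : ITm} (ht : t.sem ρ' ≤ t.sem ρ) :
    (iter .nu t φ).sem ρ v ⊆ (iter .nu t φ).sem ρ' v :=
  ((φ.sem_cons_mono ρ v).iterate_le_of_le hφ _ _).trans <|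
    (φ.sem_cons_mono ρ' v).antitone_iterate_of_map_le (Set.subset_univ _) ht

mutual

theorem Pos.sem_subset {Φ : List PTy} {A : PTy} {k : ℕ} {φ : Form Φ A} (hφ : Pos k φ)
    {ρ ρ' : ℕ → ℕ} (h : IncreaseAt k ρ ρ') (v : FVal Φ) : φ.sem ρ v ⊆ φ.sem ρ' v :=
  match hφ with
  | .notFree hf => (h.sem_eq hf v).subset
  | .and h₁ h₂ => Set.inter_subset_inter (h₁.sem_subset h v) (h₂.sem_subset h v)
  | .or h₁ h₂ => Set.union_subset_union (h₁.sem_subset h v) (h₂.sem_subset h v)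
  | .mod h₁ => Modality.sem_mono _ (h₁.sem_subset h v)
  | .imp h₁ h₂ => semImp_mono (h₁.sem_subset h _) (h₂.sem_subset h _)
  | .ex h₁ => Set.iUnion_mono fun i => h₁.sem_subset (h.ivalCons i) v
  | .mu h₁ => Form.sem_mu_subset (fun _ => h₁.sem_subset h _) (ITm.sem_mono _ h.1)
  | .nu h₁ ht => Form.sem_iter_subset (fun _ => h₁.sem_subset h _) (h.sem_itm_eq ht) .nu

theorem Neg.sem_subset {Φ : List PTy} {A : PTy} {k : ℕ} {φ : Form Φ A} (hφ : Neg k φ)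
    {ρ ρ' : ℕ → ℕ} (h : IncreaseAt k ρ ρ') (v : FVal Φ) : φ.sem ρ' v ⊆ φ.sem ρ v :=
  match hφ with
  | .notFree hf => (h.sem_eq hf v).superset
  | .and h₁ h₂ => Set.inter_subset_inter (h₁.sem_subset h v) (h₂.sem_subset h v)
  | .or h₁ h₂ => Set.union_subset_union (h₁.sem_subset h v) (h₂.sem_subset h v)
  | .mod h₁ => Modality.sem_mono _ (h₁.sem_subset h v)
  | .imp h₁ h₂ => semImp_mono (h₁.sem_subset h _) (h₂.sem_subset h _)
  | .all h₁ => Set.iInter_mono fun i => h₁.sem_subset (h.ivalCons i) v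
  | .nu h₁ => Form.sem_nu_subset (fun _ => h₁.sem_subset h _) (ITm.sem_mono _ h.1)
  | .mu h₁ ht => Form.sem_iter_subset (fun _ => h₁.sem_subset h _) (h.sem_itm_eq ht).symm .mu

end

theorem Pos.sem_monotone {φ : Form Φ A} (h : Pos 0 φ) (ρ : ℕ → ℕ) (v : FVal Φ) :
    Monotone fun i => φ.sem (ivalCons i ρ) v :=
  fun _ _ hij => h.sem_subset (increaseAt_ivalCons hij ρ) v

theorem Neg.sem_antitone {φ : Form Φ A} (h : Neg 0 φ) (ρ : ℕ → ℕ) (v : FVal Φ) :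
    Antitone fun i => φ.sem (ivalCons i ρ) v :=
  fun _ _ hij => h.sem_subset (increaseAt_ivalCons hij ρ) v

theorem Pos.of_ex {φ : Form Φ A} (h : Pos k φ.ex) : Pos (k + 1) φ := by
  cases h with
  | notFree hf => exact .notFree hf
  | ex h => exact h

theorem Neg.of_all {φ : Form Φ A} (h : Neg k φ.all) : Neg (k + 1) φ := by
  cases h with
  | notFree hf => exact .notFree hf
  | all h => exact h

theorem Pos.sem_monotone_of_ex {φ : Form Φ A} (h : Pos 0 φ.ex) (i : ℕ) (ρ : ℕ → ℕ) (v : FVal Φ) :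
    Monotone fun j => φ.sem (ivalCons i (ivalCons j ρ)) v :=
  fun _ _ hj => h.of_ex.sem_subset ((increaseAt_ivalCons hj ρ).ivalCons i) v

theorem Neg.sem_antitone_of_all {φ : Form Φ A} (h : Neg 0 φ.all) (i : ℕ) (ρ : ℕ → ℕ)
    (v : FVal Φ) : Antitone fun j => φ.sem (ivalCons i (ivalCons j ρ)) v :=
  fun _ _ hj => h.of_all.sem_subset ((increaseAt_ivalCons hj ρ).ivalCons i) v

end Monotonicity

/-! ### Continuity of positive and negative formulae -/

section Continuity

variable {Φ : List PTy} {A B : PTy} {ι : Type*}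

theorem FVal.cons_iUnion (S : ι → Set (Dom A)) (v : ι → FVal Φ) :
    FVal.cons (⋃ i, S i) (fun B X => ⋃ i, v i B X) = fun B X => ⋃ i, (v i).cons (S i) B X := by
  funext B X
  cases X <;> rfl

theorem FVal.cons_iInter (S : ι → Set (Dom A)) (v : ι → FVal Φ) :
    FVal.cons (⋂ i, S i) (fun B X => ⋂ i, v i B X) = fun B X => ⋂ i, (v i).cons (S i) B X := by
  funext B X
  cases X <;> rfl

variable [Preorder ι] [Nonempty ι]

theorem iterate_subset_iUnion {α : Type*} {F : Set α → Set α} {G : ι → Set α → Set α}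
    (hF : Monotone F) (hG : ∀ i, Monotone (G i)) (hGm : Monotone G)
    (h : ∀ S : ι → Set α, Monotone S → F (⋃ i, S i) ⊆ ⋃ i, G i (S i)) (s : Set α) (n : ℕ) :
    F^[n] s ⊆ ⋃ i, (G i)^[n] s := by
  induction n with
  | zero => exact Set.subset_iUnion (fun _ : ι => s) (Classical.arbitrary ι)
  | succ n ih =>
    simp only [Function.iterate_succ_apply']
    exact (hF ih).trans (h _ fun i j hij => (hG i).iterate_le_of_le (hGm hij) n s)

theorem iInter_subset_iterate {α : Type*} {F : Set α → Set α} {G : ι → Set α → Set α}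
    (hF : Monotone F) (hG : ∀ i, Monotone (G i)) (hGm : Antitone G)
    (h : ∀ S : ι → Set α, Antitone S → ⋂ i, G i (S i) ⊆ F (⋂ i, S i)) (s : Set α) (n : ℕ) :
    ⋂ i, (G i)^[n] s ⊆ F^[n] s := by
  induction n with
  | zero => exact Set.iInter_subset (fun _ : ι => s) (Classical.arbitrary ι)
  | succ n ih =>
    simp only [Function.iterate_succ_apply']
    exact (h _ fun i j hij => (hG j).iterate_le_of_le (hGm hij) n s).trans (hF ih)

variable [IsDirectedOrder ι]

theorem InL.sem_iUnion_subset {φ : Form Φ A} (hφ : InL .pos φ)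
    (ρ : ℕ → ℕ) {v : ι → FVal Φ} (hv : Monotone v) :
    φ.sem ρ (fun B X => ⋃ i, v i B X) ⊆ ⋃ i, φ.sem ρ (v i) := by
  induction φ generalizing ρ with
  | top | bot | star | imp => exact Set.subset_iUnion_of_subset (Classical.arbitrary ι) subset_rfl
  | var X => exact subset_rfl
  | and φ ψ ih₁ ih₂ =>
    cases hφ with
    | and h₁ h₂ =>
      refine (Set.inter_subset_inter (ih₁ h₁ ρ hv) (ih₂ h₂ ρ hv)).trans ?_
      exact (Set.iUnion_inter_of_monotone ((φ.sem_mono ρ).comp hv)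
        ((ψ.sem_mono ρ).comp hv)).superset
  | or φ ψ ih₁ ih₂ =>
    cases hφ with
    | or h₁ h₂ =>
      refine (Set.union_subset_union (ih₁ h₁ ρ hv) (ih₂ h₂ ρ hv)).trans ?_
      exact (Set.iUnion_union_distrib _ _).superset
  | mod m φ ih =>
    cases hφ with
    | mod h => exact (m.sem_mono (ih h ρ hv)).trans (m.sem_iUnion _).subset
  | iter b t φ ih =>
    cases hφ with
    | iter h =>
      simp only [Form.sem_iter]
      refine iterate_subset_iUnion (φ.sem_cons_mono ρ _) (fun i => φ.sem_cons_mono ρ (v i))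
        (fun i j hij S => φ.sem_mono ρ (FVal.cons_mono le_rfl (hv hij))) ?_ _ _
      intro S hS
      rw [FVal.cons_iUnion]
      exact ih h ρ fun i j hij => FVal.cons_mono (hS hij) (hv hij)
  | ex φ ih =>
    cases hφ with
    | ex h =>
      refine Set.iUnion_subset fun i => (ih h _ hv).trans (Set.iUnion_mono fun j => ?_)
      exact Set.subset_iUnion (fun i => φ.sem (ivalCons i ρ) (v j)) i
  | all φ ih => cases hφ

theorem InL.iInter_sem_subset {φ : Form Φ A} (hφ : InL .neg φ)
    (ρ : ℕ → ℕ) {v : ι → FVal Φ} (hv : Antitone v) :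
    ⋂ i, φ.sem ρ (v i) ⊆ φ.sem ρ (fun B X => ⋂ i, v i B X) := by
  induction φ generalizing ρ with
  | top | bot | star | imp => exact Set.iInter_subset_of_subset (Classical.arbitrary ι) subset_rfl
  | var X => exact subset_rfl
  | and φ ψ ih₁ ih₂ =>
    cases hφ with
    | and h₁ h₂ =>
      refine subset_trans ?_ (Set.inter_subset_inter (ih₁ h₁ ρ hv) (ih₂ h₂ ρ hv))
      exact (Set.iInter_inter_distrib _ _).subset
  | or φ ψ ih₁ ih₂ =>
    cases hφ with
    | or h₁ h₂ =>
      refine subset_trans ?_ (Set.union_subset_union (ih₁ h₁ ρ hv) (ih₂ h₂ ρ hv))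
      exact (Set.iInter_union_of_antitone ((φ.sem_mono ρ).comp_antitone hv)
        ((ψ.sem_mono ρ).comp_antitone hv)).subset
  | mod m φ ih =>
    cases hφ with
    | mod h => exact (m.sem_iInter _).superset.trans (m.sem_mono (ih h ρ hv))
  | iter b t φ ih =>
    cases hφ with
    | iter h =>
      simp only [Form.sem_iter]
      refine iInter_subset_iterate (φ.sem_cons_mono ρ _) (fun i => φ.sem_cons_mono ρ (v i))
        (fun i j hij S => φ.sem_mono ρ (FVal.cons_mono le_rfl (hv hij))) ?_ _ _
      intro S hS
      rw [FVal.cons_iInter]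
      exact ih h ρ fun i j hij => FVal.cons_mono (hS hij) (hv hij)
  | ex φ ih => cases hφ
  | all φ ih =>
    cases hφ with
    | all h =>
      refine Set.subset_iInter fun i => subset_trans (Set.iInter_mono fun j => ?_) (ih h _ hv)
      exact Set.iInter_subset (fun i => φ.sem (ivalCons i ρ) (v j)) i

theorem InL.sem_cons_iUnion_subset {φ : Form (B :: Φ) A} (hφ : InL .pos φ) (ρ : ℕ → ℕ) (v : FVal Φ)
    {S : ι → Set (Dom B)} (hS : Monotone S) :
    φ.sem ρ (v.cons (⋃ i, S i)) ⊆ ⋃ i, φ.sem ρ (v.cons (S i)) := by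
  have h := FVal.cons_iUnion S fun _ => v
  simp only [Set.iUnion_const] at h
  rw [h]
  exact hφ.sem_iUnion_subset ρ fun i j hij => FVal.cons_mono (hS hij) le_rfl

theorem InL.iInter_sem_cons_subset {φ : Form (B :: Φ) A} (hφ : InL .neg φ) (ρ : ℕ → ℕ) (v : FVal Φ)
    {S : ι → Set (Dom B)} (hS : Antitone S) :
    ⋂ i, φ.sem ρ (v.cons (S i)) ⊆ φ.sem ρ (v.cons (⋂ i, S i)) := by
  have h := FVal.cons_iInter S fun _ => v
  simp only [Set.iInter_const] at h
  rw [h]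
  exact hφ.iInter_sem_subset ρ fun i j hij => FVal.cons_mono (hS hij) le_rfl

end Continuity

/-! ### The topology of formulae -/

/-- The class of sets denoted by the formulae of a polarity. -/
def Sign.Denotes {A : PTy} : Sign → Set (Dom A) → Prop
  | .neutral => CompactOpen
  | .pos => ScottOpen
  | .neg => CompactSat

namespace Sign.Denotes

variable {A B : PTy} {s : Sign}

theorem of_compactOpen {S : Set (Dom A)} (h : CompactOpen S) : s.Denotes S := by
  cases s with
  | neutral => exact h
  | pos => exact h.scottOpen
  | neg => exact h.compactSat

theorem isUpperSet {S : Set (Dom A)} (h : s.Denotes S) : IsUpperSet S := by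
  cases s with
  | neutral => exact h.1
  | pos => exact ScottOpen.isUpperSet h
  | neg => exact CompactSat.isUpperSet h

theorem inter {S T : Set (Dom A)} (hS : s.Denotes S) (hT : s.Denotes T) : s.Denotes (S ∩ T) := by
  cases s with
  | neutral => exact CompactOpen.inter hS hT
  | pos => exact ScottOpen.inter hS hT
  | neg => exact CompactSat.inter hS hT

theorem union {S T : Set (Dom A)} (hS : s.Denotes S) (hT : s.Denotes T) : s.Denotes (S ∪ T) := by
  cases s with
  | neutral => exact CompactOpen.union hS hT
  | pos => exact ScottOpen.union hS hT
  | neg => exact CompactSat.union hS hT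

theorem mod (m : Modality A B) {S : Set (Dom A)} (hS : s.Denotes S) : s.Denotes (m.sem S) := by
  cases s with
  | neutral => exact m.compactOpen hS
  | pos => exact m.scottOpen hS
  | neg => exact m.compactSat hS

theorem semImp {S : Set (Dom B)} {T : Set (Dom A)} (hS : s.opp.Denotes S) (hT : s.Denotes T) :
    s.Denotes (semImp S T) := by
  cases s with
  | neutral => exact CompactOpen.semImp hS hT
  | pos => exact ScottOpen.semImp hS hT
  | neg => exact CompactSat.semImp hS hT

end Sign.Denotes

theorem compactOpen_sem_star {Φ : List PTy} (ρ : ℕ → ℕ) (v : FVal Φ) :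
    CompactOpen (Form.star.sem ρ v) := by
  refine ⟨?_, 1, ?_⟩
  · rintro x y h rfl
    exact (top_le_iff (α := Bool)).1 h
  · rintro x rfl
    exact (rfl : (⊤ : Bool) = ⊤)

theorem InL.sem_denotes {Φ : List PTy} {A : PTy} {s : Sign} {φ : Form Φ A} (h : InL s φ)
    (ρ : ℕ → ℕ) {v : FVal Φ} (hv : ∀ B X, s.Denotes (v B X)) : s.Denotes (φ.sem ρ v) := by
  induction h generalizing ρ with
  | top => exact .of_compactOpen compactOpen_univ
  | bot => exact .of_compactOpen compactOpen_empty
  | and _ _ ih₁ ih₂ => exact (ih₁ ρ hv).inter (ih₂ ρ hv)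
  | or _ _ ih₁ ih₂ => exact (ih₁ ρ hv).union (ih₂ ρ hv)
  | star => exact .of_compactOpen (compactOpen_sem_star ρ _)
  | mod _ ih => exact (ih ρ hv).mod _
  | var => exact hv _ _
  | @iter Φ A s b t φ _ ih =>
    rw [Form.sem_iter]
    generalize t.sem ρ = n
    induction n with
    | zero =>
      cases b with
      | mu => exact .of_compactOpen compactOpen_empty
      | nu => exact .of_compactOpen compactOpen_univ
    | succ n ihn =>
      rw [Function.iterate_succ_apply']
      refine ih ρ fun B X => ?_
      cases X with
      | zero => exact ihn
      | succ X => exact hv _ X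
  | ex _ _ ih => exact ScottOpen.iUnion fun i => ih _ hv
  | all _ _ ih => exact CompactSat.iInter fun i => ih _ hv
  | imp _ _ ih₁ ih₂ => exact (ih₁ ρ nofun).semImp (ih₂ ρ nofun)

theorem InL.sem_nil_denotes {A : PTy} {s : Sign} {φ : Form [] A} (h : InL s φ) (ρ : ℕ → ℕ) :
    s.Denotes (φ.sem ρ FVal.nil) := h.sem_denotes ρ nofun

theorem InMeet.inL {A : PTy} {φ : Form [] A} (h : InMeet φ) (s : Sign) : InL s φ := by
  induction h generalizing s with
  | top => exact .top
  | bot => exact .bot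
  | and _ _ ih₁ ih₂ => exact .and (ih₁ s) (ih₂ s)
  | star => exact .star
  | mod _ ih => exact .mod (ih s)
  | imp _ _ ih₁ ih₂ => exact .imp (ih₁ _) (ih₂ s)

theorem InMeet.compactOpen {A : PTy} {φ : Form [] A} (h : InMeet φ) (ρ : ℕ → ℕ) :
    CompactOpen (φ.sem ρ FVal.nil) := (h.inL .neutral).sem_nil_denotes ρ

theorem Modality.nonempty_of_sem {A B : PTy} (m : Modality A B) {S : Set (Dom A)}
    (h : (m.sem S).Nonempty) : S.Nonempty := by
  obtain ⟨x, hx⟩ := h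
  cases m with
  | proj₁ | proj₂ | fold => exact ⟨_, hx⟩
  | inj₁ | inj₂ => exact hx.imp fun _ h => h.1

theorem Modality.exists_sem_Ici {A B : PTy} (m : Modality A B) (a : Dom A) :
    ∃ b, m.sem (Set.Ici a) = Set.Ici b := by
  cases m with
  | @proj₁ A B =>
    exact ⟨((a, ⊥) : Dom A × Dom B), Set.ext fun x => ⟨fun h => ⟨h, bot_le⟩, fun h => h.1⟩⟩
  | @proj₂ B A =>
    exact ⟨((⊥, a) : Dom B × Dom A), Set.ext fun x => ⟨fun h => ⟨bot_le, h⟩, fun h => h.2⟩⟩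
  | inj₁ =>
    refine ⟨Cpo.WSum.inl a, Set.ext fun x => ⟨?_, fun h => ?_⟩⟩
    · rintro ⟨y, hy, rfl⟩
      exact (Cpo.WSum.inl_le _ _).2 hy
    · obtain ⟨y, rfl⟩ := Cpo.WSum.inl_up _ _ h
      exact ⟨y, (Cpo.WSum.inl_le _ _).1 h, rfl⟩
  | inj₂ =>
    refine ⟨Cpo.WSum.inr a, Set.ext fun x => ⟨?_, fun h => ?_⟩⟩
    · rintro ⟨y, hy, rfl⟩
      exact (Cpo.WSum.inr_le _ _).2 hy
    · obtain ⟨y, rfl⟩ := Cpo.WSum.inr_up _ _ h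
      exact ⟨y, (Cpo.WSum.inr_le _ _).1 h, rfl⟩
  | @fold A =>
    refine ⟨foldHom A a, Set.ext fun x => ⟨fun h => ?_, fun h => ?_⟩⟩
    · exact ((foldHom A).mono h).trans_eq (fold_unfold A x)
    · exact (unfold_fold A a).ge.trans ((unfoldHom A).mono h)

theorem BoundedComplete.exists_Ici_inter {X : Cpo} (hX : BoundedComplete X) {a b : X}
    (h : (Set.Ici a ∩ Set.Ici b).Nonempty) : ∃ c, Set.Ici a ∩ Set.Ici b = Set.Ici c := by
  simp only [← upperBounds_singleton, ← upperBounds_union] at h ⊢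
  obtain ⟨c, hc⟩ := hX _ h
  exact ⟨c, hc.upperBounds_eq.trans upperBounds_singleton.symm⟩

theorem exists_semImp_Ici {A B : PTy} {a : Dom B} (ha : CompactOpen (Set.Ici a)) (b : Dom A) :
    ∃ f, semImp (Set.Ici a) (Set.Ici b) = Set.Ici f := by
  obtain ⟨f, hf, hmin⟩ := (boundedComplete_dom A).exists_least_hom (a := fun _ : Unit => a)
    (b := fun _ => b) (fun _ => ha) fun _ => ⟨b, fun _ _ => le_rfl⟩
  exact ⟨(f : Hom (Dom B) (Dom A)), subset_antisymm
    (fun g hg => hmin g fun _ => hg a Set.self_mem_Ici)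
    fun g hg x hx => (hf () x hx).trans (hg x)⟩

theorem semImp_empty {A B : PTy} (T : Set (Dom A)) : semImp (B := B) ∅ T = Set.univ :=
  Set.eq_univ_of_forall fun _ _ hx => hx.elim

theorem InMeet.exists_sem_eq_Ici {A : PTy} {φ : Form [] A} (h : InMeet φ) (ρ : ℕ → ℕ)
    (hne : (φ.sem ρ FVal.nil).Nonempty) : ∃ a, φ.sem ρ FVal.nil = Set.Ici a := by
  induction h with
  | top => exact ⟨⊥, Set.Ici_bot.symm⟩
  | bot => exact hne.elim fun _ h => h.elim
  | and _ _ ih₁ ih₂ =>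
    obtain ⟨a, ha⟩ := ih₁ hne.left
    obtain ⟨b, hb⟩ := ih₂ hne.right
    simp only [Form.sem, ha, hb] at hne ⊢
    exact (boundedComplete_dom _).exists_Ici_inter hne
  | star => exact ⟨(⊤ : Bool), (Set.Ici_top (α := Bool)).symm⟩
  | @mod A B m φ _ ih =>
    obtain ⟨a, ha⟩ := ih (m.nonempty_of_sem hne)
    simpa only [Form.sem, ha] using m.exists_sem_Ici a
  | @imp A B ψ φ hψ _ ih₁ ih₂ =>
    rcases (ψ.sem ρ FVal.nil).eq_empty_or_nonempty with hempty | ⟨x, hx⟩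
    · simpa only [Form.sem, hempty, semImp_empty] using ⟨⊥, Set.Ici_bot.symm⟩
    · obtain ⟨a, ha⟩ := ih₁ ⟨x, hx⟩
      obtain ⟨b, hb⟩ := ih₂ (hne.elim fun f hf => ⟨_, hf x hx⟩)
      simpa only [Form.sem, ha, hb] using exists_semImp_Ici (ha ▸ hψ.compactOpen ρ) b

/-! ### Soundness of deduction -/

section

variable {Φ : List PTy} {A B : PTy}

theorem Modality.sem_inter_subset (m : Modality A B) (S T : Set (Dom A)) :
    m.sem S ∩ m.sem T ⊆ m.sem (S ∩ T) := by
  simp only [Set.inter_eq_iInter, m.sem_iInter]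
  exact (Set.iInter_congr (by rintro (_ | _) <;> rfl)).subset

theorem Modality.sem_union_subset (m : Modality A B) (S T : Set (Dom A)) :
    m.sem (S ∪ T) ⊆ m.sem S ∪ m.sem T := by
  simp only [Set.union_eq_iUnion, m.sem_iUnion]
  exact (Set.iUnion_congr (by rintro (_ | _) <;> rfl)).subset

theorem Modality.sem_empty_subset (m : Modality A B) : m.sem ∅ ⊆ ∅ :=
  fun x hx => (m.nonempty_of_sem ⟨x, hx⟩).elim fun _ h => h

theorem Modality.univ_subset_sem {m : Modality A B} (hm : ¬m.IsInj) :
    Set.univ ⊆ m.sem Set.univ := by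
  cases m with
  | proj₁ | proj₂ | fold => exact fun _ h => h
  | inj₁ | inj₂ => exact (hm trivial).elim

theorem foldHom_mem_sem_fold {A : Ty 1} {S : Set (Dom A.unroll)} {x : Dom A.unroll}
    (hx : x ∈ S) : foldHom A x ∈ Modality.fold.sem S := by
  change unfoldHom A (foldHom A x) ∈ S
  rwa [unfold_fold]

theorem Modality.disjoint_inj₁_inj₂ (S : Set (Dom A)) (T : Set (Dom B)) :
    Disjoint (Modality.inj₁.sem S) (Modality.inj₂.sem T) := by
  rw [Set.disjoint_left]
  rintro _ ⟨x, -, rfl⟩ ⟨y, -, h⟩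
  exact inl_ne_inr _ _ h.symm

theorem Form.sem_inst_subset_ex (φ : Form Φ A) (t : ITm) (ρ : ℕ → ℕ) (v : FVal Φ) :
    (φ.inst t).sem ρ v ⊆ φ.ex.sem ρ v := by
  rw [sem_inst]
  exact Set.subset_iUnion (fun i => φ.sem (ivalCons i ρ) v) _

theorem Form.sem_all_subset_inst (φ : Form Φ A) (t : ITm) (ρ : ℕ → ℕ) (v : FVal Φ) :
    φ.all.sem ρ v ⊆ (φ.inst t).sem ρ v := by
  rw [sem_inst]
  exact Set.iInter_subset (fun i => φ.sem (ivalCons i ρ) v) _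

theorem Form.sem_and_ex_subset {θ φ ψ : Form Φ A} {ρ : ℕ → ℕ} {v : FVal Φ}
    (h : ∀ i, (θ.lift.and φ).sem (ivalCons i ρ) v ⊆ ψ.lift.sem (ivalCons i ρ) v) :
    (θ.and φ.ex).sem ρ v ⊆ ψ.sem ρ v := by
  simp only [sem, sem_lift] at h ⊢
  rw [Set.inter_iUnion]
  exact Set.iUnion_subset h

theorem Form.subset_sem_all_or {ψ φ θ : Form Φ A} {ρ : ℕ → ℕ} {v : FVal Φ}
    (h : ∀ i, ψ.lift.sem (ivalCons i ρ) v ⊆ (φ.or θ.lift).sem (ivalCons i ρ) v) :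
    ψ.sem ρ v ⊆ (φ.all.or θ).sem ρ v := by
  simp only [sem, sem_lift] at h ⊢
  rw [Set.iInter_union]
  exact Set.subset_iInter h

theorem Pos.sem_ex_ex_subset {φ : Form Φ A} (h : Pos 0 φ) (h' : Pos 0 φ.ex) (ρ : ℕ → ℕ)
    (v : FVal Φ) : φ.ex.ex.sem ρ v ⊆ (φ.inst (.var 0)).ex.sem ρ v := by
  refine Set.iUnion_subset fun i => Set.iUnion_subset fun j =>
    Set.subset_iUnion_of_subset (max i j) ?_
  rw [Form.sem_inst]
  exact (h.sem_monotone _ v (le_max_right i j)).trans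
    (h'.sem_monotone_of_ex _ ρ v (le_max_left i j))

theorem Neg.sem_all_subset_all_all {φ : Form Φ A} (h : Neg 0 φ) (h' : Neg 0 φ.all) (ρ : ℕ → ℕ)
    (v : FVal Φ) : (φ.inst (.var 0)).all.sem ρ v ⊆ φ.all.all.sem ρ v := by
  refine Set.subset_iInter fun i => Set.subset_iInter fun j =>
    Set.iInter_subset_of_subset (max i j) ?_
  rw [Form.sem_inst]
  exact (h'.sem_antitone_of_all _ ρ v (le_max_left i j)).trans
    (h.sem_antitone _ v (le_max_right i j))

theorem ITm.sem_shift (t : ITm) (i : ℕ) (ρ : ℕ → ℕ) :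
    (t.subst fun k => .var (k + 1)).sem (ivalCons i ρ) = t.sem ρ := t.sem_subst _ _

theorem InL.sem_iter_ex_subset {φ : Form (A :: Φ) A} (h : InL .pos φ) (hk : Pos 0 φ)
    (b : IterKind) (t : ITm) (ρ : ℕ → ℕ) (v : FVal Φ) :
    (Form.iter b t φ.ex).sem ρ v ⊆ (Form.iter b (t.subst fun k => .var (k + 1)) φ).ex.sem ρ v := by
  rw [Form.sem]
  simp only [Form.sem_iter, ITm.sem_shift]
  refine iterate_subset_iUnion (φ.ex.sem_cons_mono ρ v) (fun i => φ.sem_cons_mono (ivalCons i ρ) v)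
    (fun i j hij S => hk.sem_monotone ρ _ hij) (fun S hS => Set.iUnion_subset fun i => ?_) _ _
  refine (h.sem_cons_iUnion_subset _ v hS).trans (Set.iUnion_subset fun j => ?_)
  exact Set.subset_iUnion_of_subset (max i j) ((hk.sem_monotone ρ _ (le_max_left i j)).trans
    (φ.sem_cons_mono _ v (hS (le_max_right i j))))

theorem InL.sem_all_iter_subset {φ : Form (A :: Φ) A} (h : InL .neg φ) (hk : Neg 0 φ)
    (b : IterKind) (t : ITm) (ρ : ℕ → ℕ) (v : FVal Φ) :
    (Form.iter b (t.subst fun k => .var (k + 1)) φ).all.sem ρ v ⊆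
      (Form.iter b t φ.all).sem ρ v := by
  rw [Form.sem]
  simp only [Form.sem_iter, ITm.sem_shift]
  refine iInter_subset_iterate (φ.all.sem_cons_mono ρ v) (fun i => φ.sem_cons_mono (ivalCons i ρ) v)
    (fun i j hij S => hk.sem_antitone ρ _ hij) (fun S hS => Set.subset_iInter fun i => ?_) _ _
  refine subset_trans (Set.subset_iInter fun j => ?_) (h.iInter_sem_cons_subset _ v hS)
  exact Set.iInter_subset_of_subset (max i j) ((hk.sem_antitone ρ _ (le_max_left i j)).trans
    (φ.sem_cons_mono _ v (hS (le_max_right i j))))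

theorem Form.sem_iter_succ (b : IterKind) (t : ITm) (φ : Form (A :: Φ) A) (ρ : ℕ → ℕ)
    (v : FVal Φ) : (iter b t.succ φ).sem ρ v = (φ.instF (iter b t φ)).sem ρ v := by
  rw [sem_instF, sem_iter, sem_iter, ITm.sem, Function.iterate_succ_apply']

theorem Form.sem_instF_subset (φ : Form (B :: Φ) A) {ψ θ : Form Φ B} {ρ : ℕ → ℕ} {v : FVal Φ}
    (h : ψ.sem ρ v ⊆ θ.sem ρ v) : (φ.instF ψ).sem ρ v ⊆ (φ.instF θ).sem ρ v := by
  rw [sem_instF, sem_instF]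
  exact φ.sem_cons_mono ρ v h

theorem Form.sem_iter_subset_iter (b : IterKind) (t : ITm) {ψ φ : Form (A :: Φ) A} {ρ : ℕ → ℕ}
    (h : ∀ v, ψ.sem ρ v ⊆ φ.sem ρ v) (v : FVal Φ) :
    (iter b t ψ).sem ρ v ⊆ (iter b t φ).sem ρ v := by
  rw [sem_iter, sem_iter]
  exact (ψ.sem_cons_mono ρ v).iterate_le_of_le (fun S => h _) _ _

theorem sem_all_imp_subset {ψ : Form [] B} {φ : Form [] A} (hψ : InL .neg ψ) (hk : Neg 0 ψ)
    (hφ : InL .pos φ) (ρ : ℕ → ℕ) (v : FVal Φ) :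
    (Form.imp ψ.all φ).sem ρ v ⊆ (Form.imp ψ φ.lift).ex.sem ρ v := by
  intro f hf
  have hopen := ScottOpen.preimage (hφ.sem_nil_denotes ρ) f
  obtain ⟨i, hi⟩ := hopen.exists_subset_of_iInter_subset
    (fun i => hψ.sem_nil_denotes (ivalCons i ρ)) (hk.sem_antitone ρ _) hf
  refine Set.mem_iUnion.2 ⟨i, fun x hx => ?_⟩
  rw [Form.sem_lift]
  exact hi hx

theorem sem_imp_ex_subset {ψ : Form [] B} {φ : Form [] A} (hψ : InL .neutral ψ) (hφ : InL .pos φ)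
    (hk : Pos 0 φ) (ρ : ℕ → ℕ) (v : FVal Φ) :
    (Form.imp ψ φ.ex).sem ρ v ⊆ (Form.imp ψ.lift φ).ex.sem ρ v := by
  intro f hf
  obtain ⟨i, hi⟩ := CompactOpen.exists_mem_semImp (hψ.sem_nil_denotes ρ)
    (fun i => (hφ.sem_nil_denotes (ivalCons i ρ)).isUpperSet) (hk.sem_monotone ρ _) hf
  refine Set.mem_iUnion.2 ⟨i, fun x hx => ?_⟩
  rw [Form.sem_lift] at hx
  exact hi x hx

theorem sem_all_imp_lift_subset (ψ : Form [] B) (φ : Form [] A) (ρ : ℕ → ℕ) (v : FVal Φ) :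
    (Form.imp ψ φ.lift).all.sem ρ v ⊆ (Form.imp ψ.ex φ).sem ρ v := by
  intro f hf x hx
  obtain ⟨i, hi⟩ := Set.mem_iUnion.1 hx
  exact φ.sem_lift i ρ _ ▸ Set.mem_iInter.1 hf i x hi

theorem sem_all_lift_imp_subset (ψ : Form [] B) (φ : Form [] A) (ρ : ℕ → ℕ) (v : FVal Φ) :
    (Form.imp ψ.lift φ).all.sem ρ v ⊆ (Form.imp ψ φ.all).sem ρ v :=
  fun _ hf x hx => Set.mem_iInter.2 fun i =>
    Set.mem_iInter.1 hf i x ((ψ.sem_lift i ρ _).symm ▸ hx)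

theorem semImp_Ici_union_subset {S T : Set (Dom A)} (hS : IsUpperSet S) (hT : IsUpperSet T)
    (a : Dom B) :
    semImp (Set.Ici a) (S ∪ T) ⊆ semImp (Set.Ici a) S ∪ semImp (Set.Ici a) T :=
  fun f hf => (hf a Set.self_mem_Ici).imp (fun h _ hx => hS (Hom.mono f hx) h)
    (fun h _ hx => hT (Hom.mono f hx) h)

theorem InMeet.sem_imp_or_subset {δ : Form [] B} (hδ : InMeet δ) {φ₁ φ₂ : Form [] A} {s : Sign}
    (h₁ : InL s φ₁) (h₂ : InL s φ₂) (ρ : ℕ → ℕ) (v : FVal Φ) :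
    (Form.imp δ (φ₁.or φ₂)).sem ρ v ⊆ ((Form.imp δ φ₁).or (Form.imp δ φ₂)).sem ρ v := by
  rcases (δ.sem ρ FVal.nil).eq_empty_or_nonempty with hempty | hne
  · simp only [Form.sem, hempty, semImp_empty, Set.union_self, subset_rfl]
  · obtain ⟨a, ha⟩ := hδ.exists_sem_eq_Ici ρ hne
    simp only [Form.sem, ha]
    exact semImp_Ici_union_subset (h₁.sem_nil_denotes ρ).isUpperSet
      (h₂.sem_nil_denotes ρ).isUpperSet a

theorem Form.mem_sem_conj {ρ : ℕ → ℕ} {v : FVal Φ} {l : List (Form Φ A)} {x : Dom A} :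
    x ∈ (conj l).sem ρ v ↔ ∀ φ ∈ l, x ∈ φ.sem ρ v := by
  induction l with
  | nil => simp [conj, sem]
  | cons φ l ih => simp [conj, sem, ih]

theorem InMeet.conj {l : List (Form [] A)} (h : ∀ φ ∈ l, InMeet φ) : InMeet (Form.conj l) := by
  induction l with
  | nil => exact .top
  | cons φ l ih =>
    exact .and (h φ List.mem_cons_self) (ih fun ψ hψ => h ψ (List.mem_cons_of_mem _ hψ))

theorem exists_forall_mem_semImp_Ici {ι : Type*} {a : ι → Dom B} {b : ι → Dom A}
    (ha : ∀ i, CompactOpen (Set.Ici (a i)))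
    (h : ∀ x, ∃ y, ∀ i, x ∈ Set.Ici (a i) → y ∈ Set.Ici (b i)) :
    ∃ f, ∀ i, f ∈ semImp (Set.Ici (a i)) (Set.Ici (b i)) := by
  obtain ⟨f, hf, -⟩ := (boundedComplete_dom A).exists_least_hom ha h
  exact ⟨(f : Hom (Dom B) (Dom A)), hf⟩

theorem InMeet.nonempty_sem_conj_imp {l : List (Form [] B × Form [] A)} {ρ : ℕ → ℕ}
    (h₁ : ∀ i ∈ l, InMeet i.1 ∧ (i.1.sem ρ FVal.nil).Nonempty)
    (h₂ : ∀ i ∈ l, InMeet i.2 ∧ (i.2.sem ρ FVal.nil).Nonempty)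
    (h : ∀ J : List (Form [] B × Form [] A), J.Sublist l →
      ((Form.conj (J.map Prod.fst)).sem ρ FVal.nil).Nonempty →
      ((Form.conj (J.map Prod.snd)).sem ρ FVal.nil).Nonempty) :
    ((Form.conj (l.map fun i => Form.imp i.1 i.2)).sem ρ FVal.nil).Nonempty := by
  classical
  choose a ha using fun i : {i // i ∈ l} => (h₁ i.1 i.2).1.exists_sem_eq_Ici ρ (h₁ i.1 i.2).2
  choose b hb using fun i : {i // i ∈ l} => (h₂ i.1 i.2).1.exists_sem_eq_Ici ρ (h₂ i.1 i.2).2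
  have hab (x : Dom B) : ∃ y, ∀ i, x ∈ Set.Ici (a i) → y ∈ Set.Ici (b i) := by
    simp only [← ha, ← hb]
    obtain ⟨y, hy⟩ := h (l.filter fun i => x ∈ i.1.sem ρ FVal.nil) List.filter_sublist
      ⟨x, Form.mem_sem_conj.2 <| by simp⟩
    refine ⟨y, fun i hi => Form.mem_sem_conj.1 hy _ (List.mem_map_of_mem ?_)⟩
    exact List.mem_filter.2 ⟨i.2, decide_eq_true hi⟩
  obtain ⟨f, hf⟩ := exists_forall_mem_semImp_Ici
    (fun i => ha i ▸ (h₁ i.1 i.2).1.compactOpen ρ) hab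
  refine ⟨f, Form.mem_sem_conj.2 <| List.forall_mem_map.2 fun i hi => ?_⟩
  have := hf ⟨i, hi⟩
  rwa [← ha, ← hb] at this

end

theorem Con.inMeet {A : PTy} {φ : Form [] A} (h : Con φ) : InMeet φ :=
  match h with
  | .star => .star
  | .fold h => .mod h.inMeet
  | .pair h₁ h₂ => .and (.mod h₁.inMeet) (.mod h₂.inMeet)
  | .inj₁ h => .mod h.inMeet
  | .inj₂ h => .mod h.inMeet
  | .top => .top
  | .ded _ _ h => h
  | .imp _ _ h₁ h₂ _ _ => .conj <| List.forall_mem_map.2 fun i hi =>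
      .imp (h₁ i hi).inMeet (h₂ i hi).inMeet

mutual

theorem Ded.sound {Φ : List PTy} {A : PTy} {ψ φ : Form Φ A} (h : Ded ψ φ) (ρ : ℕ → ℕ)
    (v : FVal Φ) : ψ.sem ρ v ⊆ φ.sem ρ v :=
  match h with
  | .refl _ => subset_rfl
  | .cut _ h₁ h₂ => (h₁.sound ρ v).trans (h₂.sound ρ v)
  | .distr _ => (Set.inter_union_distrib_left _ _ _).subset
  | .andR _ h₁ h₂ => Set.subset_inter (h₁.sound ρ v) (h₂.sound ρ v)
  | .andL₁ _ h => Set.inter_subset_left.trans (h.sound ρ v)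
  | .andL₂ _ h => Set.inter_subset_right.trans (h.sound ρ v)
  | .topR _ => Set.subset_univ _
  | .orR₁ _ h => (h.sound ρ v).trans Set.subset_union_left
  | .orR₂ _ h => (h.sound ρ v).trans Set.subset_union_right
  | .orL _ h₁ h₂ => Set.union_subset (h₁.sound ρ v) (h₂.sound ρ v)
  | .botL _ => Set.empty_subset _
  | .inj _ => (Modality.disjoint_inj₁_inj₂ _ _).le_bot
  | .modMono _ h => Modality.sem_mono _ (h.sound ρ v)
  | .modAnd _ => Modality.sem_inter_subset _ _ _
  | .modTop _ hm => Modality.univ_subset_sem hm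
  | .modAll _ => (Modality.sem_iInter _ _).superset
  | .modOr _ => Modality.sem_union_subset _ _ _
  | .modBot _ => Modality.sem_empty_subset _
  | .modEx _ => (Modality.sem_iUnion _ _).subset
  | .exR _ h => (h.sound ρ v).trans (Form.sem_inst_subset_ex _ _ ρ v)
  | .exL _ h => Form.sem_and_ex_subset fun i => h.sound (ivalCons i ρ) v
  | .exM ⟨_, .ex (.ex _ h₀) h₁, _⟩ => h₀.sem_ex_ex_subset h₁ ρ v
  | .allL _ h => (Form.sem_all_subset_inst _ _ ρ v).trans (h.sound ρ v)
  | .allR _ h => Form.subset_sem_all_or fun i => h.sound (ivalCons i ρ) v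
  | .allM ⟨_, _, .all (.all _ h₀) h₁⟩ => h₀.sem_all_subset_all_all h₁ ρ v
  | .iterEx ⟨_, .iter (.ex h hk), _⟩ => h.sem_iter_ex_subset hk _ _ ρ v
  | .allIter ⟨_, _, .iter (.all h hk)⟩ => h.sem_all_iter_subset hk _ _ ρ v
  | .muZero _ => subset_rfl
  | .muSuccL _ h => (Form.sem_iter_succ _ _ _ ρ v).subset.trans
      (Form.sem_instF_subset _ (h.sound ρ v))
  | .muSuccR _ => (Form.sem_iter_succ _ _ _ ρ v).superset
  | .nuZero _ => subset_rfl
  | .nuSuccR _ h => (Form.sem_instF_subset _ (h.sound ρ v)).trans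
      (Form.sem_iter_succ _ _ _ ρ v).superset
  | .nuSuccL _ => (Form.sem_iter_succ _ _ _ ρ v).subset
  | .iterMono _ h => Form.sem_iter_subset_iter _ _ (h.sound ρ) v
  | .impMono _ h₁ h₂ => semImp_mono (h₁.sound ρ _) (h₂.sound ρ _)
  | .wf ⟨.pos, .imp (.all hψ hk) hφ, _⟩ => sem_all_imp_subset hψ hk hφ ρ v
  | .cc ⟨_, .imp _ (.ex hφ hk), _⟩ hψ => sem_imp_ex_subset hψ hφ hk ρ v
  | .exImp _ => sem_all_imp_lift_subset _ _ ρ v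
  | .impAll _ => sem_all_lift_imp_subset _ _ ρ v
  | .impAnd _ => fun _ hf x hx => ⟨hf.1 x hx, hf.2 x hx⟩
  | .impTop _ => fun _ _ _ _ => trivial
  | .orImp _ => fun _ hf x hx => hx.elim (hf.1 x) (hf.2 x)
  | .botImp _ => fun _ _ _ hx => hx.elim
  | .impOr ⟨_, .imp _ (.or h₁ h₂), _⟩ hδ => hδ.sem_imp_or_subset h₁ h₂ ρ v
  | .impBot _ hδ _ => fun _ hf => (hδ.nonempty_sem ρ).elim hf

theorem Con.nonempty_sem {A : PTy} {φ : Form [] A} (h : Con φ) (ρ : ℕ → ℕ) :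
    (φ.sem ρ FVal.nil).Nonempty :=
  match h with
  | .star => Set.singleton_nonempty _
  | .fold h => (h.nonempty_sem ρ).elim fun _ hx => ⟨_, foldHom_mem_sem_fold hx⟩
  | .pair h₁ h₂ => (h₁.nonempty_sem ρ).elim fun x hx =>
      (h₂.nonempty_sem ρ).elim fun y hy => ⟨(x, y), hx, hy⟩
  | .inj₁ h => (h.nonempty_sem ρ).image _
  | .inj₂ h => (h.nonempty_sem ρ).image _
  | .top => Set.univ_nonempty
  | .ded h hd _ => (h.nonempty_sem ρ).mono (hd.sound ρ _)
  | .imp _ inc h₁ h₂ hinc hcon => InMeet.nonempty_sem_conj_imp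
      (fun i hi => ⟨(h₁ i hi).inMeet, (h₁ i hi).nonempty_sem ρ⟩)
      (fun i hi => ⟨(h₂ i hi).inMeet, (h₂ i hi).nonempty_sem ρ⟩)
      (fun J hJ ⟨_, hx⟩ => (Classical.em (inc J)).elim
        (fun h => ((hinc J hJ h).sound ρ _ hx).elim) fun h => (hcon J hJ h).nonempty_sem ρ)

end

/-! ### Relations between chains -/

theorem eventually_apply_eq_of_isLUB {X Y : Cpo} [Finite Y] (f : Hom X Y) {x : ℕ → X}
    (hx : Monotone x) {a : X} (ha : IsLUB (Set.range x) a) :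
    ∀ᶠ j in Filter.atTop, f (x j) = f a := by
  obtain ⟨i, hi⟩ := WellFoundedGT.monotone_chain_condition ⟨fun j => f (x j), f.mono.comp hx⟩
  have hlub := f.cont (Set.range_nonempty x) hx.directed_le.directedOn_range ha
  refine Filter.eventually_atTop.2 ⟨i, fun j hj => (f.mono (ha.1 ⟨j, rfl⟩)).antisymm (hlub.2 ?_)⟩
  rintro _ ⟨_, ⟨l, rfl⟩, rfl⟩
  calc f (x l) ≤ f (x (max i l)) := f.mono (hx (le_max_right i l))
    _ = f (x i) := (hi _ (le_max_left i l)).symm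
    _ = f (x j) := hi j hj

open scoped Relator

/-- A relation between the stages of two chains, preserved by their embeddings and projections. -/
structure Chain.Rel (C D : Chain) where
  rel : ∀ k, C.obj k → D.obj k → Prop
  rel_e : ∀ k, (rel k ⇒ rel (k + 1)) (C.ep k).e (D.ep k).e
  rel_p : ∀ k, (rel (k + 1) ⇒ rel k) (C.ep k).p (D.ep k).p

namespace Chain.Rel

variable {C D : Chain} {X Y : Cpo} (R : Chain.Rel C D) (c : C.Cocone X) (d : D.Cocone Y)

/-- The extension of a relation between chains to the vertices of two cocones. -/
def lift (x : X) (y : Y) : Prop := ∀ k, R.rel k ((c.ep k).p x) ((d.ep k).p y)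

variable {R c d}

theorem rel_p_of_le {x : X} {y : Y} {j k : ℕ} (hjk : j ≤ k)
    (h : R.rel k ((c.ep k).p x) ((d.ep k).p y)) : R.rel j ((c.ep j).p x) ((d.ep j).p y) := by
  induction hjk using Nat.decreasingInduction with
  | self => exact h
  | of_succ j _ ih =>
    rw [← c.comm_p, ← d.comm_p]
    exact R.rel_p j ih

theorem exists_rel_e_eq {j k : ℕ} (hkj : k ≤ j) {x : C.obj k} {y : D.obj k} (h : R.rel k x y) :
    ∃ x' y', R.rel j x' y' ∧ (c.ep j).e x' = (c.ep k).e x ∧ (d.ep j).e y' = (d.ep k).e y := by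
  induction j, hkj using Nat.le_induction with
  | base => exact ⟨x, y, h, rfl, rfl⟩
  | succ j _ ih =>
    obtain ⟨x', y', h', hx, hy⟩ := ih
    exact ⟨_, _, R.rel_e j h', (c.comm_e j x').trans hx, (d.comm_e j y').trans hy⟩

theorem lift_e {k : ℕ} {x : C.obj k} {y : D.obj k} (h : R.rel k x y) :
    R.lift c d ((c.ep k).e x) ((d.ep k).e y) := by
  intro j
  obtain ⟨x', y', h', hx, hy⟩ := exists_rel_e_eq (c := c) (d := d) (le_max_left k j) h
  refine rel_p_of_le (le_max_right k j) ?_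
  rwa [← hx, ← hy, EP.p_e, EP.p_e]

theorem lift_map_iff {X' Y' : Cpo} {c' : C.Cocone X'} {d' : D.Cocone Y'} {x : X} {y : Y} :
    R.lift c' d' (c.map c' x) (d.map d' y) ↔ R.lift c d x y := by
  simp only [lift, Cocone.p_map]

theorem lift_of_isLUB (hC : ∀ k, Finite (C.obj k)) (hD : ∀ k, Finite (D.obj k)) {x : ℕ → X}
    {y : ℕ → Y} (hx : Monotone x) (hy : Monotone y) {a : X} {b : Y} (ha : IsLUB (Set.range x) a)
    (hb : IsLUB (Set.range y) b)
    (h : ∀ k, ∀ᶠ j in Filter.atTop, R.rel k ((c.ep k).p (x j)) ((d.ep k).p (y j))) :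
    R.lift c d a b := by
  intro k
  obtain ⟨j, hj, hxj, hyj⟩ := ((h k).and ((eventually_apply_eq_of_isLUB (c.ep k).p hx ha).and
    (eventually_apply_eq_of_isLUB (d.ep k).p hy hb))).exists
  rwa [hxj, hyj] at hj

end Chain.Rel

/-! ### Coherence of the interpretation of terms -/

section sumRel

variable {X X' Y Y' Z Z' W W' : Cpo}

/-- The action of disjoint unions with a new least element on relations. -/
def sumRel (r : X → Y → Prop) (r' : X' → Y' → Prop) : Cpo.WSum X X' → Cpo.WSum Y Y' → Prop
  | none, none => True
  | some (.inl x), some (.inl y) => r x y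
  | some (.inr x), some (.inr y) => r' x y
  | _, _ => False

theorem sumRel_self_iff {r : X → X → Prop} {r' : X' → X' → Prop} (h : ∀ x y, r x y ↔ x = y)
    (h' : ∀ x y, r' x y ↔ x = y) (z w : Cpo.WSum X X') : sumRel r r' z w ↔ z = w := by
  constructor
  · intro hzw
    exact match z, w, hzw with
      | none, none, _ => rfl
      | some (.inl x), some (.inl y), hxy => congrArg Cpo.WSum.inl ((h x y).1 hxy)
      | some (.inr x), some (.inr y), hxy => congrArg Cpo.WSum.inr ((h' x y).1 hxy)
  · rintro rfl
    exact match z with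
      | none => trivial
      | some (.inl x) => (h x x).2 rfl
      | some (.inr x) => (h' x x).2 rfl

variable {r : X → Y → Prop} {r' : X' → Y' → Prop}

theorem sumRel.copair {s : Z → W → Prop} (hbot : s ⊥ ⊥) {f : X → Z} {g : Y → W} {f' : X' → Z}
    {g' : Y' → W} (h : (r ⇒ s) f g) (h' : (r' ⇒ s) f' g') :
    (sumRel r r' ⇒ s) (Hom.copairFun f f') (Hom.copairFun g g')
  | none, none, _ => hbot
  | some (.inl _), some (.inl _), hzw => h hzw
  | some (.inr _), some (.inr _), hzw => h' hzw

theorem sumRel.map {s : Z → W → Prop} {s' : Z' → W' → Prop} {f : Hom X Z} {g : Hom Y W}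
    {f' : Hom X' Z'} {g' : Hom Y' W'} (h : (r ⇒ s) f g) (h' : (r' ⇒ s') f' g') :
    (sumRel r r' ⇒ sumRel s s') (EP.sumMap f f') (EP.sumMap g g') :=
  sumRel.copair (Z := Cpo.sum Z Z') (W := Cpo.sum W W') (s := sumRel s s') trivial h h'

end sumRel

section stepRel

variable {prev prev' : ∀ {n : ℕ}, Ty n → Cpo}
  {r : ∀ {n : ℕ} (A B : Ty n), prev A → prev B → Prop}
  {r' : ∀ {n : ℕ} (A B : Ty n), prev' A → prev' B → Prop}

/-- One layer of the logical relation between the interpretations of two types, where `r` relates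
the unrollings of recursive types. Types of distinct shapes share only the least element, which
interprets the diverging terms. -/
def stepRel (r : ∀ {n : ℕ} (A B : Ty n), prev A → prev B → Prop) :
    {n : ℕ} → (A B : Ty n) → step prev A → step prev B → Prop
  | _, .unit, .unit => Eq
  | _, .prod A A', .prod B B' => fun x y => stepRel r A B x.1 y.1 ∧ stepRel r A' B' x.2 y.2
  | _, .arrow A A', .arrow B B' => fun f g =>
      (stepRel r A B ⇒ stepRel r A' B') (Hom.toFun f) (Hom.toFun g)
  | _, .sum A A', .sum B B' => sumRel (stepRel r A B) (stepRel r A' B')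
  | _, .mu A, .mu B => r A.unroll B.unroll
  | _, _, _ => fun x y => x = ⊥ ∧ y = ⊥

theorem stepRel_bot (h : ∀ {n : ℕ} (A B : Ty n), r A B ⊥ ⊥) {n : ℕ} (A B : Ty n) :
    stepRel r A B ⊥ ⊥ := by
  induction A with
  | unit | var => cases B <;> first | exact ⟨rfl, rfl⟩ | exact rfl
  | prod A A' ih ih' => cases B <;> first | exact ⟨rfl, rfl⟩ | exact ⟨ih _, ih' _⟩
  | arrow A A' _ ih' => cases B <;> first | exact ⟨rfl, rfl⟩ | exact fun _ _ _ => ih' _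
  | sum A A' => cases B <;> first | exact ⟨rfl, rfl⟩ | exact trivial
  | mu A => cases B <;> first | exact ⟨rfl, rfl⟩ | exact h _ _

theorem stepRel_self_iff (h : ∀ {n : ℕ} (A : Ty n) (x y : prev A), r A A x y ↔ x = y) {n : ℕ}
    (A : Ty n) (x y : step prev A) : stepRel r A A x y ↔ x = y := by
  induction A with
  | var => exact ⟨fun _ => rfl, fun _ => ⟨rfl, rfl⟩⟩
  | unit => exact Iff.rfl
  | prod A A' ih ih' => exact (and_congr (ih _ _) (ih' _ _)).trans Prod.ext_iff.symm
  | arrow A A' ih ih' =>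
    refine ⟨fun h => Hom.ext (funext fun x => (ih' _ _).1 (h ((ih x x).2 rfl))), ?_⟩
    rintro rfl x y hxy
    exact (ih' _ _).2 (congrArg _ ((ih x y).1 hxy))
  | sum A A' ih ih' => exact sumRel_self_iff ih ih' x y
  | mu A => exact h _ _ _

theorem EP.liftFun_bot {X Y Z W : Cpo} (c : EP X Z) (d : EP Y W) :
    ((fun x y => x = ⊥ ∧ y = ⊥) ⇒ fun x y => x = ⊥ ∧ y = ⊥) c.e d.e ∧
    ((fun x y => x = ⊥ ∧ y = ⊥) ⇒ fun x y => x = ⊥ ∧ y = ⊥) c.p d.p := by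
  constructor <;> rintro _ _ ⟨rfl, rfl⟩
  · exact ⟨c.e_bot, d.e_bot⟩
  · exact ⟨c.p_bot, d.p_bot⟩

theorem stepRel_ep (c : ∀ {n : ℕ} (A : Ty n), EP (prev A) (prev' A))
    (h : ∀ {n : ℕ} (A B : Ty n),
      (r A B ⇒ r' A B) (c A).e (c B).e ∧ (r' A B ⇒ r A B) (c A).p (c B).p)
    {n : ℕ} (A B : Ty n) :
    (stepRel r A B ⇒ stepRel r' A B) (stepEP c A).e (stepEP c B).e ∧
    (stepRel r' A B ⇒ stepRel r A B) (stepEP c A).p (stepEP c B).p := by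
  induction A with
  | unit | var =>
    cases B <;> first | exact EP.liftFun_bot _ _ | exact ⟨fun _ _ h => h, fun _ _ h => h⟩
  | prod A A' ih ih' =>
    cases B with
    | prod B B' => exact ⟨fun _ _ h => ⟨(ih B).1 h.1, (ih' B').1 h.2⟩,
        fun _ _ h => ⟨(ih B).2 h.1, (ih' B').2 h.2⟩⟩
    | _ => exact EP.liftFun_bot _ _
  | arrow A A' ih ih' =>
    cases B with
    | arrow B B' => exact ⟨fun _ _ h _ _ hxy => (ih' B').1 (h ((ih B).2 hxy)),
        fun _ _ h _ _ hxy => (ih' B').2 (h ((ih B).1 hxy))⟩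
    | _ => exact EP.liftFun_bot _ _
  | sum A A' ih ih' =>
    cases B with
    | sum B B' => exact ⟨sumRel.map (ih B).1 (ih' B').1, sumRel.map (ih B).2 (ih' B').2⟩
    | _ => exact EP.liftFun_bot _ _
  | mu A =>
    cases B with
    | mu B => exact h _ _
    | _ => exact EP.liftFun_bot _ _

end stepRel

/-- The logical relation between the `k`-th approximants of two types. -/
def approxRel : (k : ℕ) → ∀ {n : ℕ} (A B : Ty n), approx k A → approx k B → Prop
  | 0, _, _, _ => fun _ _ => True
  | k + 1, _, A, B => stepRel (approxRel k) A B

theorem approxRel_bot : (k : ℕ) → ∀ {n : ℕ} (A B : Ty n), approxRel k A B ⊥ ⊥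
  | 0, _, _, _ => trivial
  | k + 1, _, A, B => stepRel_bot (approxRel_bot k) A B

theorem approxRel_self_iff : (k : ℕ) → ∀ {n : ℕ} (A : Ty n) (x y : approx k A),
    approxRel k A A x y ↔ x = y
  | 0, _, _, _, _ => ⟨fun _ => rfl, fun _ => trivial⟩
  | k + 1, _, A, x, y => stepRel_self_iff (approxRel_self_iff k) A x y

theorem approxRel_ep : (k : ℕ) → ∀ {n : ℕ} (A B : Ty n),
    (approxRel k A B ⇒ approxRel (k + 1) A B) (approxEP k A).e (approxEP k B).e ∧
    (approxRel (k + 1) A B ⇒ approxRel k A B) (approxEP k A).p (approxEP k B).p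
  | 0, _, A, B => ⟨fun _ _ _ => approxRel_bot 1 A B, fun _ _ _ => trivial⟩
  | k + 1, _, A, B => stepRel_ep (approxEP k) (approxRel_ep k) A B

/-- The logical relation between the chains of approximants of two types. -/
def approxChainRel {n : ℕ} (A B : Ty n) : Chain.Rel (approxChain A) (approxChain B) where
  rel k := approxRel k A B
  rel_e k := (approxRel_ep k A B).1
  rel_p k := (approxRel_ep k A B).2

/-- The logical relation between the interpretations of two types. -/
def DomRel {n : ℕ} (A B : Ty n) : Dom A → Dom B → Prop :=
  (approxChainRel A B).lift (domCocone A) (domCocone B)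

section DomRel

variable {n : ℕ} {A B A' B' : Ty n}

theorem domRel_iff {x : Dom A} {y : Dom B} :
    DomRel A B x y ↔ ∀ k, approxRel (k + 1) A B ((approxDom k A).p x) ((approxDom k B).p y) :=
  ⟨fun h k => h (k + 1), fun h k => match k with
    | 0 => trivial
    | k + 1 => h k⟩

theorem domRel_self_iff {x y : Dom A} : DomRel A A x y ↔ x = y := by
  refine ⟨fun h => (isLUB_trunc x).unique ?_, ?_⟩
  · have htrunc (k : ℕ) : trunc k x = trunc k y :=
      congrArg ((domCocone A).ep k).e ((approxRel_self_iff k A _ _).1 (h k))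
    simpa only [htrunc] using isLUB_trunc y
  · rintro rfl k
    exact (approxRel_self_iff k A _ _).2 rfl

theorem DomRel.bot : DomRel A B ⊥ ⊥ := by
  intro k
  rw [EP.p_bot, EP.p_bot]
  exact approxRel_bot k A B

theorem DomRel.of_isLUB {x : ℕ → Dom A} {y : ℕ → Dom B} (hx : Monotone x) (hy : Monotone y)
    {a : Dom A} {b : Dom B} (ha : IsLUB (Set.range x) a) (hb : IsLUB (Set.range y) b)
    (h : ∀ k, ∀ᶠ j in Filter.atTop, approxRel k A B
      (((domCocone A).ep k).p (x j)) (((domCocone B).ep k).p (y j))) : DomRel A B a b :=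
  Chain.Rel.lift_of_isLUB (fun k => finite_approx k A) (fun k => finite_approx k B) hx hy ha hb h

theorem DomRel.apply {f : Dom (.arrow A A')} {g : Dom (.arrow B B')}
    (h : DomRel (.arrow A A') (.arrow B B') f g) {x : Dom A} {y : Dom B} (hxy : DomRel A B x y) :
    DomRel A' B' (Hom.toFun f x) (Hom.toFun g y) := by
  refine of_isLUB ((Hom.mono f).comp (trunc_mono_level x)) ((Hom.mono g).comp (trunc_mono_level y))
    (isLUB_apply_trunc f x) (isLUB_apply_trunc g y) fun k =>
      (Filter.eventually_ge_atTop k).mono fun j hkj => ?_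
  refine Chain.Rel.rel_p_of_le (R := approxChainRel A' B') hkj ?_
  cases j with
  | zero => trivial
  | succ j => exact h (j + 1) (hxy (j + 1))

theorem DomRel.arrow {f : Dom (.arrow A A')} {g : Dom (.arrow B B')}
    (h : (DomRel A B ⇒ DomRel A' B') (Hom.toFun f) (Hom.toFun g)) :
    DomRel (.arrow A A') (.arrow B B') f g :=
  domRel_iff.2 fun k _ _ hxy => h (Chain.Rel.lift_e
    (R := approxChainRel A B) (c := domCocone A) (d := domCocone B) (k := k + 1) hxy) (k + 1)

theorem domRel_prod_iff {x : Dom (.prod A A')} {y : Dom (.prod B B')} :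
    DomRel (.prod A A') (.prod B B') x y ↔ DomRel A B x.1 y.1 ∧ DomRel A' B' x.2 y.2 := by
  simp only [domRel_iff]
  exact forall_and

theorem domRel_sum_iff {z : Dom (.sum A A')} {w : Dom (.sum B B')} :
    DomRel (.sum A A') (.sum B B') z w ↔ sumRel (DomRel A B) (DomRel A' B') z w := by
  rw [domRel_iff]
  exact match z, w with
    | none, none => ⟨fun _ => trivial, fun _ _ => trivial⟩
    | some (.inl _), some (.inl _) => (domRel_iff (A := A) (B := B)).symm
    | some (.inr _), some (.inr _) => (domRel_iff (A := A') (B := B')).symm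
    | none, some (.inl _) | none, some (.inr _) | some (.inl _), none | some (.inr _), none
    | some (.inl _), some (.inr _) | some (.inr _), some (.inl _) => ⟨fun h => h 0, False.elim⟩

theorem domRel_mu_iff {A B : Ty (n + 1)} {x : Dom (.mu A)} {y : Dom (.mu B)} :
    DomRel (.mu A) (.mu B) x y ↔
      (approxChainRel A.unroll B.unroll).lift (unrollCocone A) (unrollCocone B) x y :=
  domRel_iff

theorem DomRel.unfold {A B : Ty (n + 1)} {x : Dom (.mu A)} {y : Dom (.mu B)}
    (h : DomRel (.mu A) (.mu B) x y) :
    DomRel A.unroll B.unroll (unfoldHom A x) (unfoldHom B y) :=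
  Chain.Rel.lift_map_iff.2 (domRel_mu_iff.1 h)

theorem DomRel.fold {A B : Ty (n + 1)} {x : Dom A.unroll} {y : Dom B.unroll}
    (h : DomRel A.unroll B.unroll x y) :
    DomRel (.mu A) (.mu B) (foldHom A x) (foldHom B y) :=
  domRel_mu_iff.2 (Chain.Rel.lift_map_iff.2 h)

end DomRel

theorem Hom.monotone_iterate_bot {X : Cpo} (f : Hom X X) : Monotone fun n : ℕ => f.toFun^[n] ⊥ :=
  Monotone.monotone_iterate_of_le_map f.mono bot_le

theorem Hom.isLUB_fix {X : Cpo} (f : Hom X X) :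
    IsLUB (Set.range fun n : ℕ => f.toFun^[n] ⊥) (Hom.fix X f) :=
  f.monotone_iterate_bot.directed_le.directedOn_range.isLUB_sSup

theorem DomRel.fix {A B : PTy} {f : Hom (Dom A) (Dom A)} {g : Hom (Dom B) (Dom B)}
    (h : (DomRel A B ⇒ DomRel A B) f g) : DomRel A B (Hom.fix _ f) (Hom.fix _ g) := by
  have hiter (j : ℕ) : DomRel A B (f.toFun^[j] ⊥) (g.toFun^[j] ⊥) := by
    induction j with
    | zero => exact bot
    | succ j ih =>
      rw [Function.iterate_succ_apply', Function.iterate_succ_apply']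
      exact h ih
  exact of_isLUB f.monotone_iterate_bot g.monotone_iterate_bot f.isLUB_fix g.isLUB_fix
    fun k => Filter.Eventually.of_forall fun j => hiter j k

/-- The logical relation between environments for two contexts of the same length. -/
def CtxRel : (L L' : List PTy) → CtxDom L → CtxDom L' → Prop
  | [], [] => fun _ _ => True
  | A :: L, B :: L' => fun u u' => CtxRel L L' (Prod.fst u) (Prod.fst u') ∧
      DomRel A B (Prod.snd u) (Prod.snd u')
  | _, _ => fun _ _ => False

theorem CtxRel.refl : (L : List PTy) → (u : CtxDom L) → CtxRel L L u u
  | [], _ => trivial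
  | _ :: L, u => ⟨CtxRel.refl L (Prod.fst u), domRel_self_iff.2 rfl⟩

theorem CtxRel.lookup : {L L' : List PTy} → {i : ℕ} → {A B : PTy} → (x : Lookup L i A) →
    (y : Lookup L' i B) → (CtxRel L L' ⇒ DomRel A B) x.sem y.sem
  | _, _, _, _, _, .zero, .zero => fun _ _ h => h.2
  | _, _, _, _, _, .succ x, .succ y => fun _ _ h => lookup x y h.1

theorem PTyping.sem_rel : {L L' : List PTy} → {M : Tm} → {A B : PTy} → (d : PTyping L M A) →
    (d' : PTyping L' M B) → (CtxRel L L' ⇒ DomRel A B) d.sem d'.sem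
  | _, _, _, _, _, .var x, .var y => CtxRel.lookup x y
  | _, _, _, _, _, .lam d, .lam d' => fun _ _ h => .arrow fun _ _ hxy => d.sem_rel d' ⟨h, hxy⟩
  | _, _, _, _, _, .app d₁ d₂, .app d₁' d₂' => fun _ _ h =>
      (d₁.sem_rel d₁' h).apply (d₂.sem_rel d₂' h)
  | _, _, _, _, _, .pair d₁ d₂, .pair d₁' d₂' => fun _ _ h =>
      domRel_prod_iff.2 ⟨d₁.sem_rel d₁' h, d₂.sem_rel d₂' h⟩
  | _, _, _, _, _, .proj₁ d, .proj₁ d' => fun _ _ h => (domRel_prod_iff.1 (d.sem_rel d' h)).1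
  | _, _, _, _, _, .proj₂ d, .proj₂ d' => fun _ _ h => (domRel_prod_iff.1 (d.sem_rel d' h)).2
  | _, _, _, _, _, .star, .star => fun _ _ _ => domRel_self_iff.2 rfl
  | _, _, _, _, _, .fix d, .fix d' => fun _ _ h => .fix fun _ _ hxy => d.sem_rel d' ⟨h, hxy⟩
  | _, _, _, _, _, .fold d, .fold d' => fun _ _ h => (d.sem_rel d' h).fold
  | _, _, _, _, _, .unfold d, .unfold d' => fun _ _ h => (d.sem_rel d' h).unfold
  | _, _, _, _, _, .inj₁ d, .inj₁ d' => fun _ _ h => domRel_sum_iff.2 (d.sem_rel d' h)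
  | _, _, _, _, _, .inj₂ d, .inj₂ d' => fun _ _ h => domRel_sum_iff.2 (d.sem_rel d' h)
  | _, _, _, _, _, .case d d₁ d₂, .case d' d₁' d₂' => fun _ _ h =>
      sumRel.copair DomRel.bot (fun _ _ hxy => d₁.sem_rel d₁' ⟨h, hxy⟩)
        (fun _ _ hxy => d₂.sem_rel d₂' ⟨h, hxy⟩) (domRel_sum_iff.1 (d.sem_rel d' h))

theorem PTyping.sem_eq {L : List PTy} {M : Tm} {A : PTy} (d d' : PTyping L M A) (u : CtxDom L) :
    d.sem u = d'.sem u :=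
  domRel_self_iff.1 (d.sem_rel d' (CtxRel.refl L u))

/-! ### Soundness of typing -/

theorem Sub.sound {A : PTy} {T U : RT A} (h : Sub T U) (ρ : ℕ → ℕ) : T.sem ρ ⊆ U.sem ρ := by
  induction h with
  | refl => exact subset_rfl
  | trans _ _ ih₁ ih₂ => exact ih₁.trans ih₂
  | under => exact Set.subset_univ _
  | top => exact subset_rfl
  | ded _ _ h => exact h.sound ρ _
  | prod _ _ ih₁ ih₂ => exact fun x hx => ⟨ih₁ hx.1, ih₂ hx.2⟩
  | arrow _ _ ih₁ ih₂ => exact semImp_mono ih₁ ih₂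
  | pureProd => exact fun _ _ => ⟨trivial, trivial⟩
  | pureArrow => exact fun _ _ _ _ => trivial
  | reftProd | prodReft | reftArrow | arrowReft => exact subset_rfl

/-- `Sat ρ Γ L u`: the entries of `u` lie in the interpretations of the refinement types of `Γ`.
The underlying pure context is a separate index `L`, so that contexts with propositionally equal
underlying contexts can be exchanged without transporting `u`. -/
inductive Sat (ρ : ℕ → ℕ) : RCtx → (L : List PTy) → CtxDom L → Prop
  | nil (u : CtxDom []) : Sat ρ [] [] u
  | cons {Γ : RCtx} {L : List PTy} {A : PTy} {T : RT A} (u : CtxDom L) (x : Dom A) :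
      Sat ρ Γ L u → x ∈ T.sem ρ → Sat ρ (⟨A, T⟩ :: Γ) (A :: L) (u, x)

theorem sat_of_mem {ρ : ℕ → ℕ} : (Γ : RCtx) → (u : CtxDom Γ.under) → u ∈ RCtx.sem ρ Γ →
    Sat ρ Γ Γ.under u
  | [], u, _ => .nil u
  | ⟨_, _⟩ :: Γ, u, h => .cons (Prod.fst u) (Prod.snd u) (sat_of_mem Γ _ h.1) h.2

theorem Lookup.nonempty_under {Γ : RCtx} {i : ℕ} {a : Σ A, RT A} (x : Lookup Γ i a) :
    Nonempty (Lookup Γ.under i a.1) := by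
  induction x with
  | zero => exact ⟨.zero⟩
  | succ _ ih => exact ih.map .succ

theorem CtxSub.under_eq {Γ Γ' : RCtx} (h : CtxSub Γ' Γ) : Γ'.under = Γ.under := by
  induction h with
  | nil => rfl
  | cons _ _ ih => exact congrArg (List.cons _) ih

theorem RCtx.under_append_cons (Δ Γ : RCtx) {B : PTy} (T U : RT B) :
    RCtx.under (Δ ++ ⟨B, T⟩ :: Γ) = RCtx.under (Δ ++ ⟨B, U⟩ :: Γ) := by
  simp [RCtx.under]

section Sat

variable {ρ : ℕ → ℕ} {Γ Δ : RCtx} {L : List PTy} {u : CtxDom L} {A B : PTy}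

theorem Sat.lookup {i : ℕ} {T : RT A} (h : Sat ρ Γ L u) (x : Lookup Γ i ⟨A, T⟩)
    (y : Lookup L i A) : y.sem u ∈ T.sem ρ := by
  induction h generalizing i with
  | nil => cases x
  | cons u a _ ha ih =>
    cases x with
    | zero =>
      cases y with
      | zero => exact ha
    | succ x =>
      cases y with
      | succ y => exact ih x y

theorem Sat.mono {Γ' : RCtx} (hu : Sat ρ Γ' L u) (h : CtxSub Γ' Γ) : Sat ρ Γ L u := by
  induction h generalizing L with
  | nil => exact hu
  | cons hs _ ih =>
    cases hu with
    | cons u x hu hx => exact .cons u x (ih hu) (hs.sound ρ hx)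

theorem Sat.or {ψ₁ ψ₂ : Form [] B} {h₁ : IsFormula ψ₁} {h₂ : IsFormula ψ₂}
    {h : IsFormula (ψ₁.or ψ₂)} (hu : Sat ρ (Δ ++ ⟨B, .reft _ h⟩ :: Γ) L u) :
    Sat ρ (Δ ++ ⟨B, .reft ψ₁ h₁⟩ :: Γ) L u ∨ Sat ρ (Δ ++ ⟨B, .reft ψ₂ h₂⟩ :: Γ) L u := by
  induction Δ generalizing L with
  | nil =>
    cases hu with
    | cons u x hu hx => exact hx.imp (.cons u x hu) (.cons u x hu)
  | cons _ _ ih =>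
    cases hu with
    | cons u x hu hx => exact (ih hu).imp (.cons u x · hx) (.cons u x · hx)

theorem not_sat_bot {h : IsFormula (A := B) .bot} :
    ¬ Sat ρ (Δ ++ ⟨B, .reft .bot h⟩ :: Γ) L u := by
  intro hu
  induction Δ generalizing L with
  | nil =>
    cases hu with
    | cons _ _ _ hx => exact hx
  | cons _ _ ih =>
    cases hu with
    | cons _ _ hu _ => exact ih hu

end Sat

theorem Hom.fix_eq {X : Cpo} (f : Hom X X) : f (Hom.fix X f) = Hom.fix X f := by
  refine (f.cont (Set.range_nonempty _) f.monotone_iterate_bot.directed_le.directedOn_range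
    f.isLUB_fix).unique ⟨?_, fun b hb => f.isLUB_fix.2 ?_⟩
  · rintro _ ⟨_, ⟨n, rfl⟩, rfl⟩
    exact f.isLUB_fix.1 ⟨n + 1, Function.iterate_succ_apply' _ _ _⟩
  · rintro _ ⟨n, rfl⟩
    refine (f.monotone_iterate_bot (Nat.le_succ n)).trans (hb ⟨_, ⟨n, rfl⟩, ?_⟩)
    exact (Function.iterate_succ_apply' _ _ _).symm

theorem PTyping.sem_fix {L : List PTy} {M : Tm} {A : PTy} (d : PTyping (A :: L) M A)
    (u : CtxDom L) : d.sem (u, (PTyping.fix d).sem u) = (PTyping.fix d).sem u :=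
  (Hom.curry d.sem u).fix_eq

/-- `Realizes Γ L M T`: some derivation typing `M` in the pure context `L` underlying `Γ` is
interpreted by a map from the interpretation of `Γ` to that of `T`. By `PTyping.sem_eq` it does not
matter which derivation is chosen. -/
def Realizes (Γ : RCtx) (L : List PTy) (M : Tm) {A : PTy} (T : RT A) : Prop :=
  ∃ d : PTyping L M A, ∀ ρ u, Sat ρ Γ L u → d.sem u ∈ T.sem ρ

namespace Realizes

variable {Γ Δ : RCtx} {L : List PTy} {M N N₁ N₂ : Tm} {A B C : PTy} {T : RT A} {U : RT B}

theorem nonempty (h : Realizes Γ L M T) : Nonempty (PTyping L M A) :=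
  let ⟨d, _⟩ := h
  ⟨d⟩

theorem of_nonempty (h : Nonempty (PTyping L M A)) : Realizes Γ L M (.pure A) :=
  let ⟨d⟩ := h
  ⟨d, fun _ _ _ => trivial⟩

theorem map (h : Realizes Γ L M T) (F : PTyping L M A → PTyping L N B)
    (hF : ∀ d ρ u, d.sem u ∈ T.sem ρ → (F d).sem u ∈ U.sem ρ) : Realizes Γ L N U :=
  let ⟨d, hd⟩ := h
  ⟨F d, fun ρ u hu => hF d ρ u (hd ρ u hu)⟩

theorem map₂ {V : RT C} (h₁ : Realizes Γ L N₁ T) (h₂ : Realizes Γ L N₂ U)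
    (F : PTyping L N₁ A → PTyping L N₂ B → PTyping L M C)
    (hF : ∀ d₁ d₂ ρ u, d₁.sem u ∈ T.sem ρ → d₂.sem u ∈ U.sem ρ → (F d₁ d₂).sem u ∈ V.sem ρ) :
    Realizes Γ L M V :=
  let ⟨d₁, hd₁⟩ := h₁
  let ⟨d₂, hd₂⟩ := h₂
  ⟨F d₁ d₂, fun ρ u hu => hF d₁ d₂ ρ u (hd₁ ρ u hu) (hd₂ ρ u hu)⟩

theorem lam (h : Realizes (⟨B, U⟩ :: Γ) (B :: L) M T) : Realizes Γ L (.lam M) (.arrow U T) :=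
  let ⟨d, hd⟩ := h
  ⟨.lam d, fun ρ u hu x hx => hd ρ (u, x) (.cons u x hu hx)⟩

theorem case₁ {φ : Form [] B} {hφ : IsFormula φ} {hinj : IsFormula (φ.mod (.inj₁ (B := C)))}
    (h : Realizes Γ L M (.reft _ hinj)) (h₁ : Realizes (⟨B, .reft φ hφ⟩ :: Γ) (B :: L) N₁ T)
    (h₂ : Nonempty (PTyping (C :: L) N₂ A)) : Realizes Γ L (.case M N₁ N₂) T := by
  obtain ⟨d, hd⟩ := h
  obtain ⟨d₁, hd₁⟩ := h₁
  obtain ⟨d₂⟩ := h₂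
  refine ⟨.case d d₁ d₂, fun ρ u hu => ?_⟩
  obtain ⟨x, hx, hxd⟩ := hd ρ u hu
  change Hom.copairFun (Hom.curry d₁.sem u).toFun (Hom.curry d₂.sem u).toFun (d.sem u) ∈ T.sem ρ
  rw [← hxd]
  exact hd₁ ρ (u, x) (.cons u x hu hx)

theorem case₂ {φ : Form [] C} {hφ : IsFormula φ} {hinj : IsFormula (φ.mod (.inj₂ (A := B)))}
    (h : Realizes Γ L M (.reft _ hinj)) (h₁ : Nonempty (PTyping (B :: L) N₁ A))
    (h₂ : Realizes (⟨C, .reft φ hφ⟩ :: Γ) (C :: L) N₂ T) : Realizes Γ L (.case M N₁ N₂) T := by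
  obtain ⟨d, hd⟩ := h
  obtain ⟨d₁⟩ := h₁
  obtain ⟨d₂, hd₂⟩ := h₂
  refine ⟨.case d d₁ d₂, fun ρ u hu => ?_⟩
  obtain ⟨x, hx, hxd⟩ := hd ρ u hu
  change Hom.copairFun (Hom.curry d₁.sem u).toFun (Hom.curry d₂.sem u).toFun (d.sem u) ∈ T.sem ρ
  rw [← hxd]
  exact hd₂ ρ (u, x) (.cons u x hu hx)

theorem fix {T' : RT A} (h : Realizes Γ L (.fix M) T)
    (hM : Realizes (⟨A, T⟩ :: Γ) (A :: L) M T') : Realizes Γ L (.fix M) T' := by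
  obtain ⟨d, hd⟩ := h
  obtain ⟨dM, hdM⟩ := hM
  refine ⟨.fix dM, fun ρ u hu => ?_⟩
  have hfix : (PTyping.fix dM).sem u ∈ T.sem ρ := d.sem_eq (.fix dM) u ▸ hd ρ u hu
  rw [← dM.sem_fix]
  exact hdM ρ _ (.cons u _ hu hfix)

theorem and {φ ψ : Form [] A} {hφ : IsFormula φ} {hψ : IsFormula ψ} {h : IsFormula (φ.and ψ)}
    (h₁ : Realizes Γ L M (.reft φ hφ)) (h₂ : Realizes Γ L M (.reft ψ hψ)) :
    Realizes Γ L M (.reft _ h) :=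
  h₁.map₂ h₂ (fun d _ => d) fun d₁ d₂ _ u hd₁ hd₂ => ⟨hd₁, d₁.sem_eq d₂ u ▸ hd₂⟩

theorem or {ψ₁ ψ₂ : Form [] B} {h₁ : IsFormula ψ₁} {h₂ : IsFormula ψ₂} {h : IsFormula (ψ₁.or ψ₂)}
    (hM₁ : Realizes (Δ ++ ⟨B, .reft ψ₁ h₁⟩ :: Γ) L M T)
    (hM₂ : Realizes (Δ ++ ⟨B, .reft ψ₂ h₂⟩ :: Γ) L M T) :
    Realizes (Δ ++ ⟨B, .reft _ h⟩ :: Γ) L M T :=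
  let ⟨d₁, hd₁⟩ := hM₁
  let ⟨d₂, hd₂⟩ := hM₂
  ⟨d₁, fun ρ u hu => hu.or.elim (hd₁ ρ u) fun hu => d₁.sem_eq d₂ u ▸ hd₂ ρ u hu⟩

theorem sub {Γ' : RCtx} {T' : RT A} (h : Realizes Γ L M T) (hΓ : CtxSub Γ' Γ) (hT : Sub T T') :
    Realizes Γ' L M T' :=
  let ⟨d, hd⟩ := h
  ⟨d, fun ρ u hu => hT.sound ρ (hd ρ u (hu.mono hΓ))⟩

end Realizes

theorem Typing.realizes {Γ : RCtx} {M : Tm} {A : PTy} {T : RT A} (h : Typing Γ M T)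
    {L : List PTy} (hL : Γ.under = L) : Realizes Γ L M T := by
  induction h generalizing L with
  | var x =>
    subst hL
    obtain ⟨y⟩ := x.nonempty_under
    exact ⟨.var y, fun _ _ hu => hu.lookup x y⟩
  | lam _ ih => exact (ih (congrArg (_ :: ·) hL)).lam
  | app _ _ ih₁ ih₂ => exact (ih₁ hL).map₂ (ih₂ hL) .app fun _ _ _ _ h₁ h₂ => h₁ _ h₂
  | pair _ _ ih₁ ih₂ => exact (ih₁ hL).map₂ (ih₂ hL) .pair fun _ _ _ _ h₁ h₂ => ⟨h₁, h₂⟩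
  | proj₁ _ ih => exact (ih hL).map .proj₁ fun _ _ _ h => h.1
  | proj₂ _ ih => exact (ih hL).map .proj₂ fun _ _ _ h => h.2
  | star => exact .of_nonempty ⟨.star⟩
  | fix _ ih => exact .of_nonempty ((ih (congrArg (_ :: ·) hL)).nonempty.map .fix)
  | fold _ ih => exact .of_nonempty ((ih hL).nonempty.map .fold)
  | unfold _ ih => exact .of_nonempty ((ih hL).nonempty.map .unfold)
  | inj₁ _ ih => exact .of_nonempty ((ih hL).nonempty.map .inj₁)
  | inj₂ _ ih => exact .of_nonempty ((ih hL).nonempty.map .inj₂)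
  | case _ _ _ ih ih₁ ih₂ =>
    obtain ⟨d⟩ := (ih hL).nonempty
    obtain ⟨d₁⟩ := (ih₁ (congrArg (_ :: ·) hL)).nonempty
    obtain ⟨d₂⟩ := (ih₂ (congrArg (_ :: ·) hL)).nonempty
    exact .of_nonempty ⟨.case d d₁ d₂⟩
  | starReft => exact ⟨.star, fun _ _ _ => rfl⟩
  | pairReft₁ _ _ _ _ ih₁ ih₂ => exact (ih₁ hL).map₂ (ih₂ hL) .pair fun _ _ _ _ h₁ _ => h₁
  | pairReft₂ _ _ _ _ ih₁ ih₂ => exact (ih₁ hL).map₂ (ih₂ hL) .pair fun _ _ _ _ _ h₂ => h₂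
  | projReft₁ _ _ _ ih => exact (ih hL).map .proj₁ fun _ _ _ h => h
  | projReft₂ _ _ _ ih => exact (ih hL).map .proj₂ fun _ _ _ h => h
  | foldReft _ _ _ ih => exact (ih hL).map .fold fun _ _ _ h => foldHom_mem_sem_fold h
  | unfoldReft _ _ _ ih => exact (ih hL).map .unfold fun _ _ _ h => h
  | injReft₁ _ _ _ ih => exact (ih hL).map .inj₁ fun _ _ _ h => ⟨_, h, rfl⟩
  | injReft₂ _ _ _ ih => exact (ih hL).map .inj₂ fun _ _ _ h => ⟨_, h, rfl⟩
  | caseReft₁ _ _ _ _ hN ih ih₁ => exact (ih hL).case₁ (ih₁ (congrArg (_ :: ·) hL)) (hL ▸ hN)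
  | caseReft₂ _ _ _ hN _ ih ih₂ => exact (ih hL).case₂ (hL ▸ hN) (ih₂ (congrArg (_ :: ·) hL))
  | fixReft _ _ _ _ ih₁ ih₂ => exact (ih₁ hL).fix (ih₂ (congrArg (_ :: ·) hL))
  | and _ _ _ _ _ ih₁ ih₂ => exact (ih₁ hL).and (ih₂ hL)
  | or _ _ _ _ _ ih₁ ih₂ =>
    exact (ih₁ ((RCtx.under_append_cons _ _ _ _).trans hL)).or
      (ih₂ ((RCtx.under_append_cons _ _ _ _).trans hL))
  | bot _ hM =>
    obtain ⟨d⟩ := hL ▸ hM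
    exact ⟨d, fun _ _ hu => (not_sat_bot hu).elim⟩
  | sub hΓ _ hT ih => exact (ih (hΓ.under_eq.symm.trans hL)).sub hΓ hT

end

end FPC

theorem mainTheorem3 (Γ : FPC.RCtx) (M : FPC.Tm) {A : FPC.PTy} (T : FPC.RT A)
    (h : FPC.Typing Γ M T) : FPC.Sound Γ M T := by
  obtain ⟨d, hd⟩ := h.realizes rfl
  refine ⟨⟨d⟩, fun d' ρ u hu => ?_⟩
  rw [d'.sem_eq d]
  exact hd ρ u (FPC.sat_of_mem Γ u hu)
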